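/- **Setting.** Let $d\ge 1$, $\lambda>0$, $\delta>0$, $\Lambda_N=[-N,N]^d\subseteq\mathbb Z^d$, $\mathcal E_N$ the set of unordered nearest-neighbour pairs in $\Lambda_N$, $I_r=[-r/2,r/2]$ and $K(N,r)=\Lambda_N\times I_r$. There are two regimes. *Positive temperature:* $\beta\in(0,\infty)$ is fixed, $r=r_0=\beta$, and the temporal boundary conditions are $\mathfrak t_1=\mathfrak t_2=\mathfrak p$ (periodic). *Ground state* ($\beta=\infty$): $r=2N$ with $N\ge1$, $r_0=2N_0$, and $\mathfrak t_1=\mathfrak f$ (free), $\mathfrak t_2=\mathfrak w$ (wired). **Correlations.** Let $E$ govern independent rate-$\delta$ Poisson processes $D_x$ on $I_r$ and fair bits $\xi_x\in\{0,1\}$ ($x\in\Lambda_N$); let $\sigma(x,0)=(-1)^{\xi_x}$, and let $\sigma(x,\cdot)$ change sign at the points of $D_x$. Then $$\langle\sigma_{0,0}\sigma_{x,t}\rangle^{\mathfrak s,\mathfrak t}_{N,r}=\frac{E[\sigma(0,0)\sigma(x,t)\,\mathbf 1_{\mathfrak t}\,e^{\lambda H_{\mathfrak s}}]}{E[\mathbf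 1_{\mathfrak t}\,e^{\lambda H_{\mathfrak s}}]},$$ where $H_{\mathfrak f}=\sum_{xy\in\mathcal E_N}\int_{I_r}\sigma(x,t)\sigma(y,t)\,dt$, and $H_{\mathfrak w}$ is the same sum over $\mathcal E_{N+1}$ with $\sigma=+1$ on $\Lambda_{N+1}\setminus\Lambda_N$; $\mathbf 1_{\mathfrak f}=1$, $\mathbf 1_{\mathfrak w}$ is the indicator that $\sigma(x,\pm r/2)=+1$ for all $x\in\Lambda_N$, and $\mathbf 1_{\mathfrak p}$ that $\sigma(x,-r/2)=\sigma(x,r/2)$ for all $x\in\Lambda_N$. **Labellings and $\overline{\mathbb P}_{N,r}$.** Let $\mathbb E_{N,r}$ govern independent Poisson processes on $I_r$: bridges $B_{xy},\hat B_{xy}$ of intensity $\lambda$ ($xy\in\mathcal E_N$); $G_x$ of intensity $\lambda\cdot\#\{y\notin\Lambda_N: y\text{ a nearest neighbour of }x\}$ and cuts $\Delta_x$ of intensity $4\delta$ ($x\in\Lambda_N$); and independent fair bits $\tau_x,\hat\tau_x$. The switching points of the labelling $\psi$ are the endpoints of the bridges of $B$; those of $\hat\psi$ are the endpoints of the bridges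 of $\hat B$ and the points $(x,t)$ with $t\in G_x$. Each labelling assigns "even" or "odd" to the points of $K(N,r)$: on each line $\{x\}\times I_r$ the label switches at the switching points and is constant in between (the odd set being closed). If the temporal boundary condition is $\mathfrak f$, both ends of each line are even; if it is $\mathfrak p$, the label at $(x,0)$ is given by the bit at $x$ (odd if it is $1$); in both cases the configuration is consistent if each line has an even number of switching points. If it is $\mathfrak w$, the labels of the two ends of a line are unconstrained: the label of $(x,-r/2)$ is given by the bit at $x$, and every configuration is consistent. The temporal condition is $\mathfrak t_1$ for $\psi$ and $\mathfrak t_2$ for $\hat\psi$. The weight $\partial\psi$ (or $\partial\hat\psi$) is $e^{2\delta\epsilon}$ with $\epsilon$ the total length of the even set, or $0$ if the configuration is not consistent, and $$\overline{\mathbb P}_{N,r}(A)=\frac{\mathbb E_{N,r}(\mathbf 1_A\,\partial\psi\,\partial\hat\psi)}{\mathbb E_{N,r}(\partial\psi\,\partial\hat\psi)}.$$ **Connectivity.** An open path is a finite alternating sequence of moves along lines and jumps, beginning and ending with a move. A move along the line at $x$ traverses an interval (for $\mathfrak p$: an arc of the circle obtained by identifying the ends of $I_r$) containing no point of $\Delta_x$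 that is even in both labellings. A jump crosses a bridge of $B$ or $\hat B$, or goes from one point of $\hat G$ to another, where $\hat G_x=G_x$ in the positive-temperature regime and $\hat G_x=G_x\cup\{\pm r/2\}$ in the ground-state regime. $\{(0,0)\leftrightarrow\Gamma\}$ is the event that some open path joins $(0,0)$ to a point of $\hat G$. An event is defined in $J\subseteq K(N,r)$ if it is measurable with respect to the restrictions of $B,\hat B,G,\Delta,\psi,\hat\psi$ to $J$ (a bridge is in $J$ if at least one of its endpoints is). **Proposition.** In each of the two regimes: (A) For each $(x,t)$ (with $t\in I_\beta$ in the positive-temperature regime) there is a constant $C_{(x,t)}$, depending only on $(x,t),d,\lambda,\delta$ and $\beta$, such that for all $N$ with $(x,t)\in K(N,r)$ $$\langle\sigma_{0,0}\sigma_{x,t}\rangle^{\mathfrak w,\mathfrak t_2}_{N,r}-\langle\sigma_{0,0}\sigma_{x,t}\rangle^{\mathfrak f,\mathfrak t_1}_{N,r}\le C_{(x,t)}\,\overline{\mathbb P}_{N,r}\big((0,0)\leftrightarrow\Gamma\big).$$ (B) For each $N_0\ge0$ there is a constant $c=c(N_0,r_0)$, depending only on $N_0,r_0,d,\lambda,\delta$,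 such that for all $N>N_0$ and every event $A$ defined in $K(N,r)\setminus K(N_0,r_0)$, $$\overline{\mathbb P}_{N,r}(A)\le c\,\overline{\mathbb P}_{N,r}(A\cap\mathcal C),$$ where $\mathcal C$ is the event that there is an open path inside $K(N_0,r_0)$ between every pair of points of $K(N_0,r_0)$. -/

import Mathlib

open MeasureTheory Set

namespace TFIM

noncomputable section

/-! ### Lattice, boxes, edges -/

/-- The lattice `ℤ^d`. -/
abbrev Lattice (d : ℕ) : Type := Fin d → ℤ

/-- The box `Λ_N = [-N, N]^d`. -/
def box (d N : ℕ) : Finset (Lattice d) :=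
  Fintype.piFinset fun _ => Finset.Icc (-(N : ℤ)) (N : ℤ)

/-- Nearest neighbours: `ℓ¹`-distance one. -/
def Nbr {d : ℕ} (x y : Lattice d) : Prop := ∑ i, |x i - y i| = 1

open Classical in
/-- The nearest-neighbour pairs inside `Λ_N`. Two nearest neighbours are always comparable in the
coordinatewise order, so each unordered pair `{x, y}` is listed exactly once, as `(x, y)` with
`x < y`. -/
def edges (d N : ℕ) : Finset (Lattice d × Lattice d) :=
  (box d N ×ˢ box d N).filter fun e => e.1 < e.2 ∧ Nbr e.1 e.2

/-- The sites of `Λ_N`, as a type. -/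
abbrev Site (d N : ℕ) : Type := {x : Lattice d // x ∈ box d N}

/-- The nearest-neighbour pairs of `Λ_N`, as a type. -/
abbrev Edge (d N : ℕ) : Type := {e : Lattice d × Lattice d // e ∈ edges d N}

/-- The time interval `I_r = [-r/2, r/2]`. -/
def timeI (r : ℝ) : Set ℝ := Icc (-r / 2) (r / 2)

/-- `K(N₀, r₀) = Λ_{N₀} × I_{r₀}`, as a subset of `Λ_N × ℝ`. -/
def subBox {d : ℕ} (N N₀ : ℕ) (r₀ : ℝ) : Set (Site d N × ℝ) :=
  {p | p.1.1 ∈ box d N₀ ∧ p.2 ∈ timeI r₀}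

open Classical in
/-- The number of nearest neighbours of `x ∈ Λ_N` outside `Λ_N`. It vanishes unless
`x ∈ ∂Λ_N`. -/
def outDegree {d N : ℕ} (x : Site d N) : ℕ :=
  ((box d (N + 1)).filter fun y => y ∉ box d N ∧ Nbr x.1 y).card

/-! ### Poisson processes -/

/-- Finite point configurations on the line: a number `n` and `n` points. -/
abbrev Config : Type := Σ n : ℕ, (Fin n → ℝ)

/-- The set of points of a configuration. -/
def Config.points (c : Config) : Set ℝ := Set.range c.2

/-- The number of points of a configuration in the set `U`. -/
def Config.count (c : Config) (U : Set ℝ) : ℕ := {i | c.2 i ∈ U}.ncard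

/-- The configuration without points. -/
def Config.empty : Config := ⟨0, Fin.elim0⟩

/-- The law of a Poisson process of intensity `a` on `I_r`: with probability
`e^{-ar} (ar)^n / n!` there are `n` points, and these are independent and uniform on `I_r`
(so that the law restricted to `n` points is `e^{-ar} a^n / n!` times Lebesgue measure on
`I_r^n`). -/
def poissonLaw (a r : ℝ) : Measure Config :=
  Measure.sum fun n : ℕ =>
    ENNReal.ofReal (Real.exp (-(a * r)) * a ^ n / (n.factorial : ℝ)) •
      (Measure.pi fun _ : Fin n => (volume.restrict (timeI r))).map
        (fun p => (⟨n, p⟩ : Config))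

/-- A fair coin. -/
def coinLaw : Measure Bool := ProbabilityTheory.uniformOn Set.univ

/-! ### Boundary conditions -/

/-- Spatial boundary conditions. -/
inductive SpatialBC
  | free
  | wired

/-- Temporal boundary conditions. -/
inductive TemporalBC
  | free
  | wired
  | periodic

/-! ### The space-time spin representation and its two-point functions -/

/-- The randomness of the spin representation in `K(N, r)`: flip times `D_x` and initial
bits `ξ_x`. -/
abbrev SpinSpace (d N : ℕ) : Type := (Site d N → Config) × (Site d N → Bool)

/-- The a-priori measure: independent Poisson processes of rate `δ` on `I_r` and fair bits. -/
def spinLaw (d : ℕ) (δ : ℝ) (N : ℕ) (r : ℝ) : Measure (SpinSpace d N) :=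
  (Measure.pi fun _ => poissonLaw δ r).prod (Measure.pi fun _ => coinLaw)

open Classical in
/-- The spin `σ(x, t)`: it equals `(-1)^{ξ_x}` at time `0` and flips at the points of `D_x`.
Outside `Λ_N` it is `+1`; this is used only for the wired spatial boundary condition. -/
def spin {d N : ℕ} (ω : SpinSpace d N) (x : Lattice d) (t : ℝ) : ℝ :=
  if h : x ∈ box d N then
    (-1) ^ ((ω.2 ⟨x, h⟩).toNat +
      if 0 ≤ t then (ω.1 ⟨x, h⟩).count (Ioc 0 t) else (ω.1 ⟨x, h⟩).count (Ioc t 0))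
  else 1

/-- `∑ ∫_{I_r} σ(x,t) σ(y,t) dt`, over the pairs of `Λ_N` (free) or of `Λ_{N+1}` with spins `+1`
on `∂Λ_{N+1}` (wired). -/
def interaction {d N : ℕ} (s : SpatialBC) (r : ℝ) (ω : SpinSpace d N) : ℝ :=
  match s with
  | .free => ∑ e ∈ edges d N, ∫ t in timeI r, spin ω e.1 t * spin ω e.2 t
  | .wired => ∑ e ∈ edges d (N + 1), ∫ t in timeI r, spin ω e.1 t * spin ω e.2 t

/-- The restriction on the spins at times `±r/2`. -/
def TemporalOK {d N : ℕ} (b : TemporalBC) (r : ℝ) (ω : SpinSpace d N) : Prop :=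
  match b with
  | .free => True
  | .wired => ∀ x ∈ box d N, spin ω x (-r / 2) = 1 ∧ spin ω x (r / 2) = 1
  | .periodic => ∀ x ∈ box d N, spin ω x (-r / 2) = spin ω x (r / 2)

open Classical in
/-- The unnormalised density of the space-time Ising measure with respect to the a-priori
measure. -/
def spinDensity {d N : ℕ} (lam : ℝ) (s : SpatialBC) (b : TemporalBC) (r : ℝ)
    (ω : SpinSpace d N) : ℝ :=
  if TemporalOK b r ω then Real.exp (lam * interaction s r ω) else 0

/-- The two-point function `⟨σ_{0,0} σ_{x,t}⟩_{N,r}^{s,b}`. -/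
def twoPoint (d : ℕ) (lam δ : ℝ) (s : SpatialBC) (b : TemporalBC) (N : ℕ) (r : ℝ)
    (x : Lattice d) (t : ℝ) : ℝ :=
  (∫ ω, spin ω 0 0 * spin ω x t * spinDensity lam s b r ω ∂(spinLaw d δ N r)) /
    ∫ ω, spinDensity lam s b r ω ∂(spinLaw d δ N r)

/-! ### The random-parity representation -/

/-- The number of switching points `(x, t)`, `t ∈ U`: endpoints of bridges and points of `G_x`.
(Almost surely no two of these coincide.) -/
def switchCount {d N : ℕ} (B : Edge d N → Config) (G : Site d N → Config) (x : Site d N)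
    (U : Set ℝ) : ℕ :=
  (∑ e : Edge d N, if e.1.1 = x.1 ∨ e.1.2 = x.1 then (B e).count U else 0) + (G x).count U

/-- The parity (even number: label "even") of the label at the lower end `(x, -r/2)` of a line,
where `S U` is the number of switching points of the line in `U`. Free: even. Periodic: such that
the label at `(x, 0)` is given by the coin. Wired: given by the coin, since the lower end and the
upper end of the line are then both attached to the ghost site, and their labels are not
constrained. -/
def startParity (b : TemporalBC) (r : ℝ) (coin : Bool) (S : Set ℝ → ℕ) : ℕ :=
  match b with
  | .free => 0
  | .wired => coin.toNat
  | .periodic => coin.toNat + S (Ico (-r / 2) 0)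

/-- The point at height `t` is labelled "odd". Labels switch at the switching points and are
constant in between, and the odd set is closed: a switching point is odd, being the
endpoint of an odd interval. -/
def IsOdd (b : TemporalBC) (r : ℝ) (coin : Bool) (S : Set ℝ → ℕ) (t : ℝ) : Prop :=
  Odd (startParity b r coin S + S (Ico (-r / 2) t)) ∨
    Odd (startParity b r coin S + S (Icc (-r / 2) t))

/-- Consistency of the switching points (without sources): an even number on each line. For the
wired temporal boundary condition, where both ends of each line are attached to the ghost site,
there is no constraint. -/
def Consistent {d N : ℕ} (b : TemporalBC) (r : ℝ) (S : Site d N → Set ℝ → ℕ) : Prop :=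
  match b with
  | .free => ∀ x, Even (S x (timeI r))
  | .wired => True
  | .periodic => ∀ x, Even (S x (timeI r))

open Classical in
/-- The weight `e^{2δε}` of a labelling, `ε` being the total length of the even set; it is zero
if the switching points are not consistent. -/
def weight {d N : ℕ} (δ : ℝ) (b : TemporalBC) (r : ℝ) (coin : Site d N → Bool)
    (S : Site d N → Set ℝ → ℕ) : ℝ :=
  if Consistent b r S then
    Real.exp (2 * δ * ∑ x, (volume {t ∈ timeI r | ¬ IsOdd b r (coin x) (S x) t}).toReal)
  else 0

/-- The configuration space for a pair of labellings together with a process of cuts. -/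
structure Pair (d N : ℕ) where
  /-- bridges `B` -/
  B : Edge d N → Config
  /-- coins `τ` -/
  coin : Site d N → Bool
  /-- bridges `B̂` -/
  B' : Edge d N → Config
  /-- points `G`, attached to the ghost site -/
  G : Site d N → Config
  /-- coins `τ̂` -/
  coin' : Site d N → Bool
  /-- cuts `Δ` -/
  cuts : Site d N → Config

/-- The components of a `Pair` as a tuple. -/
def Pair.toProd {d N : ℕ} (ω : Pair d N) :
    ((Edge d N → Config) × (Site d N → Bool)) ×
      ((Edge d N → Config) × (Site d N → Config) × (Site d N → Bool)) × (Site d N → Config) :=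
  ((ω.B, ω.coin), (ω.B', ω.G, ω.coin'), ω.cuts)

/-- The `Pair` with given components. -/
def Pair.ofProd {d N : ℕ}
    (p : ((Edge d N → Config) × (Site d N → Bool)) ×
      ((Edge d N → Config) × (Site d N → Config) × (Site d N → Bool)) × (Site d N → Config)) :
    Pair d N :=
  ⟨p.1.1, p.1.2, p.2.1.1, p.2.1.2.1, p.2.1.2.2, p.2.2⟩

instance {d N : ℕ} : MeasurableSpace (Pair d N) := MeasurableSpace.comap Pair.toProd inferInstance

/-- The measure `𝔼_{N,r}`: all components are independent, `B`, `B̂` have intensity `λ`, `G_x` has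
intensity `λ` times the number of neighbours of `x` outside `Λ_N`, the cuts have
intensity `4δ`, and the coins are fair. -/
def pairLaw (d : ℕ) (lam δ : ℝ) (N : ℕ) (r : ℝ) : Measure (Pair d N) :=
  (((Measure.pi fun _ => poissonLaw lam r).prod (Measure.pi fun _ => coinLaw)).prod
    (((Measure.pi fun _ => poissonLaw lam r).prod
      ((Measure.pi fun x : Site d N => poissonLaw (lam * (outDegree x : ℝ)) r).prod
        (Measure.pi fun _ => coinLaw))).prod
      (Measure.pi fun _ => poissonLaw (4 * δ) r))).map Pair.ofProd

/-- The two regimes: positive temperature, with periodic temporal boundary conditions for both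
labellings, and ground state, with free (first labelling) and wired (second labelling)
temporal boundary conditions. -/
inductive Regime
  | thermal
  | ground

/-- Temporal boundary condition of the first labelling. -/
def Regime.bc₁ : Regime → TemporalBC
  | .thermal => .periodic
  | .ground => .free

/-- Temporal boundary condition of the second labelling. -/
def Regime.bc₂ : Regime → TemporalBC
  | .thermal => .periodic
  | .ground => .wired

/-- Switching points of the first labelling `ψ` (spatially free). -/
def Pair.S {d N : ℕ} (ω : Pair d N) (x : Site d N) (U : Set ℝ) : ℕ :=
  switchCount ω.B (fun _ => Config.empty) x U

/-- Switching points of the second labelling `ψ̂` (spatially wired). -/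
def Pair.S' {d N : ℕ} (ω : Pair d N) (x : Site d N) (U : Set ℝ) : ℕ :=
  switchCount ω.B' ω.G x U

/-- The point `p` is odd in `ψ`. -/
def Pair.Odd₁ {d N : ℕ} (R : Regime) (r : ℝ) (ω : Pair d N) (p : Site d N × ℝ) : Prop :=
  IsOdd R.bc₁ r (ω.coin p.1) (ω.S p.1) p.2

/-- The point `p` is odd in `ψ̂`. -/
def Pair.Odd₂ {d N : ℕ} (R : Regime) (r : ℝ) (ω : Pair d N) (p : Site d N × ℝ) : Prop :=
  IsOdd R.bc₂ r (ω.coin' p.1) (ω.S' p.1) p.2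

/-- The product of the weights of the two labellings. -/
def pairWeight {d N : ℕ} (δ : ℝ) (R : Regime) (r : ℝ) (ω : Pair d N) : ℝ :=
  weight δ R.bc₁ r ω.coin ω.S * weight δ R.bc₂ r ω.coin' ω.S'

/-- The measure `P̄_{N,r}`: the measure `𝔼_{N,r}`, weighted by the product of the weights of the
two labellings and normalised. -/
def Pbar (d : ℕ) (lam δ : ℝ) (R : Regime) (N : ℕ) (r : ℝ) : Measure (Pair d N) :=
  (∫⁻ ω, ENNReal.ofReal (pairWeight δ R r ω) ∂(pairLaw d lam δ N r))⁻¹ •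
    (pairLaw d lam δ N r).withDensity fun ω => ENNReal.ofReal (pairWeight δ R r ω)

/-! ### Open paths -/

/-- A cut at a point which is even in both labellings. -/
def Blocked {d N : ℕ} (R : Regime) (r : ℝ) (ω : Pair d N) (p : Site d N × ℝ) : Prop :=
  p.2 ∈ (ω.cuts p.1).points ∧ ¬ ω.Odd₁ R r p ∧ ¬ ω.Odd₂ R r p

/-- The sets that may be traversed between heights `s` and `t` of a line: the interval between
them and, in the periodic case, also the complementary arc of the circle. -/
def arcs (R : Regime) (r s t : ℝ) : Set (Set ℝ) :=
  match R with
  | .thermal => {uIcc s t, Icc (-r / 2) (min s t) ∪ Icc (max s t) (r / 2)}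
  | .ground => {uIcc s t}

/-- One can move from `p` to `q` along a line, inside `J` and without being blocked. -/
def Segment {d N : ℕ} (R : Regime) (r : ℝ) (ω : Pair d N) (J : Set (Site d N × ℝ))
    (p q : Site d N × ℝ) : Prop :=
  p.1 = q.1 ∧ ∃ I ∈ arcs R r p.2 q.2, ∀ u ∈ I, (p.1, u) ∈ J ∧ ¬ Blocked R r ω (p.1, u)

/-- The points of the line at `x` attached to the ghost site `Γ`: `G_x` and, in the ground state
regime, the two ends of the line. -/
def ghost {d N : ℕ} (R : Regime) (r : ℝ) (ω : Pair d N) (x : Site d N) : Set ℝ :=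
  match R with
  | .thermal => (ω.G x).points
  | .ground => (ω.G x).points ∪ {-r / 2, r / 2}

/-- One can jump from `p` to `q`: across a bridge, or via the ghost site. -/
def Jump {d N : ℕ} (R : Regime) (r : ℝ) (ω : Pair d N) (p q : Site d N × ℝ) : Prop :=
  (p.2 = q.2 ∧ ∃ e : Edge d N,
      (e.1 = (p.1.1, q.1.1) ∨ e.1 = (q.1.1, p.1.1)) ∧
        p.2 ∈ (ω.B e).points ∪ (ω.B' e).points) ∨
    (p.2 ∈ ghost R r ω p.1 ∧ q.2 ∈ ghost R r ω q.1)

/-- There is an open path from the first to the second point inside `J`: an alternating sequence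
of segments and jumps which begins and ends with a segment. -/
inductive OpenPath {d N : ℕ} (R : Regime) (r : ℝ) (ω : Pair d N) (J : Set (Site d N × ℝ)) :
    Site d N × ℝ → Site d N × ℝ → Prop
  | single {p q : Site d N × ℝ} : Segment R r ω J p q → OpenPath R r ω J p q
  | cons {p p₁ p₂ q : Site d N × ℝ} : Segment R r ω J p p₁ → Jump R r ω p₁ p₂ →
      OpenPath R r ω J p₂ q → OpenPath R r ω J p q

theorem zero_mem_box (d N : ℕ) : (0 : Lattice d) ∈ box d N := by
  simp [box]

/-- The event `{(0,0) ↔ Γ}`. -/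
def connGhost (d : ℕ) (R : Regime) (N : ℕ) (r : ℝ) : Set (Pair d N) :=
  {ω | ∃ q : Site d N × ℝ, q.2 ∈ ghost R r ω q.1 ∧
    OpenPath R r ω (subBox N N r) (⟨0, zero_mem_box d N⟩, 0) q}

/-- The event `𝒞` that any two points of `K(N₀, r₀)` are joined by an open path inside
`K(N₀, r₀)`. -/
def fullyConnected (d : ℕ) (R : Regime) (N : ℕ) (r : ℝ) (N₀ : ℕ) (r₀ : ℝ) : Set (Pair d N) :=
  {ω | ∀ p ∈ subBox N N₀ r₀, ∀ q ∈ subBox N N₀ r₀, OpenPath R r ω (subBox N N₀ r₀) p q}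

/-! ### Events defined in a region -/

/-- The times `t ∈ U` for which a bridge between the endpoints of `e` at time `t` meets `J`. -/
def bridgeWindow {d N : ℕ} (J : Set (Site d N × ℝ)) (e : Edge d N) (U : Set ℝ) : Set ℝ :=
  {t ∈ U | ∃ x : Site d N, (e.1.1 = x.1 ∨ e.1.2 = x.1) ∧ (x, t) ∈ J}

/-- The times `t ∈ U` with `(x, t) ∈ J`. -/
def siteWindow {d N : ℕ} (J : Set (Site d N × ℝ)) (x : Site d N) (U : Set ℝ) : Set ℝ :=
  {t ∈ U | (x, t) ∈ J}

/-- The σ-algebra of the events defined in `J`: it is generated by the restrictions of the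
processes `B`, `B̂`, `G`, `Δ` and of the labellings `ψ`, `ψ̂` to `J`. A bridge counts as being in
`J` as soon as one of its endpoints is. -/
@[reducible]
def definedIn {d N : ℕ} (R : Regime) (r : ℝ) (J : Set (Site d N × ℝ)) :
    MeasurableSpace (Pair d N) :=
  MeasurableSpace.generateFrom
    ({A | ∃ (e : Edge d N) (U : Set ℝ) (k : ℕ), MeasurableSet U ∧
          (A = {ω | (ω.B e).count (bridgeWindow J e U) = k} ∨
           A = {ω | (ω.B' e).count (bridgeWindow J e U) = k})} ∪
     {A | ∃ (x : Site d N) (U : Set ℝ) (k : ℕ), MeasurableSet U ∧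
          (A = {ω | (ω.G x).count (siteWindow J x U) = k} ∨
           A = {ω | (ω.cuts x).count (siteWindow J x U) = k})} ∪
     {A | ∃ p ∈ J, A = {ω | ω.Odd₁ R r p} ∨ A = {ω | ω.Odd₂ R r p}})

end

end TFIM

/-! The difference of the two correlations is a difference of partition functions of pairs of
labellings. A switching argument cancels all of it except the contribution of configurations in
which the origin is connected to the ghost. A local modification of the configuration then removes
the sources; the same modification without sources gives (B).

Random parity. The Laplace functional of a Poisson process, read backwards (`exp_mul_integral`),
expands the exponential of the interaction into bridges, and into points of `G` where the outer
spins are `+1`. The flips and bits are then averaged line by line (`integral_line`): a line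
contributes the exponential of `-2δ` times its odd length, provided it satisfies the parity
constraint of the temporal boundary condition. By `twoPoint_sub_eq` the difference of correlations
is `(Z(∅, s) - Z(s, ∅)) / Z(∅, ∅)`, where `s` denotes sources at `(0,0)` and `(x,t)` and the two
slots are the sources of the two labellings.

Switching. Take a pair with the sources in the second labelling, and let `C` be the set of points
reachable from the origin. Along a line `C` can end only at cuts where both labels are even, so
exchanging the two labellings inside `C` produces again a consistent pair (`even_switches_inter`,
`LineSwap`). If `C` misses the ghost, a handshake argument forces the second source into `C`, so
both sources move to the first labelling, while the weight and the cluster stay the same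
(`swap_cluster`). Both kinds of bridges have the same intensity, so the exchange is a
measure-preserving recolouring of marked points. It is injective because `C` can be read off from
the image. Summing over all recolourings and coins (`sum_recol_le`) bounds `Z(∅, s) - Z(s, ∅)` by
the part of `Z(∅, s)` in which the origin is connected to the ghost (`lintegral_srcWeight_le`).

Resampling. Inside a fixed box containing both sources, delete all cuts, put one or two bridges of
each kind on every edge, and shift the parities of the second kind along a path joining `0` to `x`.
This absorbs the sources, does not change the labels outside the box, costs a bounded factor in the
weight, makes the box fully connected, and keeps connections to the ghost (`Resample`). A good inner
configuration with prescribed parities has probability bounded below independently of `N`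
(`innerBound_le`), so `exists_resample_bound` gives a constant independent of `N`. For (B) no parity
is shifted, and an event defined outside the box does not notice the change (`Resample.mem_iff`).

Configurations are ordered tuples, so all weights and events have to be invariant under reordering.
Connectivity events are handled by measurable majorants and hulls, without showing that they are
measurable. -/

namespace TFIM
noncomputable section
open scoped ENNReal

/-! ### Finite configurations in a measurable space -/

/-- Finite ordered configurations of points of `X`. -/
abbrev PConf (X : Type*) : Type _ := Σ n : ℕ, (Fin n → X)

namespace PConf
variable {X Y Z W : Type*}

/-- The points of a configuration, as a list. -/
def toList (c : PConf X) : List X := List.ofFn c.2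

/-- The configuration with the given list of points. -/
def ofList (l : List X) : PConf X := ⟨l.length, l.get⟩

@[simp] lemma toList_ofList (l : List X) : (ofList l).toList = l := by
  simp [ofList, toList]

@[simp] lemma ofList_toList (c : PConf X) : ofList c.toList = c :=
  List.equivSigmaTuple.right_inv c

/-- Identities between configurations are checked after applying `toList`, where the lemmas on
`filter`, append and permutations are available. -/
lemma toList_injective : Function.Injective (toList : PConf X → List X) :=
  Function.LeftInverse.injective ofList_toList

/-- Adding a point in front. -/
def cons (x : X) (c : PConf X) : PConf X := ⟨c.1 + 1, Fin.cons x c.2⟩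

@[simp] lemma toList_cons (x : X) (c : PConf X) : (cons x c).toList = x :: c.toList := by
  simp [cons, toList, List.ofFn_succ]

/-- The number of points in the set `U`. -/
def cnt (c : PConf X) (U : Set X) : ℕ := {i | c.2 i ∈ U}.ncard

open Classical in
lemma cnt_eq_sum (c : PConf X) (U : Set X) : c.cnt U = ∑ i, if c.2 i ∈ U then 1 else 0 := by
  rw [cnt, Set.ncard_eq_toFinset_card', Finset.sum_boole]
  simp only [Nat.cast_id]
  congr 1
  ext i; simp

open Classical in
lemma cnt_eq_countP (c : PConf X) (U : Set X) :
    c.cnt U = c.toList.countP (fun x => decide (x ∈ U)) := by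
  rw [cnt_eq_sum]
  obtain ⟨n, v⟩ := c
  simp only [toList]
  induction n with
  | zero => simp
  | succ n ih =>
    rw [Fin.sum_univ_succ, List.ofFn_succ, List.countP_cons, ih (fun i => v i.succ), add_comm]
    simp

open Classical in
/-- The subconfiguration of the points in `U`. -/
def filt (U : Set X) (c : PConf X) : PConf X := ofList (c.toList.filter fun x => decide (x ∈ U))

@[simp] lemma toList_filt [DecidablePred (· ∈ (U : Set X))] (c : PConf X) :
    (filt U c).toList = c.toList.filter fun x => decide (x ∈ U) := by
  simp only [filt, toList_ofList]
  congr!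

lemma filt_cons_of_mem {U : Set X} {x : X} (h : x ∈ U) (c : PConf X) :
    filt U (cons x c) = cons x (filt U c) := by
  classical
  apply toList_injective
  simp [h]

lemma filt_cons_of_notMem {U : Set X} {x : X} (h : x ∉ U) (c : PConf X) :
    filt U (cons x c) = filt U c := by
  classical
  apply toList_injective
  simp [h]

/-- Juxtaposition. -/
def join (a b : PConf X) : PConf X := ⟨a.1 + b.1, Fin.append a.2 b.2⟩

@[simp] lemma toList_join (a b : PConf X) : (join a b).toList = a.toList ++ b.toList := by
  simp [join, toList, List.ofFn_fin_append]

/-- The image of a configuration. -/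
def map (f : X → Y) (c : PConf X) : PConf Y := ⟨c.1, f ∘ c.2⟩

lemma cnt_map (f : X → Y) (c : PConf X) (U : Set Y) : (map f c).cnt U = c.cnt (f ⁻¹' U) := rfl

lemma cnt_filt (V U : Set X) (c : PConf X) : (filt V c).cnt U = c.cnt (V ∩ U) := by
  classical
  rw [cnt_eq_countP, cnt_eq_countP, toList_filt, List.countP_filter]
  congr 1
  ext x; by_cases h : x ∈ V <;> simp [h]

lemma cnt_join (a b : PConf X) (U : Set X) : (join a b).cnt U = a.cnt U + b.cnt U := by
  classical
  simp [cnt_eq_countP]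

lemma cnt_congr_perm {c c' : PConf X} (h : c.toList.Perm c'.toList) (U : Set X) :
    c.cnt U = c'.cnt U := by
  classical
  rw [cnt_eq_countP, cnt_eq_countP, h.countP_eq]

lemma filt_filt (U V : Set X) (c : PConf X) : filt V (filt U c) = filt (U ∩ V) c := by
  classical
  apply toList_injective
  rw [toList_filt, toList_filt, toList_filt, List.filter_filter]
  congr 1; ext x; by_cases h : x ∈ U <;> simp [h]

/-- Reordering of a configuration with `n` points. -/
def reorder (c : PConf X) (σ : Equiv.Perm (Fin c.1)) : PConf X := ⟨c.1, c.2 ∘ σ⟩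

lemma toList_reorder_perm (c : PConf X) (σ : Equiv.Perm (Fin c.1)) :
    (c.reorder σ).toList.Perm c.toList :=
  σ.ofFn_comp_perm c.2

/-- Splitting a tuple at `U` and joining the parts loses only the order: the permutation lists the
indices of the points in `U` before the others. This is why invariance under `reorder` is required
when points are resampled. -/
lemma exists_reorder (U : Set X) (c : PConf X) :
    ∃ σ, c = (join (filt U c) (filt Uᶜ c)).reorder σ := by
  classical
  obtain ⟨n, v⟩ := c
  set L := (List.finRange n).filter (fun i => decide (v i ∈ U)) ++
    (List.finRange n).filter (fun i => ! decide (v i ∈ U)) with hL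
  have hp : L.Perm (List.finRange n) := List.filter_append_perm _ _
  have hnd : L.Nodup := hp.nodup_iff.2 (List.nodup_finRange n)
  have hmem : ∀ i, i ∈ L := fun i => hp.mem_iff.2 (List.mem_finRange i)
  have hj : join (filt U ⟨n, v⟩) (filt Uᶜ ⟨n, v⟩) = ofList (L.map v) := by
    apply toList_injective
    rw [toList_join, toList_filt, toList_filt, toList_ofList]
    simp [toList, List.ofFn_eq_map, hL, List.filter_map, Function.comp_def]
  rw [hj]
  have hlen : L.length = n := by simpa using hp.length_eq
  let e := hnd.getEquivOfForallMemList L hmem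
  have hlen' : (ofList (L.map v)).1 = n := by simp [ofList, hlen]
  let σ : Fin (ofList (L.map v)).1 ≃ Fin (ofList (L.map v)).1 :=
    (finCongr hlen').trans (e.symm.trans (finCongr (by simp [ofList])))
  refine ⟨σ, ?_⟩
  apply toList_injective
  simp only [reorder, toList]
  rw [List.ofFn_congr hlen']
  congr 1
  ext i
  have h1 : L.get (e.symm i) = i := e.apply_symm_apply i
  have h2 : (L.map v).get (Fin.cast (by simp) (e.symm i)) = v (L.get (e.symm i)) := by simp
  rw [h1] at h2
  exact h2.symm

/-- The configuration with the given points. -/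
abbrev mk (n : ℕ) (v : Fin n → X) : PConf X := ⟨n, v⟩

lemma mk_injective (n : ℕ) : Function.Injective (mk (X := X) n) :=
  fun _ _ h => eq_of_heq (Sigma.mk.inj h).2

lemma mk_succ_eq_cons (n : ℕ) (v : Fin (n + 1) → X) :
    mk (n + 1) v = cons (v 0) (mk n (Fin.tail v)) := by
  simp [cons]

section Measurability
variable [MeasurableSpace X] [MeasurableSpace Y] [MeasurableSpace Z] [MeasurableSpace W]

lemma measurableSet_iff {s : Set (PConf X)} :
    MeasurableSet s ↔ ∀ n, MeasurableSet (mk (X := X) n ⁻¹' s) := by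
  rw [MeasurableSpace.measurableSet_iInf]
  rfl

lemma measurable_mk (n : ℕ) : Measurable (mk (X := X) n) :=
  fun _ hs => measurableSet_iff.1 hs n

lemma measurable_iff {f : PConf X → W} :
    Measurable f ↔ ∀ n, Measurable fun v : Fin n → X => f ⟨n, v⟩ := by
  refine ⟨fun h n => h.comp (measurable_mk n), fun h s hs => measurableSet_iff.2 fun n => ?_⟩
  exact h n hs

lemma measurableEmbedding_mk (n : ℕ) :
    MeasurableEmbedding (mk (X := X) n) where
  injective := (mk_injective _)
  measurable := measurable_mk n
  measurableSet_image' := fun {s} hs => by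
    rw [measurableSet_iff]
    intro m
    by_cases h : m = n
    · subst h
      rwa [Set.preimage_image_eq _ (mk_injective _)]
    · convert MeasurableSet.empty
      ext v
      simp only [mem_preimage, mem_image, mem_empty_iff_false, iff_false, not_exists, not_and]
      intro w _ hw
      exact h (congrArg Sigma.fst hw).symm

/-- The product is a countable union of the pieces with exactly `n` points, each of which is
measurably embedded. -/
lemma measurable_prod_iff {f : Z × PConf X → W} (h : ∀ n, Measurable fun p : Z × (Fin n → X) =>
    f (p.1, ⟨n, p.2⟩)) : Measurable f := by
  intro s hs
  have : f ⁻¹' s = ⋃ n, Prod.map id (mk n) ''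
      ((fun p : Z × (Fin n → X) => f (p.1, ⟨n, p.2⟩)) ⁻¹' s) := by
    ext ⟨z, n, v⟩
    simp only [mem_preimage, mem_iUnion, mem_image, Prod.exists, Prod.map_apply, id]
    constructor
    · intro h; exact ⟨n, z, v, h, rfl⟩
    · rintro ⟨m, z', v', h, e⟩
      rw [← e]; exact h
  rw [this]
  exact MeasurableSet.iUnion fun n =>
    (MeasurableEmbedding.id.prodMap (measurableEmbedding_mk n)).measurableSet_image.2 (h n hs)

lemma measurable_cons : Measurable fun p : X × PConf X => cons p.1 p.2 := by
  apply measurable_prod_iff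
  intro n
  refine (measurable_mk (n + 1)).comp (measurable_pi_iff.2 fun i => ?_)
  refine Fin.cases ?_ (fun j => ?_) i
  · simpa using measurable_fst
  · simpa using (measurable_pi_apply j).fun_comp measurable_snd

lemma measurable_filt {U : Set X} (hU : MeasurableSet U) : Measurable (filt U) := by
  classical
  rw [measurable_iff]
  intro n
  induction n with
  | zero =>
    have : ∀ v : Fin 0 → X, filt U ⟨0, v⟩ = filt U ⟨0, Fin.elim0⟩ := fun v => by
      congr 2; exact Subsingleton.elim _ _
    simp only [this]
    exact measurable_const
  | succ n ih =>
    have : ∀ v : Fin (n + 1) → X, filt U ⟨n + 1, v⟩ =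
        if v 0 ∈ U then cons (v 0) (filt U ⟨n, Fin.tail v⟩) else filt U ⟨n, Fin.tail v⟩ := by
      intro v
      rw [show (⟨n + 1, v⟩ : PConf X) = _ from mk_succ_eq_cons n v]
      split_ifs with h
      · exact filt_cons_of_mem h _
      · exact filt_cons_of_notMem h _
    simp only [this]
    have ht : Measurable fun v : Fin (n + 1) → X => filt U ⟨n, Fin.tail v⟩ :=
      ih.comp (measurable_pi_iff.2 fun i => measurable_pi_apply _)
    refine Measurable.ite (measurable_pi_apply 0 hU) ?_ ht
    exact measurable_cons.comp ((measurable_pi_apply 0).prodMk ht)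

lemma measurable_map {f : X → Y} (hf : Measurable f) : Measurable (map f) := by
  rw [measurable_iff]
  intro n
  exact (measurable_mk n).comp (measurable_pi_iff.2 fun i => hf.comp (measurable_pi_apply i))

lemma measurable_join : Measurable fun p : PConf X × PConf X => join p.1 p.2 := by
  apply measurable_prod_iff
  intro m
  suffices h : Measurable fun p : (Fin m → X) × PConf X => join p.2 ⟨m, p.1⟩ from
    h.comp measurable_swap
  apply measurable_prod_iff
  intro n
  refine (measurable_mk (n + m)).comp (measurable_pi_iff.2 fun i => ?_)
  refine Fin.addCases (fun j => ?_) (fun j => ?_) i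
  · simpa using (measurable_pi_apply j).fun_comp measurable_snd
  · simpa using (measurable_pi_apply j).fun_comp measurable_fst

/-- The counting set is allowed to vary with a parameter, since a label at height `t` counts points
in sets such as `[-r/2, t)` and its measurability is needed jointly in `t` and the configuration. -/
lemma measurable_cnt_prod {D : Set (Z × X)} (hD : MeasurableSet D) :
    Measurable fun p : Z × PConf X => p.2.cnt {x | (p.1, x) ∈ D} := by
  classical
  apply measurable_prod_iff
  intro n
  have h : (fun p : Z × (Fin n → X) => (mk n p.2).cnt {x | (p.1, x) ∈ D}) =
      fun p => ∑ i : Fin n, if (p.1, p.2 i) ∈ D then 1 else 0 := by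
    ext p; rw [cnt_eq_sum]; rfl
  rw [h]
  refine Finset.measurable_fun_sum _ fun i _ => ?_
  exact Measurable.ite
    ((measurable_fst.prodMk ((measurable_pi_apply i).comp measurable_snd)) hD)
    measurable_const measurable_const

lemma measurable_cnt {U : Set X} (hU : MeasurableSet U) : Measurable fun c : PConf X => c.cnt U :=
  (measurable_cnt_prod (Z := Unit) (D := {p | p.2 ∈ U}) (measurable_snd hU)).comp
    (measurable_const (a := ()) |>.prodMk measurable_id)

end Measurability
end PConf
end
end TFIM

namespace TFIM
noncomputable section
open scoped ENNReal
namespace PConf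
variable {X Y Z W : Type*} [MeasurableSpace X] [MeasurableSpace Y]

/-! ### Poisson measures -/

/-- The measure `∑ μ^n / n!`. -/
def expMeas (μ : Measure X) : Measure (PConf X) :=
  Measure.sum fun n : ℕ => ((n.factorial : ℝ≥0∞)⁻¹) • (Measure.pi fun _ : Fin n => μ).map (mk n)

/-- The Poisson process with intensity measure `μ`. -/
def pois (μ : Measure X) : Measure (PConf X) :=
  ENNReal.ofReal (Real.exp (-(μ univ).toReal)) • expMeas μ

lemma lintegral_expMeas (μ : Measure X) {f : PConf X → ℝ≥0∞} (hf : Measurable f) :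
    ∫⁻ c, f c ∂expMeas μ =
      ∑' n : ℕ, ((n.factorial : ℝ≥0∞)⁻¹) * ∫⁻ v, f (mk n v) ∂Measure.pi fun _ : Fin n => μ := by
  rw [expMeas, lintegral_sum_measure]
  congr 1; ext n
  rw [lintegral_smul_measure, lintegral_map hf (measurable_mk n), smul_eq_mul]

lemma lintegral_pi_succ (μ : Measure X) [SigmaFinite μ] {n : ℕ} {f : (Fin (n + 1) → X) → ℝ≥0∞}
    (hf : Measurable f) :
    ∫⁻ v, f v ∂Measure.pi (fun _ : Fin (n + 1) => μ) =
      ∫⁻ x, ∫⁻ v, f (Fin.cons x v) ∂Measure.pi (fun _ : Fin n => μ) ∂μ := by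
  have h := (measurePreserving_piFinSuccAbove (fun _ : Fin (n + 1) => μ) 0).symm
  rw [← h.lintegral_comp hf, lintegral_prod _ (hf.fun_comp h.measurable).aemeasurable]
  simp [MeasurableEquiv.piFinSuccAbove, Fin.insertNthEquiv]

/-- Integral over `i` points in `U` and `j` points outside `U`. -/
def splitIntegral (μ : Measure X) (U : Set X) (F : PConf X × PConf X → ℝ≥0∞) (i j : ℕ) : ℝ≥0∞ :=
  ∫⁻ p, ∫⁻ q, F (mk i p, mk j q) ∂Measure.pi (fun _ : Fin j => μ.restrict Uᶜ)
    ∂Measure.pi (fun _ : Fin i => μ.restrict U)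

lemma splitIntegral_succ_left (μ : Measure X) [SigmaFinite μ] {U : Set X}
    {F : PConf X × PConf X → ℝ≥0∞} (hF : Measurable F) (i j : ℕ) :
    ∫⁻ x in U, splitIntegral μ U (fun ab => F (cons x ab.1, ab.2)) i j ∂μ =
      splitIntegral μ U F (i + 1) j := by
  unfold splitIntegral
  rw [lintegral_pi_succ]
  · rfl
  · refine Measurable.lintegral_prod_right' (f := fun p : (Fin (i + 1) → X) × (Fin j → X) =>
      F (mk _ p.1, mk j p.2)) ?_
    exact hF.comp (((measurable_mk _).comp measurable_fst).prodMk
      ((measurable_mk _).comp measurable_snd))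

lemma splitIntegral_succ_right (μ : Measure X) [SigmaFinite μ] {U : Set X}
    {F : PConf X × PConf X → ℝ≥0∞} (hF : Measurable F) (i j : ℕ) :
    ∫⁻ x in Uᶜ, splitIntegral μ U (fun ab => F (ab.1, cons x ab.2)) i j ∂μ =
      splitIntegral μ U F i (j + 1) := by
  unfold splitIntegral
  rw [lintegral_lintegral_swap]
  · congr 1; ext p
    rw [lintegral_pi_succ]
    · rfl
    · exact hF.comp (measurable_const.prodMk (measurable_mk _))
  · apply Measurable.aemeasurable
    refine Measurable.lintegral_prod_right' (f := fun p : (X × (Fin i → X)) × (Fin j → X) =>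
      F (mk _ p.1.2, cons p.1.1 (mk j p.2))) ?_
    refine hF.comp (((measurable_mk _).comp (measurable_snd.comp measurable_fst)).prodMk
      (measurable_cons.comp ((measurable_fst.comp measurable_fst).prodMk
      ((measurable_mk _).comp measurable_snd))))

lemma measurable_splitIntegral (μ : Measure X) [SigmaFinite μ] {U : Set X}
    [MeasurableSpace Z] {F : Z → PConf X × PConf X → ℝ≥0∞}
    (hF : Measurable (fun p : Z × PConf X × PConf X => F p.1 p.2)) (i j : ℕ) :
    Measurable fun z => splitIntegral μ U (F z) i j := by
  unfold splitIntegral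
  refine Measurable.lintegral_prod_right' (f := fun p : Z × (Fin i → X) =>
      ∫⁻ q, F p.1 (mk i p.2, mk j q) ∂Measure.pi (fun _ : Fin j => μ.restrict Uᶜ)) ?_
  refine Measurable.lintegral_prod_right' (f := fun p : (Z × (Fin i → X)) × (Fin j → X) =>
      F p.1.1 (mk i p.1.2, mk j p.2)) ?_
  refine hF.comp ((measurable_fst.comp measurable_fst).prodMk
    (((measurable_mk _).comp (measurable_snd.comp measurable_fst)).prodMk
      ((measurable_mk _).comp measurable_snd)))

/-- Each of the `n` points falls in `U` or outside, and the order in which this happens does not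
matter; this gives the binomial coefficient. The induction conditions on the first point and uses
Pascal's rule. -/
lemma lintegral_pi_split (μ : Measure X) [SigmaFinite μ] {U : Set X} (hU : MeasurableSet U) (n : ℕ)
    {F : PConf X × PConf X → ℝ≥0∞} (hF : Measurable F) :
    ∫⁻ v, F (filt U (mk n v), filt Uᶜ (mk n v)) ∂Measure.pi (fun _ : Fin n => μ) =
      ∑ ij ∈ Finset.HasAntidiagonal.antidiagonal n, (n.choose ij.1 : ℝ≥0∞) * splitIntegral μ U F ij.1 ij.2 := by
  induction n generalizing F with
  | zero =>
    have h0 : ∀ (V : Set X) (v : Fin 0 → X), filt V (mk 0 v) = mk 0 v := by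
      classical
      intro V v; apply toList_injective; rw [toList_filt]; simp [toList]
    simp only [h0, splitIntegral]
    simp only [Finset.HasAntidiagonal.antidiagonal_zero, Finset.sum_singleton, Nat.choose_self, Nat.cast_one,
      one_mul]
    rw [Measure.pi_of_empty (fun _ : Fin 0 => μ) Fin.elim0,
      Measure.pi_of_empty (fun _ : Fin 0 => μ.restrict U) Fin.elim0,
      Measure.pi_of_empty (fun _ : Fin 0 => μ.restrict Uᶜ) Fin.elim0]
    simp
  | succ n ih =>
    have hm : Measurable fun p : PConf X => (filt U p, filt Uᶜ p) :=
      (measurable_filt hU).prodMk (measurable_filt hU.compl)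
    rw [lintegral_pi_succ μ (hF.fun_comp (hm.fun_comp (measurable_mk _))), ← lintegral_add_compl _ hU]
    -- The first point lies in `U`. The coefficient is written `n.choose ij.2`, equal to `n.choose
    -- ij.1` on the antidiagonal, because this is the form in which Pascal's rule is applied in
    -- `h3`.
    have h1 : ∫⁻ x in U, ∫⁻ v, F (filt U (mk (n + 1) (Fin.cons x v)),
        filt Uᶜ (mk (n + 1) (Fin.cons x v))) ∂Measure.pi (fun _ : Fin n => μ) ∂μ =
        ∑ ij ∈ Finset.HasAntidiagonal.antidiagonal n, (n.choose ij.2 : ℝ≥0∞) *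
          splitIntegral μ U F (ij.1 + 1) ij.2 := by
      have : ∀ x ∈ U, ∫⁻ v, F (filt U (mk (n + 1) (Fin.cons x v)),
          filt Uᶜ (mk (n + 1) (Fin.cons x v))) ∂Measure.pi (fun _ : Fin n => μ) =
          ∑ ij ∈ Finset.HasAntidiagonal.antidiagonal n, (n.choose ij.1 : ℝ≥0∞) *
            splitIntegral μ U (fun ab => F (cons x ab.1, ab.2)) ij.1 ij.2 := by
        intro x hx
        have hFx : Measurable fun ab : PConf X × PConf X => F (cons x ab.1, ab.2) :=
          hF.comp ((measurable_cons.comp (measurable_const.prodMk measurable_fst)).prodMk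
            measurable_snd)
        rw [← ih hFx]
        congr 1; ext v
        rw [show mk (n + 1) (Fin.cons x v) = cons x (mk n v) from rfl, filt_cons_of_mem hx,
          filt_cons_of_notMem (by simpa using hx)]
      rw [setLIntegral_congr_fun hU this, lintegral_finsetSum]
      · refine Finset.sum_congr rfl fun ij hij => ?_
        rw [lintegral_const_mul', splitIntegral_succ_left μ hF]
        · rw [Nat.choose_symm_of_eq_add (Finset.HasAntidiagonal.mem_antidiagonal.1 hij).symm]
        · exact ENNReal.natCast_ne_top _
      · intro ij _
        refine (measurable_splitIntegral μ (F := fun x ab => F (cons x ab.1, ab.2)) ?_ _ _).const_mul _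
        exact hF.comp ((measurable_cons.comp (measurable_fst.prodMk
          (measurable_fst.comp measurable_snd))).prodMk (measurable_snd.comp measurable_snd))
    have h2 : ∫⁻ x in Uᶜ, ∫⁻ v, F (filt U (mk (n + 1) (Fin.cons x v)),
        filt Uᶜ (mk (n + 1) (Fin.cons x v))) ∂Measure.pi (fun _ : Fin n => μ) ∂μ =
        ∑ ij ∈ Finset.HasAntidiagonal.antidiagonal n, (n.choose ij.1 : ℝ≥0∞) *
          splitIntegral μ U F ij.1 (ij.2 + 1) := by
      have : ∀ x ∈ Uᶜ, ∫⁻ v, F (filt U (mk (n + 1) (Fin.cons x v)),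
          filt Uᶜ (mk (n + 1) (Fin.cons x v))) ∂Measure.pi (fun _ : Fin n => μ) =
          ∑ ij ∈ Finset.HasAntidiagonal.antidiagonal n, (n.choose ij.1 : ℝ≥0∞) *
            splitIntegral μ U (fun ab => F (ab.1, cons x ab.2)) ij.1 ij.2 := by
        intro x hx
        have hFx : Measurable fun ab : PConf X × PConf X => F (ab.1, cons x ab.2) :=
          hF.comp (measurable_fst.prodMk
            (measurable_cons.comp (measurable_const.prodMk measurable_snd)))
        rw [← ih hFx]
        congr 1; ext v
        rw [show mk (n + 1) (Fin.cons x v) = cons x (mk n v) from rfl, filt_cons_of_mem hx,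
          filt_cons_of_notMem hx]
      rw [setLIntegral_congr_fun hU.compl this, lintegral_finsetSum]
      · refine Finset.sum_congr rfl fun ij hij => ?_
        rw [lintegral_const_mul', splitIntegral_succ_right μ hF]
        exact ENNReal.natCast_ne_top _
      · intro ij _
        refine (measurable_splitIntegral μ (F := fun x ab => F (ab.1, cons x ab.2)) ?_ _ _).const_mul _
        exact hF.comp ((measurable_fst.comp measurable_snd).prodMk
          (measurable_cons.comp (measurable_fst.prodMk (measurable_snd.comp measurable_snd))))
    have h3 := Finset.sum_antidiagonal_choose_succ_mul (fun i j => splitIntegral μ U F i j) n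
    rw [h1, h2, h3, add_comm]

lemma expMeas_univ (μ : Measure X) [IsFiniteMeasure μ] :
    expMeas μ univ = ENNReal.ofReal (Real.exp (μ univ).toReal) := by
  rw [← lintegral_one, lintegral_expMeas μ measurable_const]
  simp only [lintegral_one, Measure.pi_univ, Finset.prod_const, Finset.card_univ, Fintype.card_fin]
  have h : ∀ n : ℕ, ((n.factorial : ℝ≥0∞)⁻¹) * (μ univ) ^ n =
      ENNReal.ofReal ((μ univ).toReal ^ n / n.factorial) := by
    intro n
    rw [ENNReal.ofReal_div_of_pos (by positivity), ENNReal.ofReal_pow ENNReal.toReal_nonneg,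
      ENNReal.ofReal_toReal (measure_ne_top _ _), ENNReal.ofReal_natCast, mul_comm, div_eq_mul_inv]
  simp only [h]
  rw [← ENNReal.ofReal_tsum_of_nonneg (fun n => by positivity)
    (Real.summable_pow_div_factorial _)]
  rw [Real.exp_eq_exp_ℝ, NormedSpace.exp_eq_tsum_div]

instance (μ : Measure X) [IsFiniteMeasure μ] : IsFiniteMeasure (expMeas μ) :=
  ⟨by rw [expMeas_univ]; exact ENNReal.ofReal_lt_top⟩

instance (μ : Measure X) [IsFiniteMeasure μ] : IsProbabilityMeasure (pois μ) :=
  ⟨by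
    rw [pois, Measure.smul_apply, expMeas_univ, smul_eq_mul, ← ENNReal.ofReal_mul (by positivity),
      ← Real.exp_add]
    simp⟩

/-- Since `choose (i + j) i / (i + j)! = 1 / (i! j!)`, the exponential series of `μ` is the product
of the series of its two restrictions. -/
lemma lintegral_expMeas_split (μ : Measure X) [IsFiniteMeasure μ] {U : Set X}
    (hU : MeasurableSet U) {F : PConf X × PConf X → ℝ≥0∞} (hF : Measurable F) :
    ∫⁻ c, F (filt U c, filt Uᶜ c) ∂expMeas μ =
      ∫⁻ a, ∫⁻ b, F (a, b) ∂expMeas (μ.restrict Uᶜ) ∂expMeas (μ.restrict U) := by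
  have hm : Measurable fun p : PConf X => (filt U p, filt Uᶜ p) :=
      (measurable_filt hU).prodMk (measurable_filt hU.compl)
  rw [lintegral_expMeas μ (hF.fun_comp hm), lintegral_expMeas _ hF.lintegral_prod_right']
  have hr : ∀ i : ℕ, ((i.factorial : ℝ≥0∞)⁻¹) *
      ∫⁻ v, ∫⁻ b, F (mk i v, b) ∂expMeas (μ.restrict Uᶜ) ∂Measure.pi (fun _ : Fin i => μ.restrict U)
      = ∑' j : ℕ, ((i.factorial : ℝ≥0∞)⁻¹) * ((j.factorial : ℝ≥0∞)⁻¹) * splitIntegral μ U F i j := by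
    intro i
    have : ∀ v, ∫⁻ b, F (mk i v, b) ∂expMeas (μ.restrict Uᶜ) =
      ∑' j : ℕ, ((j.factorial : ℝ≥0∞)⁻¹) * ∫⁻ q, F (mk i v, mk j q)
        ∂Measure.pi (fun _ : Fin j => μ.restrict Uᶜ) := fun v =>
      lintegral_expMeas _ (hF.comp (measurable_const.prodMk measurable_id))
    simp only [this]
    have hmeas : ∀ j, Measurable fun v : Fin i → X => ∫⁻ q, F (mk i v, mk j q)
        ∂Measure.pi (fun _ : Fin j => μ.restrict Uᶜ) := fun j =>
      Measurable.lintegral_prod_right' (f := fun p : (Fin i → X) × (Fin j → X) =>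
        F (mk _ p.1, mk j p.2)) (hF.comp (((measurable_mk _).comp measurable_fst).prodMk
          ((measurable_mk _).comp measurable_snd)))
    rw [lintegral_tsum fun j => ((hmeas j).const_mul _).aemeasurable, ← ENNReal.tsum_mul_left]
    congr 1; ext j
    rw [lintegral_const_mul _ (hmeas j), mul_assoc, splitIntegral]
  simp only [hr]
  rw [← ENNReal.tsum_prod (f := fun i j : ℕ => ((i.factorial : ℝ≥0∞)⁻¹) *
    ((j.factorial : ℝ≥0∞)⁻¹) * splitIntegral μ U F i j),
    ← Finset.HasAntidiagonal.sigmaAntidiagonalEquivProd.tsum_eq, ENNReal.tsum_sigma']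
  congr 1; ext n
  rw [lintegral_pi_split μ hU n hF, tsum_fintype, Finset.mul_sum]
  rw [← Finset.sum_coe_sort (Finset.HasAntidiagonal.antidiagonal n)]
  refine Finset.sum_congr rfl fun ij _ => ?_
  obtain ⟨⟨i, j⟩, hij⟩ := ij
  have hn : i + j = n := Finset.HasAntidiagonal.mem_antidiagonal.1 hij
  subst hn
  change _ = ((i.factorial : ℝ≥0∞)⁻¹) * ((j.factorial : ℝ≥0∞)⁻¹) * splitIntegral μ U F i j
  rw [← mul_assoc]
  congr 1
  have h := Nat.add_choose_mul_factorial_mul_factorial i j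
  rw [← Nat.choose_symm_add] at h
  have hi : ((i.factorial : ℝ≥0∞)) ≠ 0 := by exact_mod_cast i.factorial_ne_zero
  have hj : ((j.factorial : ℝ≥0∞)) ≠ 0 := by exact_mod_cast j.factorial_ne_zero
  have hN : (((i + j).factorial : ℝ≥0∞)) ≠ 0 := by exact_mod_cast (i + j).factorial_ne_zero
  rw [← ENNReal.mul_inv (Or.inl hi) (Or.inl (ENNReal.natCast_ne_top _))]
  refine (ENNReal.eq_inv_of_mul_eq_one_left ?_)
  rw [mul_assoc, ← mul_assoc ((Nat.choose _ _ : ℕ) : ℝ≥0∞)]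
  have h' : (((i + j).choose i : ℕ) : ℝ≥0∞) * i.factorial * j.factorial = (i + j).factorial := by
    exact_mod_cast h
  rw [h', ENNReal.inv_mul_cancel hN (ENNReal.natCast_ne_top _)]

/-- After the factorisation of the series only the normalisations remain, and they multiply because
the two masses add up to `μ univ`. This independence of complementary regions is what makes
resampling possible. -/
lemma pois_map_split (μ : Measure X) [IsFiniteMeasure μ] {U : Set X} (hU : MeasurableSet U) :
    (pois μ).map (fun c => (filt U c, filt Uᶜ c)) =
      (pois (μ.restrict U)).prod (pois (μ.restrict Uᶜ)) := by
  have hm : Measurable fun p : PConf X => (filt U p, filt Uᶜ p) :=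
      (measurable_filt hU).prodMk (measurable_filt hU.compl)
  refine Measure.ext_of_lintegral _ fun F hF => ?_
  rw [lintegral_map hF hm, lintegral_prod _ hF.aemeasurable, pois, lintegral_smul_measure,
    lintegral_expMeas_split μ hU hF]
  simp only [pois, lintegral_smul_measure, smul_eq_mul]
  rw [lintegral_const_mul _ hF.lintegral_prod_right', ← mul_assoc,
    ← ENNReal.ofReal_mul (by positivity), ← Real.exp_add]
  congr 3
  rw [← measure_add_measure_compl hU, ENNReal.toReal_add (measure_ne_top _ _) (measure_ne_top _ _)]
  simp only [Measure.restrict_apply_univ]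
  ring

end PConf
end
end TFIM

/-! ### Independence over disjoint regions, images, the Laplace functional and symmetrisation of
Poisson processes. -/

namespace TFIM
noncomputable section
open scoped ENNReal
namespace PConf
variable {X Y Z W : Type*} [MeasurableSpace X] [MeasurableSpace Y]

/-- One region is split off at a time; the process on its complement is again Poisson, and the other
regions lie in that complement. -/
lemma pois_forall_filt {ι : Type*} (s : Finset ι) (V : ι → Set X) (hV : ∀ i, MeasurableSet (V i))
    (hd : Pairwise fun i j => Disjoint (V i) (V j)) (A : ι → Set (PConf X))
    (hA : ∀ i, MeasurableSet (A i)) (μ : Measure X) [IsFiniteMeasure μ] :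
    pois μ {c | ∀ i ∈ s, filt (V i) c ∈ A i} = ∏ i ∈ s, pois (μ.restrict (V i)) (A i) := by
  classical
  induction s using Finset.induction_on generalizing μ with
  | empty => simp
  | insert j s hj ih =>
    have hm : Measurable fun p : PConf X => (filt (V j) p, filt (V j)ᶜ p) :=
      (measurable_filt (hV j)).prodMk (measurable_filt (hV j).compl)
    have hms : MeasurableSet {c : PConf X | ∀ i ∈ s, filt (V i) c ∈ A i} := by
      have : {c : PConf X | ∀ i ∈ s, filt (V i) c ∈ A i} = ⋂ i ∈ s, filt (V i) ⁻¹' A i := by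
        ext; simp
      rw [this]
      exact Finset.measurableSet_biInter _ fun i _ => measurable_filt (hV i) (hA i)
    have h1 : {c : PConf X | ∀ i ∈ insert j s, filt (V i) c ∈ A i} =
        (fun p : PConf X => (filt (V j) p, filt (V j)ᶜ p)) ⁻¹'
          (A j ×ˢ {c : PConf X | ∀ i ∈ s, filt (V i) c ∈ A i}) := by
      ext c
      simp only [Finset.forall_mem_insert, mem_preimage, mem_prod, mem_ofPred_eq, filt_filt]
      refine and_congr Iff.rfl (forall₂_congr fun i hi => ?_)
      have : (V j)ᶜ ∩ V i = V i := inter_eq_right.2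
        (subset_compl_iff_disjoint_left.2 (hd (fun h => hj (h ▸ hi))))
      rw [this]
    rw [h1, ← Measure.map_apply hm ((hA j).prod hms), pois_map_split μ (hV j), Measure.prod_prod,
      Finset.prod_insert hj, ih]
    congr 1
    refine Finset.prod_congr rfl fun i hi => ?_
    have hji : j ≠ i := fun h => hj (h ▸ hi)
    rw [Measure.restrict_restrict (hV i), inter_eq_left.2
        (subset_compl_iff_disjoint_left.2 (hd hji))]

lemma expMeas_map {f : X → Y} (hf : Measurable f) (μ : Measure X) [IsFiniteMeasure μ] :
    (expMeas μ).map (map f) = expMeas (μ.map f) := by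
  rw [expMeas, Measure.map_sum (measurable_map hf).aemeasurable, expMeas]
  congr 1; ext1 n
  rw [Measure.map_smul, Measure.map_map (measurable_map hf) (measurable_mk n)]
  have : (map f ∘ mk n : (Fin n → X) → PConf Y) = mk n ∘ fun v i => f (v i) := rfl
  rw [this, ← Measure.map_map (measurable_mk n)
    (measurable_pi_iff.2 fun i => hf.fun_comp (measurable_pi_apply i)),
    Measure.pi_map_pi fun _ => hf.aemeasurable]

lemma pois_map {f : X → Y} (hf : Measurable f) (μ : Measure X) [IsFiniteMeasure μ] :
    (pois μ).map (map f) = pois (μ.map f) := by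
  rw [pois, Measure.map_smul, expMeas_map hf, pois, Measure.map_apply hf MeasurableSet.univ,
    preimage_univ]

lemma measurable_prod_points {f : X → ℝ} (hf : Measurable f) :
    Measurable fun c : PConf X => ∏ i, f (c.2 i) := by
  rw [measurable_iff]
  intro n
  change Measurable fun v : Fin n → X => ∏ i, f (v i)
  exact Finset.measurable_fun_prod _ fun i _ => hf.fun_comp (measurable_pi_apply i)

/-- The Laplace functional of a Poisson process. -/
lemma integral_pois_prod (μ : Measure X) [IsFiniteMeasure μ] {f : X → ℝ} (hf : Measurable f)
    (hb : ∀ x, |f x| ≤ 1) :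
    ∫ c, ∏ i, f (c.2 i) ∂pois μ = Real.exp (∫ x, (f x - 1) ∂μ) := by
  have hfi : Integrable f μ :=
    Integrable.of_bound hf.aestronglyMeasurable 1 (Filter.Eventually.of_forall hb)
  have hint : Integrable (fun c : PConf X => ∏ i, f (c.2 i)) (expMeas μ) := by
    refine Integrable.of_bound (measurable_prod_points hf).aestronglyMeasurable 1
      (Filter.Eventually.of_forall fun c => ?_)
    rw [Real.norm_eq_abs, Finset.abs_prod]
    exact Finset.prod_le_one (fun _ _ => abs_nonneg _) fun i _ => hb _
  -- On configurations with `n` points the product integrates to `(∫ f)^n`, so the sum over `n` is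
  -- an exponential series.
  have h1 : ∫ c, ∏ i, f (c.2 i) ∂expMeas μ = Real.exp (∫ x, f x ∂μ) := by
    rw [expMeas] at hint ⊢
    rw [integral_sum_measure hint, Real.exp_eq_exp_ℝ, NormedSpace.exp_eq_tsum_div]
    congr 1; ext n
    rw [integral_smul_measure, (measurableEmbedding_mk n).integral_map]
    have : ∫ v : Fin n → X, ∏ i, f (v i) ∂Measure.pi (fun _ => μ) = (∫ x, f x ∂μ) ^ n := by
      rw [integral_fintype_prod_eq_prod (μ := fun _ : Fin n => μ) (fun _ => f)]
      simp
    rw [this]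
    simp [div_eq_inv_mul]
  rw [pois, integral_smul_measure, h1, ENNReal.toReal_ofReal (by positivity), smul_eq_mul,
    ← Real.exp_add, integral_sub hfi (integrable_const _)]
  congr 1
  simp [Measure.real]
  ring

lemma pois_zero_card (μ : Measure X) [IsFiniteMeasure μ] (k : ℕ) :
    pois μ {c | c.1 = k} =
      ENNReal.ofReal (Real.exp (-(μ univ).toReal) * (μ univ).toReal ^ k / k.factorial) := by
  classical
  have hms : MeasurableSet {c : PConf X | c.1 = k} := by
    rw [measurableSet_iff]; intro n
    by_cases h : n = k
    · convert MeasurableSet.univ; ext; simp [h]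
    · convert MeasurableSet.empty; ext; simp [h]
  rw [pois, Measure.smul_apply, expMeas, Measure.sum_apply _ hms, tsum_eq_single k]
  · rw [Measure.smul_apply, Measure.map_apply (measurable_mk k) hms]
    have : (mk k ⁻¹' {c : PConf X | c.1 = k}) = univ := by ext; simp
    rw [this, Measure.pi_univ]
    simp only [Finset.prod_const, Finset.card_univ, Fintype.card_fin, smul_eq_mul]
    rw [mul_div_assoc, ENNReal.ofReal_mul (by positivity), ENNReal.ofReal_div_of_pos (by positivity),
      ENNReal.ofReal_pow ENNReal.toReal_nonneg,
      ENNReal.ofReal_toReal (measure_ne_top _ _), ENNReal.ofReal_natCast, mul_comm (_⁻¹),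
      div_eq_mul_inv]
  · intro n hn
    rw [Measure.smul_apply, Measure.map_apply (measurable_mk n) hms]
    have : (mk n ⁻¹' {c : PConf X | c.1 = k}) = ∅ := by ext; simp [hn]
    rw [this]; simp

/-- Two functions whose averages over coordinatewise measure preserving symmetries compare. -/
lemma lintegral_pois_le_of_orbit {K : Type*} [Fintype K] [MeasurableSpace K]
    [MeasurableSingletonClass K] (κ : Measure K) [SFinite κ] (w : ℝ≥0∞) (hκ : ∀ k, κ {k} = w)
    (μ : Measure X) [IsFiniteMeasure μ] {φ : Bool → X → X} (hφ : ∀ b, MeasurePreserving (φ b) μ μ)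
    {f g : PConf X × K → ℝ≥0∞} (hf : Measurable f) (hg : Measurable g)
    (h : ∀ᵐ c ∂pois μ, ∑ a : Fin c.1 → Bool, ∑ k, f (mk c.1 fun i => φ (a i) (c.2 i), k) ≤
      ∑ a : Fin c.1 → Bool, ∑ k, g (mk c.1 fun i => φ (a i) (c.2 i), k)) :
    ∫⁻ p, f p ∂(pois μ).prod κ ≤ ∫⁻ p, g p ∂(pois μ).prod κ := by
  have hsum : ∀ {f : PConf X × K → ℝ≥0∞}, Measurable f →
      Measurable fun c : PConf X => ∑ k, f (c, k) := fun hf =>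
    Finset.measurable_fun_sum _ fun k _ => hf.fun_comp (measurable_id.prodMk measurable_const)
  have hav : ∀ {f : PConf X × K → ℝ≥0∞}, Measurable f →
      Measurable fun c : PConf X => ((2 : ℝ≥0∞) ^ c.1)⁻¹ *
        ∑ a : Fin c.1 → Bool, ∑ k, f (mk c.1 fun i => φ (a i) (c.2 i), k) := by
    intro f hf
    rw [measurable_iff]; intro n
    change Measurable fun v : Fin n → X => ((2 : ℝ≥0∞) ^ n)⁻¹ *
        ∑ a : Fin n → Bool, ∑ k, f (mk n fun i => φ (a i) (v i), k)
    refine Measurable.const_mul (Finset.measurable_fun_sum _ fun a _ => ?_) _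
    exact ((hsum hf).comp (measurable_mk n)).comp
      (measurable_pi_iff.2 fun i => (hφ (a i)).measurable.comp (measurable_pi_apply i))
  -- Every choice `a` of symmetries preserves the law of the `n` points, so the integral equals its
  -- average over all `2^n` choices. All points of `K` have the same mass `w`, so integrating over
  -- `K` is `w` times a sum. The comparison is thereby reduced to finite sums over orbits.
  have key : ∀ {f : PConf X × K → ℝ≥0∞}, Measurable f → ∫⁻ p, f p ∂(pois μ).prod κ =
      w * ∫⁻ c, ((2 : ℝ≥0∞) ^ c.1)⁻¹ *
        ∑ a : Fin c.1 → Bool, ∑ k, f (mk c.1 fun i => φ (a i) (c.2 i), k) ∂pois μ := by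
    intro f hf
    rw [lintegral_prod _ hf.aemeasurable]
    have : ∀ c, ∫⁻ k, f (c, k) ∂κ = w * ∑ k, f (c, k) := by
      intro c
      rw [lintegral_fintype, Finset.mul_sum]
      exact Finset.sum_congr rfl fun k _ => by rw [hκ, mul_comm]
    simp only [this]
    rw [lintegral_const_mul _ (hsum hf)]
    congr 1
    simp only [pois, lintegral_smul_measure]
    congr 1
    rw [lintegral_expMeas _ (hsum hf), lintegral_expMeas _ (hav hf)]
    congr 1; ext n
    congr 1
    change _ = ∫⁻ v : Fin n → X, ((2 : ℝ≥0∞) ^ n)⁻¹ *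
        ∑ a : Fin n → Bool, ∑ k, f (mk n fun i => φ (a i) (v i), k) ∂_
    rw [lintegral_const_mul']
    swap
    · exact ENNReal.inv_ne_top.2 (by simp)
    have hsn : Measurable fun v : Fin n → X => ∑ k, f (mk n v, k) :=
      (hsum hf).comp (measurable_mk n)
    have hmp : ∀ a : Fin n → Bool, MeasurePreserving (fun (v : Fin n → X) i => φ (a i) (v i))
        (Measure.pi fun _ => μ) (Measure.pi fun _ => μ) := fun a =>
      measurePreserving_pi _ _ fun i => hφ (a i)
    rw [lintegral_finsetSum _ fun a _ => hsn.fun_comp (hmp a).measurable]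
    have : ∀ a : Fin n → Bool, ∫⁻ v : Fin n → X, ∑ k, f (mk n fun i => φ (a i) (v i), k)
        ∂(Measure.pi fun _ => μ) = ∫⁻ v : Fin n → X, ∑ k, f (mk n v, k) ∂(Measure.pi fun _ => μ) :=
      fun a => (hmp a).lintegral_comp hsn
    simp only [this]
    simp only [Finset.sum_const, Finset.card_univ, Fintype.card_pi, Fintype.card_bool,
      Finset.prod_const, Fintype.card_fin, nsmul_eq_mul, Nat.cast_pow, Nat.cast_ofNat]
    rw [← mul_assoc, ENNReal.inv_mul_cancel (by simp) (by simp), one_mul]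
  rw [key hf, key hg]
  gcongr 1
  refine lintegral_mono_ae ?_
  filter_upwards [h] with c hc
  gcongr

end PConf
end
end TFIM

/-! ### Poisson processes on the time interval, fair coins, and points in general position. -/

namespace TFIM
noncomputable section
open scoped ENNReal

instance isFiniteMeasure_restrict_timeI (r : ℝ) :
    IsFiniteMeasure ((volume : Measure ℝ).restrict (timeI r)) :=
  ⟨by rw [Measure.restrict_apply_univ]; simp [timeI]⟩

lemma volume_timeI (r : ℝ) : volume (timeI r) = ENNReal.ofReal r := by
  rw [timeI, Real.volume_Icc]; congr 1; ring

lemma measurableSet_timeI (r : ℝ) : MeasurableSet (timeI r) := measurableSet_Icc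

/-- The intensity measure of a Poisson process of rate `a` on `I_r`. -/
def rateMeas (a r : ℝ) : Measure ℝ := ENNReal.ofReal a • volume.restrict (timeI r)

instance (a r : ℝ) : IsFiniteMeasure (rateMeas a r) := by
  exact Measure.smul_finite _ ENNReal.ofReal_ne_top

lemma rateMeas_univ (a r : ℝ) : rateMeas a r univ = ENNReal.ofReal a * ENNReal.ofReal r := by
  simp [rateMeas, volume_timeI]

lemma pi_const_smul {X : Type*} [MeasurableSpace X] (n : ℕ) (c : ℝ≥0∞) (μ : Measure X)
    [IsFiniteMeasure μ] [IsFiniteMeasure (c • μ)] :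
    (Measure.pi fun _ : Fin n => c • μ) = c ^ n • Measure.pi fun _ : Fin n => μ := by
  refine Measure.pi_eq fun s _ => ?_
  simp [Measure.pi_pi, Finset.prod_mul_distrib]

/-- The factor `a ^ n` is absorbed into the `n`-fold product of the intensity measure. -/
lemma poissonLaw_eq_pois {a r : ℝ} (ha : 0 ≤ a) (hr : 0 ≤ r) :
    poissonLaw a r = PConf.pois (rateMeas a r) := by
  have hsum : ∀ (c : ℝ≥0∞) (m : ℕ → Measure Config),
      c • Measure.sum m = Measure.sum fun n => c • m n := by
    intro c m; ext s hs
    simp [Measure.sum_apply _ hs, ENNReal.tsum_mul_left]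
  rw [poissonLaw, PConf.pois, PConf.expMeas, hsum]
  congr 1; ext1 n
  have : IsFiniteMeasure (ENNReal.ofReal a • (volume : Measure ℝ).restrict (timeI r)) :=
    inferInstanceAs (IsFiniteMeasure (rateMeas a r))
  rw [rateMeas_univ, rateMeas, pi_const_smul, Measure.map_smul, smul_smul, smul_smul]
  congr 1
  rw [ENNReal.toReal_mul, ENNReal.toReal_ofReal ha, ENNReal.toReal_ofReal hr, mul_div_assoc,
    ENNReal.ofReal_mul (by positivity), ENNReal.ofReal_div_of_pos (by positivity),
    ENNReal.ofReal_pow ha, ENNReal.ofReal_natCast, mul_assoc, mul_comm (_⁻¹), div_eq_mul_inv]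

instance isProbabilityMeasure_coinLaw : IsProbabilityMeasure coinLaw := by
  unfold coinLaw
  exact ProbabilityTheory.isProbabilityMeasure_uniformOn (Set.toFinite _) ⟨true, mem_univ _⟩

lemma coinLaw_singleton (b : Bool) : coinLaw {b} = 2⁻¹ := by
  rw [coinLaw, ProbabilityTheory.uniformOn_univ]
  simp

lemma integral_coinLaw (f : Bool → ℝ) : ∫ b, f b ∂coinLaw = (f false + f true) / 2 := by
  rw [integral_fintype (Integrable.of_finite)]
  simp [Measure.real, coinLaw_singleton]
  ring

namespace PConf
variable {X : Type*} [MeasurableSpace X]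

lemma ae_pois_iff {μ : Measure X} {p : PConf X → Prop} 
    (h : ∀ n, ∀ᵐ v ∂Measure.pi (fun _ : Fin n => μ), p (mk n v)) : ∀ᵐ c ∂pois μ, p c := by
  refine Measure.ae_smul_measure ?_ _
  rw [expMeas, Measure.ae_sum_iff]
  intro n
  refine Measure.ae_smul_measure ?_ _
  exact (measurableEmbedding_mk n).ae_map_iff.2 (h n)

/-- Almost surely the points of a Poisson process have distinct images under a map without
atoms, which avoid a given countable set. -/
lemma ae_pois_generic {μ : Measure X} [IsFiniteMeasure μ] {f : X → ℝ} (hf : Measurable f)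
    (hμ : ∀ t, μ (f ⁻¹' {t}) = 0) {s : Set ℝ} (hs : s.Countable) {T : Set ℝ}
    (hT : ∀ᵐ x ∂μ, f x ∈ T) :
    ∀ᵐ c ∂pois μ, Function.Injective (fun i => f (c.2 i)) ∧ ∀ i, f (c.2 i) ∈ T \ s := by
  refine ae_pois_iff fun n => ?_
  have hs0 : ∀ᵐ x ∂μ, f x ∉ s := by
    rw [ae_iff]
    have : {x | ¬ f x ∉ s} = ⋃ t ∈ s, f ⁻¹' {t} := by ext; simp
    rw [this, measure_biUnion_null_iff hs]
    exact fun t _ => hμ t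
  have h1 : ∀ i : Fin n, ∀ᵐ v ∂Measure.pi (fun _ : Fin n => μ), f (v i) ∈ T \ s := fun i =>
    (Measure.tendsto_eval_ae_ae (μ := fun _ : Fin n => μ) (i := i)).eventually
      (p := fun x => f x ∈ T \ s) (hT.and hs0)
  have h2 : ∀ i j : Fin n, i ≠ j → ∀ᵐ v ∂Measure.pi (fun _ : Fin n => μ), f (v i) ≠ f (v j) := by
    intro i j hij
    cases n with
    | zero => exact i.elim0
    | succ m =>
      -- Separating coordinate `i` from the others makes it independent of coordinate `j`. By Fubini
      -- a coincidence has probability zero, since the image of the intensity has no atoms.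
      obtain ⟨k, rfl⟩ := Fin.exists_succAbove_eq hij.symm
      have hmp := measurePreserving_piFinSuccAbove (fun _ : Fin (m + 1) => μ) i
      have hset : MeasurableSet {p : X × (Fin m → X) | f p.1 = f (p.2 k)} :=
        measurableSet_eq_fun (hf.comp measurable_fst)
          (hf.comp ((measurable_pi_apply k).comp measurable_snd))
      have h0 : (μ.prod (Measure.pi fun _ : Fin m => μ)) {p | f p.1 = f (p.2 k)} = 0 := by
        rw [Measure.prod_apply_symm hset]
        simp only [lintegral_eq_zero_iff (measurable_measure_prodMk_right hset)]
        exact Filter.Eventually.of_forall fun w => hμ (f (w k))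
      rw [ae_iff]
      have := hmp.measure_preimage hset.nullMeasurableSet
      rw [h0] at this
      convert this using 2
      ext v
      simp [MeasurableEquiv.piFinSuccAbove, Fin.insertNthEquiv, Fin.removeNth]
  filter_upwards [ae_all_iff.2 h1, ae_all_iff.2 fun i => ae_all_iff.2 fun j =>
    ae_all_iff.2 (h2 i j)] with v hv1 hv2
  refine ⟨fun i j hij => ?_, hv1⟩
  by_contra hne
  exact hv2 i j hne hij

end PConf
end
end TFIM

/-! ### One marked Poisson process carrying all bridges, ghost points and cuts. -/

namespace TFIM
noncomputable section
open scoped ENNReal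

lemma measurePreserving_prodRightComm {A B C : Type*} [MeasurableSpace A] [MeasurableSpace B]
    [MeasurableSpace C] (a : Measure A) (b : Measure B) (c : Measure C) [SFinite a] [SFinite b]
    [SFinite c] :
    MeasurePreserving (fun p : (A × B) × C => ((p.1.1, p.2), p.1.2))
      ((a.prod b).prod c) ((a.prod c).prod b) :=
  ((measurePreserving_prodAssoc a c b).symm.comp
    ((MeasurePreserving.id a).prod (Measure.measurePreserving_swap (μ := b) (ν := c)))).comp
      (measurePreserving_prodAssoc a b c)

/-- The marks of the points of the underlying marked Poisson process: `B`, `B̂`, `G`, `Δ`. -/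
def Mark (d N : ℕ) : Type := Edge d N ⊕ (Edge d N ⊕ (Site d N ⊕ Site d N))

namespace Mark
variable {d N : ℕ}
instance : MeasurableSpace (Mark d N) := ⊤
instance : DiscreteMeasurableSpace (Mark d N) := ⟨fun _ => trivial⟩
instance : Fintype (Mark d N) := inferInstanceAs (Fintype (Edge d N ⊕ (Edge d N ⊕ (Site d N ⊕ Site d N))))
instance : DecidableEq (Mark d N) := Classical.decEq _
/-- Mark of a bridge of `B`. -/
def b (e : Edge d N) : Mark d N := Sum.inl e
/-- Mark of a bridge of `B̂`. -/
def b' (e : Edge d N) : Mark d N := Sum.inr (Sum.inl e)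
/-- Mark of a point of `G`. -/
def g (x : Site d N) : Mark d N := Sum.inr (Sum.inr (Sum.inl x))
/-- Mark of a cut. -/
def cut (x : Site d N) : Mark d N := Sum.inr (Sum.inr (Sum.inr x))

/-- The rates of the components. -/
def rate (lam δ : ℝ) : Mark d N → ℝ
  | Sum.inl _ => lam
  | Sum.inr (Sum.inl _) => lam
  | Sum.inr (Sum.inr (Sum.inl x)) => lam * (outDegree x : ℝ)
  | Sum.inr (Sum.inr (Sum.inr _)) => 4 * δ

/-- Intensity measure of the marked process. -/
def meas (d N : ℕ) (lam δ r : ℝ) : Measure (Mark d N × ℝ) :=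
  ∑ m, (rateMeas (rate lam δ m) r).map (Prod.mk m)

instance (lam δ r : ℝ) : IsFiniteMeasure (meas d N lam δ r) := by
  unfold meas; infer_instance

lemma measurableSet_fst (m : Mark d N) :
    MeasurableSet (Prod.fst ⁻¹' {m} : Set (Mark d N × ℝ)) :=
  measurable_fst (MeasurableSet.of_discrete)

lemma meas_apply (lam δ r : ℝ) {s : Set (Mark d N × ℝ)} (hs : MeasurableSet s) :
    meas d N lam δ r s = ∑ m, rateMeas (rate lam δ m) r {t | (m, t) ∈ s} := by
  rw [meas, Measure.finsetSum_apply]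
  refine Finset.sum_congr rfl fun m _ => ?_
  rw [Measure.map_apply measurable_prodMk_left hs]; rfl

lemma map_snd_restrict (lam δ r : ℝ) (m : Mark d N) :
    ((meas d N lam δ r).restrict (Prod.fst ⁻¹' {m})).map Prod.snd = rateMeas (rate lam δ m) r := by
  ext s hs
  rw [Measure.map_apply measurable_snd hs, Measure.restrict_apply (measurable_snd hs),
    meas_apply _ _ _ ((measurable_snd hs).inter (measurableSet_fst m)), Finset.sum_eq_single m]
  · congr 1; ext t; simp
  · intro m' _ hne
    convert measure_empty (μ := rateMeas (rate lam δ m') r)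
    ext t; simp [hne]
  · simp

end Mark

variable {d N : ℕ}

/-- The points with mark `m`. -/
def component (c : PConf (Mark d N × ℝ)) (m : Mark d N) : Config :=
  PConf.map Prod.snd (PConf.filt (Prod.fst ⁻¹' {m}) c)

lemma component_count (c : PConf (Mark d N × ℝ)) (m : Mark d N) (U : Set ℝ) :
    (component c m).count U = c.cnt ({m} ×ˢ U) := by
  change PConf.cnt (component c m) U = _
  rw [component, PConf.cnt_map, PConf.cnt_filt]
  congr 1

lemma measurable_component (m : Mark d N) :
    Measurable fun c : PConf (Mark d N × ℝ) => component c m :=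
  (PConf.measurable_map measurable_snd).comp (PConf.measurable_filt (Mark.measurableSet_fst m))

/-- Points with different marks lie in disjoint regions, so `pois_forall_filt` makes the components
independent. A single process is used because recolouring and resampling then act on individual
points. -/
lemma pois_map_component (lam δ r : ℝ) :
    (PConf.pois (Mark.meas d N lam δ r)).map (fun c m => component c m) =
      Measure.pi fun m => PConf.pois (rateMeas (Mark.rate lam δ m) r) := by
  symm
  refine Measure.pi_eq fun s hs => ?_
  rw [Measure.map_apply (measurable_pi_iff.2 measurable_component) (MeasurableSet.univ_pi hs)]
  have h := PConf.pois_forall_filt (Finset.univ : Finset (Mark d N))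
    (fun m => (Prod.fst ⁻¹' {m} : Set (Mark d N × ℝ))) Mark.measurableSet_fst
    (fun i j hij => Disjoint.preimage _ (by simpa using hij))
    (fun m => PConf.map Prod.snd ⁻¹' s m)
    (fun m => PConf.measurable_map measurable_snd (hs m)) (Mark.meas d N lam δ r)
  have h2 : ((fun (c : PConf (Mark d N × ℝ)) m => component c m) ⁻¹' (univ.pi s)) =
      {c | ∀ i ∈ Finset.univ, PConf.filt (Prod.fst ⁻¹' {i}) c ∈ PConf.map Prod.snd ⁻¹' s i} := by
    ext c; simp [component]
  rw [h2, h]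
  refine Finset.prod_congr rfl fun m _ => ?_
  rw [← Measure.map_apply (PConf.measurable_map measurable_snd) (hs m),
    PConf.pois_map measurable_snd, Mark.map_snd_restrict]

/-- The coins of the two labellings. -/
abbrev Coins (d N : ℕ) : Type := (Site d N → Bool) × (Site d N → Bool)

/-- The underlying randomness: a marked Poisson process and coins. -/
abbrev Base (d N : ℕ) : Type := PConf (Mark d N × ℝ) × Coins d N

/-- The law of the coins. -/
def coinsLaw (d N : ℕ) : Measure (Coins d N) :=
  (Measure.pi fun _ => coinLaw).prod (Measure.pi fun _ => coinLaw)

instance : IsProbabilityMeasure (coinsLaw d N) := by unfold coinsLaw; infer_instance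

/-- All values of the coins have the same mass, as `lintegral_pois_le_of_orbit` requires; this
permits exchanging coins between the labellings. -/
lemma coinsLaw_singleton (k : Coins d N) :
    coinsLaw d N {k} = ((2 : ℝ≥0∞)⁻¹) ^ (2 * Fintype.card (Site d N)) := by
  obtain ⟨k, k'⟩ := k
  rw [coinsLaw, ← singleton_prod_singleton, Measure.prod_prod, ← univ_pi_singleton,
    ← univ_pi_singleton, Measure.pi_pi, Measure.pi_pi]
  simp only [coinLaw_singleton, Finset.prod_const, Finset.card_univ]
  ring

/-- The law of the underlying randomness. -/
def baseLaw (d N : ℕ) (lam δ r : ℝ) : Measure (Base d N) :=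
  (PConf.pois (Mark.meas d N lam δ r)).prod (coinsLaw d N)

instance (lam δ r : ℝ) : IsProbabilityMeasure (baseLaw d N lam δ r) := by
  unfold baseLaw; infer_instance

/-- The pair of labellings with cuts encoded by a marked configuration and coins. -/
def toPair (p : Base d N) : Pair d N where
  B e := component p.1 (Mark.b e)
  coin := p.2.1
  B' e := component p.1 (Mark.b' e)
  G x := component p.1 (Mark.g x)
  coin' := p.2.2
  cuts x := component p.1 (Mark.cut x)

lemma measurable_ofProd : Measurable (Pair.ofProd (d := d) (N := N)) := by
  rintro _ ⟨s, hs, rfl⟩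
  exact hs

lemma measurable_toProd : Measurable (Pair.toProd (d := d) (N := N)) :=
  comap_measurable _

/-- The marks separate into four independent families (`t1`); the maps `u1` and `u2` only
reassociate the product, so that each family of coins stands next to the processes of its labelling.
-/
lemma map_toProd_toPair {lam δ r : ℝ} (hlam : 0 ≤ lam) (hδ : 0 ≤ δ) (hr : 0 ≤ r) :
    MeasurePreserving (fun p : Base d N => (toPair p).toProd) (baseLaw d N lam δ r)
      (((Measure.pi fun _ => poissonLaw lam r).prod (Measure.pi fun _ => coinLaw)).prod
    (((Measure.pi fun _ => poissonLaw lam r).prod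
      ((Measure.pi fun x : Site d N => poissonLaw (lam * (outDegree x : ℝ)) r).prod
        (Measure.pi fun _ => coinLaw))).prod
      (Measure.pi fun _ => poissonLaw (4 * δ) r))) := by
  have e1 : ∀ x : Site d N, poissonLaw (lam * (outDegree x : ℝ)) r =
      PConf.pois (rateMeas (lam * (outDegree x : ℝ)) r) :=
    fun x => poissonLaw_eq_pois (by positivity) hr
  simp only [e1, poissonLaw_eq_pois hlam hr, poissonLaw_eq_pois (show 0 ≤ 4 * δ by positivity) hr]
  have hc : MeasurePreserving (fun (c : PConf (Mark d N × ℝ)) m => component c m)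
      (PConf.pois (Mark.meas d N lam δ r))
      (Measure.pi fun m => PConf.pois (rateMeas (Mark.rate lam δ m) r)) :=
    ⟨measurable_pi_iff.2 measurable_component, pois_map_component lam δ r⟩
  let f : Edge d N ⊕ (Edge d N ⊕ (Site d N ⊕ Site d N)) → ℝ := Mark.rate lam δ
  have s1 := measurePreserving_sumPiEquivProdPi (ι := Edge d N)
    (ι' := Edge d N ⊕ (Site d N ⊕ Site d N)) (X := fun _ => PConf ℝ)
    (fun m => PConf.pois (rateMeas (f m) r))
  have s2 := measurePreserving_sumPiEquivProdPi (ι := Edge d N)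
    (ι' := (Site d N ⊕ Site d N)) (X := fun _ => PConf ℝ)
    (fun m => PConf.pois (rateMeas (f (Sum.inr m)) r))
  have s3 := measurePreserving_sumPiEquivProdPi (ι := Site d N)
    (ι' := Site d N) (X := fun _ => PConf ℝ)
    (fun m => PConf.pois (rateMeas (f (Sum.inr (Sum.inr m))) r))
  have t1 := ((MeasurePreserving.id _).prod (((MeasurePreserving.id _).prod s3).comp s2)).comp s1
  have t2 := (t1.comp hc).prod (MeasurePreserving.id (coinsLaw d N))
  set μB := Measure.pi fun _ : Edge d N => PConf.pois (rateMeas lam r)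
  set μG := Measure.pi fun x : Site d N => PConf.pois (rateMeas (lam * (outDegree x : ℝ)) r)
  set μC := Measure.pi fun _ : Site d N => PConf.pois (rateMeas (4 * δ) r)
  set κ := Measure.pi fun _ : Site d N => coinLaw
  have u1 := (measurePreserving_prodAssoc (μB.prod κ) (μB.prod (μG.prod μC)) κ).comp
    (((measurePreserving_prodRightComm μB (μB.prod (μG.prod μC)) κ).prod
      (MeasurePreserving.id κ)).comp
      (measurePreserving_prodAssoc (μB.prod (μB.prod (μG.prod μC))) κ κ).symm)
  have u2 := (measurePreserving_prodAssoc μB (μG.prod κ) μC).symm.comp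
    (((MeasurePreserving.id μB).prod (measurePreserving_prodRightComm μG μC κ)).comp
      (measurePreserving_prodAssoc μB (μG.prod μC) κ))
  exact (((MeasurePreserving.id (μB.prod κ)).prod u2).comp u1).comp t2

lemma map_toPair {lam δ r : ℝ} (hlam : 0 ≤ lam) (hδ : 0 ≤ δ) (hr : 0 ≤ r) :
    MeasurePreserving (toPair (d := d) (N := N)) (baseLaw d N lam δ r) (pairLaw d lam δ N r) := by
  have h := map_toProd_toPair (d := d) (N := N) hlam hδ hr
  have h2 : MeasurePreserving (Pair.ofProd (d := d) (N := N)) _ (pairLaw d lam δ N r) :=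
    ⟨measurable_ofProd, rfl⟩
  exact h2.comp h

end
end TFIM

/-! ### Replacing the points of a Poisson process inside a region. -/

namespace TFIM
noncomputable section
open scoped ENNReal
namespace PConf
variable {X : Type*} [MeasurableSpace X] {K : Type*} [MeasurableSpace K]

/-- The configurations all of whose reorderings lie in `M`. -/
def symCore (M : Set (PConf X × K)) : Set (PConf X × K) :=
  {p | ∀ σ : Equiv.Perm (Fin p.1.1), (p.1.reorder σ, p.2) ∈ M}

lemma measurableSet_symCore {M : Set (PConf X × K)} (hM : MeasurableSet M) :
    MeasurableSet (symCore M) := by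
  have h : Measurable fun p : K × PConf X => ∀ σ : Equiv.Perm (Fin p.2.1),
      (p.2.reorder σ, p.1) ∈ M := by
    refine measurable_prod_iff fun n => ?_
    rw [← measurableSet_setOfPred]
    have : {p : K × (Fin n → X) | ∀ σ : Equiv.Perm (Fin n), ((mk n p.2).reorder σ, p.1) ∈ M} =
        ⋂ σ : Equiv.Perm (Fin n), (fun p : K × (Fin n → X) => (mk n (p.2 ∘ σ), p.1)) ⁻¹' M := by
      ext p; simp [reorder]
    refine (this ▸ MeasurableSet.iInter fun σ => ?_ : MeasurableSet {p : K × (Fin n → X) |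
      ∀ σ : Equiv.Perm (Fin n), ((mk n p.2).reorder σ, p.1) ∈ M})
    refine Measurable.prodMk ?_ measurable_fst hM
    exact (measurable_mk n).comp (measurable_pi_iff.2 fun i =>
      (measurable_pi_apply _).comp measurable_snd)
  exact measurable_swap (measurableSet_setOfPred.2 h)

/-- Resampling the points in `U`: if every configuration can be turned into one of `E'` by replacing
its points in `U` by a configuration of `S` with a prescribed value of the statistic `st`, then the
integral of `F` is controlled by that of `w` over `E'`. -/
lemma exists_resample_bound {μ : Measure X} [IsFiniteMeasure μ] {κ : Measure K}
    [IsProbabilityMeasure κ] {U : Set X} (hU : MeasurableSet U) {P : Type*} [MeasurableSpace P]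
    [Countable P] [MeasurableSingletonClass P] {st : PConf X → P} (hst : Measurable st)
    (T : P → P) {S : Set (PConf X)} (hS : MeasurableSet S) {c₀ C : ℝ≥0∞} (hc₀ : c₀ ≠ 0)
    (hc₁ : c₀ ≠ ∞) (hbd : ∀ a, c₀ ≤ pois (μ.restrict U) (S ∩ st ⁻¹' {a}))
    {F w : PConf X × K → ℝ≥0∞} (hw : Measurable w)
    (hwσ : ∀ c k σ, w (reorder c σ, k) = w (c, k))
    {E' M : Set (PConf X × K)} (hM : MeasurableSet M) (hEM : E' ⊆ M)
    (hE : ∀ c k σ, (c, k) ∈ E' → (reorder c σ, k) ∈ E')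
    (hF : ∀ c k, ∀ a ∈ S, st a = T (st (filt U c)) →
      F (c, k) ≤ C * E'.indicator w (join a (filt Uᶜ c), k)) :
    ∃ V : PConf X × K → ℝ≥0∞, Measurable V ∧ (∀ p, F p ≤ V p) ∧
      ∫⁻ p, V p ∂(pois μ).prod κ ≤ C * c₀⁻¹ * ∫⁻ p in M, w p ∂(pois μ).prod κ := by
  classical
  -- The measurable set `M` need not be invariant under reordering, whereas joining the new and the
  -- old points changes the order. Its invariant core is still measurable and still contains `E'`,
  -- which is itself invariant.
  set g : PConf X × K → ℝ≥0∞ := (symCore M).indicator w with hg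
  have hgm : Measurable g := hw.indicator (measurableSet_symCore hM)
  have hcore : E' ⊆ symCore M := fun p hp σ => hEM (hE _ _ σ hp)
  set h : (PConf X × PConf X × K) × PConf X → ℝ≥0∞ := fun q =>
    {q : (PConf X × PConf X × K) × PConf X | q.2 ∈ S ∧ st q.2 = T (st q.1.1)}.indicator
      (fun q => g (join q.2 q.1.2.1, q.1.2.2)) q with hh
  have hhm : Measurable h := by
    refine Measurable.indicator ?_ ?_
    · exact hgm.comp ((measurable_join.comp (measurable_snd.prodMk
        (measurable_fst.comp (measurable_snd.comp measurable_fst)))).prodMk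
        (measurable_snd.comp (measurable_snd.comp measurable_fst)))
    · exact (measurable_snd hS).inter (measurableSet_eq_fun (hst.comp measurable_snd)
        ((measurable_of_countable T).comp (hst.comp (measurable_fst.comp measurable_fst))))
  set I : PConf X × PConf X × K → ℝ≥0∞ := fun q => ∫⁻ a, h (q, a) ∂pois (μ.restrict U) with hI
  have hIm : Measurable I := hhm.lintegral_prod_right'
  have hsp : Measurable fun p : PConf X => (filt U p, filt Uᶜ p) :=
      (measurable_filt hU).prodMk (measurable_filt hU.compl)
  have hspm : Measurable fun p : PConf X × K => (filt U p.1, filt Uᶜ p.1, p.2) :=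
    ((measurable_filt hU).comp measurable_fst).prodMk
      (((measurable_filt hU.compl).comp measurable_fst).prodMk measurable_snd)
  refine ⟨fun p => C * c₀⁻¹ * I (filt U p.1, filt Uᶜ p.1, p.2),
    (hIm.comp hspm).const_mul _, ?_, ?_⟩
  · rintro ⟨c, k⟩
    -- Average the hypothesis `hF` over fresh points `a` in `U`: those of `S` with the prescribed
    -- statistic have probability at least `c₀`, whatever `c` is.
    have h1 : F (c, k) * c₀ ≤ C * I (filt U c, filt Uᶜ c, k) := by
      calc F (c, k) * c₀ ≤ F (c, k) * pois (μ.restrict U) (S ∩ st ⁻¹' {T (st (filt U c))}) := by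
            gcongr; exact hbd _
        _ = ∫⁻ a in S ∩ st ⁻¹' {T (st (filt U c))}, F (c, k) ∂pois (μ.restrict U) := by
            rw [setLIntegral_const]
        _ ≤ ∫⁻ a in S ∩ st ⁻¹' {T (st (filt U c))}, C * h ((filt U c, filt Uᶜ c, k), a)
              ∂pois (μ.restrict U) := by
            refine setLIntegral_mono ((hhm.comp (measurable_const.prodMk measurable_id)).const_mul _)
              fun a ha => ?_
            refine (hF c k a ha.1 ha.2).trans ?_
            gcongr
            have hmem : (((filt U c, filt Uᶜ c, k), a) : (PConf X × PConf X × K) × PConf X) ∈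
              {q : (PConf X × PConf X × K) × PConf X | q.2 ∈ S ∧ st q.2 = T (st q.1.1)} :=
                ⟨ha.1, by simpa using ha.2⟩
            simp only [hh]
            rw [Set.indicator_of_mem hmem]
            exact Set.indicator_le_indicator_of_subset hcore (fun _ => zero_le) _
        _ ≤ ∫⁻ a, C * h ((filt U c, filt Uᶜ c, k), a) ∂pois (μ.restrict U) :=
            setLIntegral_le_lintegral _ _
        _ = C * I (filt U c, filt Uᶜ c, k) :=
            lintegral_const_mul _ (hhm.comp (measurable_const.prodMk measurable_id))
    calc F (c, k) = F (c, k) * c₀ * c₀⁻¹ := by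
          rw [mul_assoc, ENNReal.mul_inv_cancel hc₀ hc₁, mul_one]
      _ ≤ C * I (filt U c, filt Uᶜ c, k) * c₀⁻¹ := by gcongr
      _ = _ := by ring
  · rw [lintegral_const_mul _ (hIm.fun_comp hspm)]
    refine mul_le_mul' le_rfl ?_
    rw [← lintegral_indicator hM, lintegral_prod_symm _ (hIm.fun_comp hspm).aemeasurable,
      lintegral_prod_symm _ (hw.indicator hM).aemeasurable]
    refine lintegral_mono fun k => ?_
    have hIk : Measurable fun q : PConf X × PConf X => I (q.1, q.2, k) :=
      hIm.comp (measurable_fst.prodMk (measurable_snd.prodMk measurable_const))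
    have hjk : Measurable fun q : PConf X × PConf X => g (join q.1 q.2, k) :=
      hgm.comp (measurable_join.prodMk measurable_const)
    -- Dropping the constraint on `a` makes the integrand independent of the old points in `U`,
    -- which integrate to one. The fresh points and the points outside `U` together form again a
    -- Poisson process with intensity `μ`.
    calc ∫⁻ c, I (filt U c, filt Uᶜ c, k) ∂pois μ
        = ∫⁻ q, I (q.1, q.2, k) ∂(pois (μ.restrict U)).prod (pois (μ.restrict Uᶜ)) := by
          rw [← pois_map_split μ hU, lintegral_map hIk hsp]
      _ ≤ ∫⁻ q : PConf X × PConf X, (∫⁻ a, g (join a q.2, k) ∂pois (μ.restrict U))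
            ∂(pois (μ.restrict U)).prod (pois (μ.restrict Uᶜ)) := by
          refine lintegral_mono fun q => lintegral_mono fun a => ?_
          exact Set.indicator_le_self _ _ _
      _ = ∫⁻ b, (∫⁻ a, g (join a b, k) ∂pois (μ.restrict U)) ∂pois (μ.restrict Uᶜ) := by
          rw [lintegral_prod_symm]
          · simp
          · exact (hjk.lintegral_prod_left'.comp measurable_snd).aemeasurable
      _ = ∫⁻ q, g (join q.1 q.2, k) ∂(pois (μ.restrict U)).prod (pois (μ.restrict Uᶜ)) := by
          rw [lintegral_prod_symm _ hjk.aemeasurable]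
      _ = ∫⁻ c, g (join (filt U c) (filt Uᶜ c), k) ∂pois μ := by
          rw [← pois_map_split μ hU, lintegral_map hjk hsp]
      _ ≤ ∫⁻ c, M.indicator w (c, k) ∂pois μ := by
          refine lintegral_mono fun c => ?_
          -- The rejoined configuration is a reordering of `c`. The weight does not see this, and
          -- membership in the core gives membership of `c` in `M`.
          obtain ⟨σ, hσ⟩ := exists_reorder U c
          rw [hg]
          by_cases hmem : (join (filt U c) (filt Uᶜ c), k) ∈ symCore M
          · rw [Set.indicator_of_mem hmem]
            have h2 := hmem σ
            rw [← hwσ _ k σ]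
            simp only at h2 ⊢
            rw [← hσ] at h2 ⊢
            rw [Set.indicator_of_mem h2]
          · rw [Set.indicator_of_notMem hmem]; exact zero_le

end PConf
end
end TFIM

namespace TFIM
noncomputable section
open scoped ENNReal

/-! ### Exchanging two labellings on part of a line -/

/-- Additivity of a counting function. -/
def Additive (S : Set ℝ → ℕ) : Prop := ∀ U V, S U = S (U ∩ V) + S (U \ V)

namespace Additive
variable {S T : Set ℝ → ℕ}

lemma empty (hS : Additive S) : S ∅ = 0 := by
  have := hS ∅ ∅
  simp at this
  exact this

lemma union (hS : Additive S) {U V : Set ℝ} (h : Disjoint U V) : S (U ∪ V) = S U + S V := by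
  rw [hS (U ∪ V) U, union_inter_cancel_left, union_sdiff_left, h.sdiff_eq_right]

lemma add (hS : Additive S) (hT : Additive T) : Additive fun U => S U + T U := fun U V => by
  have h1 := hS U V
  have h2 := hT U V
  dsimp only
  omega

lemma mono (hS : Additive S) {U V : Set ℝ} (h : U ⊆ V) : S U ≤ S V := by
  rw [hS V U, inter_eq_right.2 h]; omega

lemma Ico_add_Icc (hS : Additive S) {a u : ℝ} (h : a ≤ u) :
    S (Icc a u) = S (Ico a u) + S {u} := by
  rw [← hS.union (by simp), Ico_union_right h]

end Additive

/-- Here `S` counts the switches of both labellings together, `m` is the sum of their parities at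
`a`, and along the line `C` can begin or end only at points of `Bl`, where that sum is even on both
sides. A piece of `C` between two such points therefore contains an even number of switches; only a
piece starting at `a` or still running at `u` contributes, through the sum of the labels there. The
induction is on the number of points of `Bl` below `u`. -/
lemma even_switches_inter {a b : ℝ} {S : Set ℝ → ℕ} (hS : Additive S) {Bl C : Set ℝ}
    (hfin : Bl.Finite) (hdisj : ∀ z ∈ Bl, z ∉ C) (m : ℕ)
    (hconn : ∀ v v', a ≤ v → v ≤ v' → v' ≤ b → (∀ u ∈ Icc v v', u ∉ Bl) → (v ∈ C ↔ v' ∈ C))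
    (hbl : ∀ z ∈ Bl, a ≤ z → z ≤ b → Even (m + S (Ico a z)) ∧ Even (m + S (Icc a z)))
    [DecidablePred (· ∈ C)] (u : ℝ) (hau : a ≤ u) (hub : u ≤ b) :
    Even (S (Ico a u ∩ C) + (if u ∈ C then m + S (Ico a u) else 0) + (if a ∈ C then m else 0)) := by
  induction hn : (Bl ∩ Ico a u).ncard using Nat.strong_induction_on generalizing u with
  | _ n ih =>
  have hF : (Bl ∩ Ico a u).Finite := hfin.inter_of_left _
  rcases (Bl ∩ Ico a u).eq_empty_or_nonempty with he | hne
  · have hfree : ∀ v ∈ Ico a u, v ∉ Bl := fun v hv hb => by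
      have : v ∈ Bl ∩ Ico a u := ⟨hb, hv⟩
      rw [he] at this; exact this
    have hsame : ∀ v ∈ Ico a u, (a ∈ C ↔ v ∈ C) := fun v hv =>
      hconn a v le_rfl hv.1 (hv.2.le.trans hub) fun w hw => hfree w ⟨hw.1, hw.2.trans_lt hv.2⟩
    have hSC : S (Ico a u ∩ C) = if a ∈ C then S (Ico a u) else 0 := by
      split_ifs with haC
      · rw [inter_eq_left.2 fun v hv => (hsame v hv).1 haC]
      · rw [← hS.empty]; congr 1
        ext v; simp only [mem_inter_iff, mem_empty_iff_false, iff_false, not_and]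
        exact fun hv hvC => haC ((hsame v hv).2 hvC)
    rw [hSC]
    by_cases huB : u ∈ Bl
    · have h1 := (hbl u huB hau hub).1
      rw [if_neg (hdisj u huB)]
      split_ifs
      · rw [Nat.even_iff] at *; omega
      · simp
    · have h1 : a ∈ C ↔ u ∈ C := hconn a u le_rfl hau hub fun w hw hwB => by
        rcases hw.2.lt_or_eq with h | h
        · exact hfree w ⟨hw.1, h⟩ hwB
        · exact huB (h ▸ hwB)
      by_cases haC : a ∈ C
      · rw [if_pos haC, if_pos (h1.1 haC), if_pos haC, Nat.even_iff]; omega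
      · rw [if_neg haC, if_neg (fun h => haC (h1.2 h)), if_neg haC]; simp
  -- Cut at the last point `z` of `Bl` below `u`: the induction hypothesis covers the part below
  -- `z`, the point `z` is outside `C`, and the open interval from `z` to `u` lies entirely inside
  -- or entirely outside `C`.
  · obtain ⟨z, hz, hmax⟩ := hF.exists_maximal hne
    have hmax' : ∀ w ∈ Bl, w ∈ Ico a u → w ≤ z := fun w hw hwu => by
      by_contra h
      push Not at h
      exact absurd (hmax (show w ∈ Bl ∩ Ico a u from ⟨hw, hwu⟩) h.le) (not_le.2 h)
    have hzC := hdisj z hz.1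
    have hlt : (Bl ∩ Ico a z).ncard < n := by
      rw [← hn]
      refine ncard_lt_ncard ⟨inter_subset_inter_right _ (Ico_subset_Ico_right hz.2.2.le), ?_⟩ hF
      exact fun h => absurd (h hz).2.2 (lt_irrefl _)
    have h1 := ih _ hlt z hz.2.1 (hz.2.2.le.trans hub) rfl
    rw [if_neg hzC] at h1
    have hb := (hbl z hz.1 hz.2.1 (hz.2.2.le.trans hub)).2
    have hd1 : S (Ico a u ∩ C) = S (Ico a z ∩ C) + S (Ioo z u ∩ C) := by
      rw [← hS.union]
      · congr 1
        ext v
        simp only [mem_inter_iff, mem_Ico, mem_union, mem_Ioo]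
        constructor
        · rintro ⟨⟨h1, h2⟩, h3⟩
          rcases lt_trichotomy v z with h | h | h
          · exact Or.inl ⟨⟨h1, h⟩, h3⟩
          · exact absurd (h ▸ h3) hzC
          · exact Or.inr ⟨⟨h, h2⟩, h3⟩
        · rintro (⟨⟨h1, h2⟩, h3⟩ | ⟨⟨h1, h2⟩, h3⟩)
          · exact ⟨⟨h1, h2.trans hz.2.2⟩, h3⟩
          · exact ⟨⟨hz.2.1.trans h1.le, h2⟩, h3⟩
      · rw [disjoint_left]
        rintro v ⟨h1, _⟩ ⟨h2, _⟩
        exact absurd h1.2 (not_lt.2 h2.1.le)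
    have hd2 : S (Ico a u) = S (Icc a z) + S (Ioo z u) := by
      rw [← hS.union]
      · congr 1
        ext v
        simp only [mem_Ico, mem_union, mem_Ioo, mem_Icc]
        constructor
        · rintro ⟨h1, h2⟩
          rcases le_or_gt v z with h | h
          · exact Or.inl ⟨h1, h⟩
          · exact Or.inr ⟨h, h2⟩
        · rintro (⟨h1, h2⟩ | ⟨h1, h2⟩)
          · exact ⟨h1, h2.trans_lt hz.2.2⟩
          · exact ⟨hz.2.1.trans h1.le, h2⟩
      · rw [disjoint_left]
        intro v h1 h2
        exact absurd h1.2 (not_le.2 h2.1)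
    have hfree : ∀ v ∈ Ioo z u, v ∉ Bl := fun v hv hb =>
      absurd (hmax' v hb ⟨hz.2.1.trans hv.1.le, hv.2⟩) (not_le.2 hv.1)
    have hsame : ∀ v ∈ Ioo z u, ∀ v' ∈ Ioo z u, v ∈ C → v' ∈ C := by
      have key : ∀ v ∈ Ioo z u, ∀ v' ∈ Ioo z u, v ≤ v' → (v ∈ C ↔ v' ∈ C) := fun v hv v' hv' h =>
        hconn v v' (hz.2.1.trans hv.1.le) h (hv'.2.le.trans hub) fun w hw =>
          hfree w ⟨hv.1.trans_le hw.1, hw.2.trans_lt hv'.2⟩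
      intro v hv v' hv'
      rcases le_total v v' with h | h
      · exact (key v hv v' hv' h).1
      · exact (key v' hv' v hv h).2
    have hSC : (S (Ioo z u ∩ C) = S (Ioo z u) ∧ ∀ v ∈ Ioo z u, v ∈ C) ∨
        (S (Ioo z u ∩ C) = 0 ∧ ∀ v ∈ Ioo z u, v ∉ C) := by
      by_cases h : ∃ v ∈ Ioo z u, v ∈ C
      · obtain ⟨v, hv, hvC⟩ := h
        left
        have hall : ∀ v' ∈ Ioo z u, v' ∈ C := fun v' hv' => hsame v hv v' hv' hvC
        exact ⟨by rw [inter_eq_left.2 hall], hall⟩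
      · push Not at h
        right
        refine ⟨?_, h⟩
        rw [← hS.empty]; congr 1
        ext v; simp only [mem_inter_iff, mem_empty_iff_false, iff_false, not_and]
        exact h v
    by_cases huB : u ∈ Bl
    · have h2 := (hbl u huB hau hub).1
      rw [if_neg (hdisj u huB)]
      rw [Nat.even_iff] at *
      rcases hSC with ⟨h, _⟩ | ⟨h, _⟩ <;> omega
    · have hmid : (z + u) / 2 ∈ Ioo z u := ⟨by linarith [hz.2.2], by linarith [hz.2.2]⟩
      have h3 : (z + u) / 2 ∈ C ↔ u ∈ C :=
        hconn _ u (hz.2.1.trans hmid.1.le) hmid.2.le hub fun w hw hwB => by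
          rcases hw.2.lt_or_eq with h | h
          · exact hfree w ⟨hmid.1.trans_le hw.1, h⟩ hwB
          · exact huB (h ▸ hwB)
      rw [Nat.even_iff] at *
      rcases hSC with ⟨h, h'⟩ | ⟨h, h'⟩
      · rw [if_pos (h3.1 (h' _ hmid))]; omega
      · rw [if_neg fun hu => h' _ hmid (h3.2 hu)]; omega

/-- The data for exchanging two labellings of a line on the set `C`. -/
structure LineSwap (R : Regime) (r : ℝ) (k₁ k₂ k₁' k₂' : Bool) (T₁ T₂ T₁' T₂' : Set ℝ → ℕ)
    (Bl C : Set ℝ) : Prop where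
  nonneg : 0 ≤ r
  add₁ : Additive T₁
  add₂ : Additive T₂
  eq₁ : ∀ U, T₁' U = T₁ (U \ C) + T₂ (U ∩ C)
  eq₂ : ∀ U, T₂' U = T₂ (U \ C) + T₁ (U ∩ C)
  fin : Bl.Finite
  disj : ∀ z ∈ Bl, z ∉ C
  even₁ : ∀ z ∈ Bl, ¬ IsOdd R.bc₁ r k₁ T₁ z
  even₂ : ∀ z ∈ Bl, ¬ IsOdd R.bc₂ r k₂ T₂ z
  conn : ∀ v v', -r / 2 ≤ v → v ≤ v' → v' ≤ r / 2 → (∀ u ∈ Icc v v', u ∉ Bl) → (v ∈ C ↔ v' ∈ C)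
  thermal : R = .thermal → (0 ∈ C → k₁' = k₂ ∧ k₂' = k₁) ∧ (0 ∉ C → k₁' = k₁ ∧ k₂' = k₂) ∧
    (-r / 2 ∈ C ↔ r / 2 ∈ C) ∧ Even (T₁ (timeI r)) ∧ Even (T₂ (timeI r))
  ground : R = .ground → -r / 2 ∉ C ∧ r / 2 ∉ C ∧ k₁' = k₁ ∧ k₂' = k₂ ∧ Even (T₁ (timeI r))

namespace LineSwap
variable {R : Regime} {r : ℝ} {k₁ k₂ k₁' k₂' : Bool} {T₁ T₂ T₁' T₂' : Set ℝ → ℕ} {Bl C : Set ℝ}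

-- At a blocked point both labels are even, hence so is the sum of the parities just before it and
-- just after it. This allows `even_switches_inter` to be applied to the joint count `T₁ + T₂`.
open Classical in
lemma parity (h : LineSwap R r k₁ k₂ k₁' k₂' T₁ T₂ T₁' T₂' Bl C) (u : ℝ) (hu : u ∈ timeI r) :
    Even (T₁ (Ico (-r / 2) u ∩ C) + T₂ (Ico (-r / 2) u ∩ C) +
      (if u ∈ C then startParity R.bc₁ r k₁ T₁ + startParity R.bc₂ r k₂ T₂ +
        (T₁ (Ico (-r / 2) u) + T₂ (Ico (-r / 2) u)) else 0) +
      (if -r / 2 ∈ C then startParity R.bc₁ r k₁ T₁ + startParity R.bc₂ r k₂ T₂ else 0)) := by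
  refine even_switches_inter (h.add₁.add h.add₂) h.fin h.disj _ h.conn ?_ u hu.1 hu.2
  intro z hz _ _
  have h1 := h.even₁ z hz
  have h2 := h.even₂ z hz
  simp only [IsOdd, not_or, Nat.not_odd_iff] at h1 h2
  simp only [Nat.even_iff]
  omega

-- In the thermal regime the coins fix the labels at height `0`, so the parities at the lower end
-- are obtained by going down from there, using the parity identity at `u = 0`. In the ground regime
-- `C` avoids the lower end and the coins do not change.
open Classical in
lemma start (h : LineSwap R r k₁ k₂ k₁' k₂' T₁ T₂ T₁' T₂' Bl C) :
    (startParity R.bc₁ r k₁' T₁' % 2 = (startParity R.bc₁ r k₁ T₁ +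
      (if -r / 2 ∈ C then startParity R.bc₁ r k₁ T₁ + startParity R.bc₂ r k₂ T₂ else 0)) % 2) ∧
    (startParity R.bc₂ r k₂' T₂' % 2 = (startParity R.bc₂ r k₂ T₂ +
      (if -r / 2 ∈ C then startParity R.bc₁ r k₁ T₁ + startParity R.bc₂ r k₂ T₂ else 0)) % 2) := by
  have h0 : (0 : ℝ) ∈ timeI r := ⟨by linarith [h.nonneg], by linarith [h.nonneg]⟩
  have hp := h.parity 0 h0
  have e1 := h.eq₁ (Ico (-r / 2) 0)
  have e2 := h.eq₂ (Ico (-r / 2) 0)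
  have a1 := h.add₁ (Ico (-r / 2) 0) C
  have a2 := h.add₂ (Ico (-r / 2) 0) C
  cases R with
  | thermal =>
    obtain ⟨t1, t2, -⟩ := h.thermal rfl
    simp only [startParity, Regime.bc₁, Regime.bc₂, Nat.even_iff] at *
    by_cases hC : (0 : ℝ) ∈ C
    · obtain ⟨rfl, rfl⟩ := t1 hC
      simp only [hC, if_true] at hp
      split_ifs at * <;> omega
    · obtain ⟨rfl, rfl⟩ := t2 hC
      simp only [hC, if_false] at hp
      split_ifs at * <;> omega
  | ground =>
    obtain ⟨g1, -, rfl, rfl, -⟩ := h.ground rfl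
    simp [startParity, Regime.bc₁, Regime.bc₂, g1]

/-- Modulo two, the exchange shifts each label at `u` by the number of switches of both labellings
in `C` below `u`, plus the shift at the lower end. By `parity` this total is the sum of the two old
labels if `u ∈ C`, and zero otherwise; adding the sum of two labels to one of them gives the other.
-/
lemma isOdd (h : LineSwap R r k₁ k₂ k₁' k₂' T₁ T₂ T₁' T₂' Bl C) {u : ℝ} (hu : u ∈ timeI r) :
    (u ∈ C → (IsOdd R.bc₁ r k₁' T₁' u ↔ IsOdd R.bc₂ r k₂ T₂ u) ∧
      (IsOdd R.bc₂ r k₂' T₂' u ↔ IsOdd R.bc₁ r k₁ T₁ u)) ∧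
    (u ∉ C → (IsOdd R.bc₁ r k₁' T₁' u ↔ IsOdd R.bc₁ r k₁ T₁ u) ∧
      (IsOdd R.bc₂ r k₂' T₂' u ↔ IsOdd R.bc₂ r k₂ T₂ u)) := by
  classical
  have hp := h.parity u hu
  obtain ⟨s1, s2⟩ := h.start
  have e1 := h.eq₁ (Ico (-r / 2) u)
  have e2 := h.eq₂ (Ico (-r / 2) u)
  have a1 := h.add₁ (Ico (-r / 2) u) C
  have a2 := h.add₂ (Ico (-r / 2) u) C
  -- The new counts are not assumed additive; the one splitting that is needed follows from their
  -- expression through the old ones.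
  have hadd' : ∀ {T T' T'' : Set ℝ → ℕ}, Additive T → Additive T' →
      (∀ U, T'' U = T (U \ C) + T' (U ∩ C)) → T'' (Icc (-r / 2) u) =
        T'' (Ico (-r / 2) u) + T'' {u} := by
    intro T T' T'' hT hT' hT''
    rw [← Ico_union_right hu.1, hT'', hT'', hT'', union_sdiff_distrib, union_inter_distrib_right,
      hT.union, hT'.union]
    · ring
    · exact Disjoint.mono inter_subset_left inter_subset_left (by simp)
    · exact Disjoint.mono sdiff_subset sdiff_subset (by simp)
  have i1 := hadd' h.add₁ h.add₂ h.eq₁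
  have i2 := hadd' h.add₂ h.add₁ h.eq₂
  have j1 := h.add₁.Ico_add_Icc hu.1
  have j2 := h.add₂.Ico_add_Icc hu.1
  have p1 := h.eq₁ {u}
  have p2 := h.eq₂ {u}
  simp only [Nat.even_iff] at hp
  constructor
  · intro hC
    have hd : ({u} : Set ℝ) \ C = ∅ := by
      ext v
      simp only [mem_sdiff, mem_singleton_iff, mem_empty_iff_false, iff_false, not_and, not_not]
      rintro rfl; exact hC
    have hi : ({u} : Set ℝ) ∩ C = {u} := by simpa using hC
    rw [hd, hi, h.add₁.empty] at p1
    rw [hd, hi, h.add₂.empty] at p2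
    rw [if_pos hC] at hp
    simp only [IsOdd, Nat.odd_iff]
    constructor <;> (split_ifs at * <;> omega)
  · intro hC
    have hd : ({u} : Set ℝ) \ C = {u} := by simpa using hC
    have hi : ({u} : Set ℝ) ∩ C = ∅ := by simpa using hC
    rw [hd, hi, h.add₂.empty] at p1
    rw [hd, hi, h.add₁.empty] at p2
    rw [if_neg hC] at hp
    simp only [IsOdd, Nat.odd_iff]
    constructor <;> (split_ifs at * <;> omega)

/-- The parity identity at the upper end counts the exchanged switches of the whole line. In the
thermal regime the two ends belong to `C` together or not at all and carry equal labels, so their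
contributions cancel; in the ground regime neither end is in `C`. -/
lemma even_timeI (h : LineSwap R r k₁ k₂ k₁' k₂' T₁ T₂ T₁' T₂' Bl C) :
    Even (T₁' (timeI r)) ∧ (R = .thermal → Even (T₂' (timeI r))) := by
  classical
  have hr := h.nonneg
  have hend : r / 2 ∈ timeI r := ⟨by linarith, le_rfl⟩
  have hp := h.parity (r / 2) hend
  have hI : timeI r = Ico (-r / 2) (r / 2) ∪ {r / 2} := (Ico_union_right hend.1).symm
  have hdj : Disjoint (Ico (-r / 2) (r / 2)) {r / 2} := by simp
  have e1 := h.eq₁ (timeI r)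
  have e2 := h.eq₂ (timeI r)
  have a1 := h.add₁ (timeI r) C
  have a2 := h.add₂ (timeI r) C
  have b1 := h.add₁.union hdj
  have b2 := h.add₂.union hdj
  have c1 : ∀ {T : Set ℝ → ℕ}, Additive T → T (timeI r ∩ C) =
      T (Ico (-r / 2) (r / 2) ∩ C) + T ({r / 2} ∩ C) := by
    intro T hT
    rw [hI, union_inter_distrib_right, hT.union]
    exact Disjoint.mono inter_subset_left inter_subset_left hdj
  have d1 := c1 h.add₁
  have d2 := c1 h.add₂
  rw [← hI] at b1 b2
  cases R with
  | thermal =>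
    obtain ⟨-, -, hC, ev1, ev2⟩ := h.thermal rfl
    simp only [Nat.even_iff] at *
    simp only [hC] at hp
    by_cases hC' : r / 2 ∈ C
    · have hi : ({r / 2} : Set ℝ) ∩ C = {r / 2} := by simpa using hC'
      rw [hi] at d1 d2
      simp only [hC', if_true] at hp
      refine ⟨?_, fun _ => ?_⟩ <;> omega
    · have hi : ({r / 2} : Set ℝ) ∩ C = ∅ := by simpa using hC'
      rw [hi, h.add₁.empty] at d1
      rw [hi, h.add₂.empty] at d2
      simp only [hC', if_false] at hp
      refine ⟨?_, fun _ => ?_⟩ <;> omega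
  | ground =>
    obtain ⟨g1, g2, -, -, ev1⟩ := h.ground rfl
    have hi : ({r / 2} : Set ℝ) ∩ C = ∅ := by simpa using g2
    rw [hi, h.add₁.empty] at d1
    rw [hi, h.add₂.empty] at d2
    simp only [g1, g2, if_false] at hp
    simp only [Nat.even_iff] at *
    refine ⟨by omega, fun hh => by simp at hh⟩

end LineSwap
end
end TFIM

namespace TFIM
noncomputable section
open scoped ENNReal
variable {d N : ℕ}

/-! ### Labellings with sources -/

lemma Config.count_eq_cnt (c : Config) (U : Set ℝ) : c.count U = PConf.cnt c U := rfl

lemma Config.count_additive (c : Config) : Additive c.count := by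
  classical
  intro U V
  simp only [Config.count_eq_cnt, PConf.cnt_eq_sum]
  rw [← Finset.sum_add_distrib]
  refine Finset.sum_congr rfl fun i _ => ?_
  by_cases h1 : c.2 i ∈ U <;> by_cases h2 : c.2 i ∈ V <;> simp [h1, h2]

lemma Config.count_congr (c : Config) {U V : Set ℝ} (h : ∀ t ∈ c.points, (t ∈ U ↔ t ∈ V)) :
    c.count U = c.count V := by
  unfold Config.count
  congr 1
  ext i
  exact h _ ⟨i, rfl⟩

lemma Config.count_eq_zero (c : Config) {U : Set ℝ} (h : ∀ t ∈ c.points, t ∉ U) :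
    c.count U = 0 := by
  rw [c.count_congr (V := ∅) fun t ht => by simpa using h t ht, c.count_additive.empty]

lemma Config.mem_points_iff (c : Config) (t : ℝ) : t ∈ c.points ↔ c.count {t} ≠ 0 := by
  constructor
  · rintro ⟨i, rfl⟩ h
    rw [Config.count, Set.ncard_eq_zero] at h
    have : i ∈ ({i' | c.2 i' ∈ ({c.2 i} : Set ℝ)} : Set (Fin c.1)) := by simp
    rw [h] at this; exact this
  · intro h
    by_contra hn
    exact h (c.count_eq_zero fun s hs hst => hn (by rwa [mem_singleton_iff.1 hst] at hs))

lemma mem_edges {e : Lattice d × Lattice d} :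
    e ∈ edges d N ↔ (e.1 ∈ box d N ∧ e.2 ∈ box d N) ∧ e.1 < e.2 ∧ Nbr e.1 e.2 := by
  simp [edges]

/-- One endpoint of an edge. -/
def edgeFst (e : Edge d N) : Site d N :=
  ⟨e.1.1, (mem_edges.1 e.2).1.1⟩

/-- The other endpoint of an edge. -/
def edgeSnd (e : Edge d N) : Site d N :=
  ⟨e.1.2, (mem_edges.1 e.2).1.2⟩

lemma edgeFst_ne_edgeSnd (e : Edge d N) : edgeFst e ≠ edgeSnd e := fun h =>
  ((mem_edges.1 e.2).2.1).ne (congrArg Subtype.val h)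

lemma incident_iff (e : Edge d N) (y : Site d N) :
    (e.1.1 = y.1 ∨ e.1.2 = y.1) ↔ y = edgeFst e ∨ y = edgeSnd e := by
  simp [Subtype.ext_iff, edgeFst, edgeSnd, eq_comm]

lemma switchCount_additive (B : Edge d N → Config) (G : Site d N → Config) (y : Site d N) :
    Additive (switchCount B G y) := by
  intro U V
  simp only [switchCount]
  rw [(G y).count_additive U V]
  have : ∀ e : Edge d N, (if e.1.1 = y.1 ∨ e.1.2 = y.1 then (B e).count U else 0) =
      (if e.1.1 = y.1 ∨ e.1.2 = y.1 then (B e).count (U ∩ V) else 0) +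
      (if e.1.1 = y.1 ∨ e.1.2 = y.1 then (B e).count (U \ V) else 0) := by
    intro e
    split_ifs
    · exact (B e).count_additive U V
    · rfl
  simp only [this, Finset.sum_add_distrib]
  ring

/-- Handshake: a bridge has exactly two endpoints, and without ghost points there are no other
switches. -/
lemma even_sum_switchCount (B : Edge d N → Config) (U : Set ℝ) :
    Even (∑ y, switchCount B (fun _ => Config.empty) y U) := by
  classical
  have h0 : Config.empty.count U = 0 := Config.count_eq_zero _ (by rintro t ⟨i, _⟩; exact i.elim0)
  simp only [switchCount, h0, add_zero]
  rw [Finset.sum_comm]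
  refine Finset.even_sum _ fun e _ => ?_
  rw [← Finset.sum_filter]
  have : (Finset.univ.filter fun y : Site d N => e.1.1 = y.1 ∨ e.1.2 = y.1) =
      {edgeFst e, edgeSnd e} := by
    ext y; simp [incident_iff]
  rw [this, Finset.sum_pair (edgeFst_ne_edgeSnd e)]
  exact ⟨_, rfl⟩

open Classical in
/-- A single source at `q`. -/
def src (q : Site d N × ℝ) (y : Site d N) (U : Set ℝ) : ℕ := if y = q.1 ∧ q.2 ∈ U then 1 else 0

lemma src_additive (q : Site d N × ℝ) (y : Site d N) : Additive (src q y) := by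
  intro U V
  by_cases h1 : y = q.1 <;> by_cases h2 : q.2 ∈ U <;> by_cases h3 : q.2 ∈ V <;> simp [src, h1, h2, h3]

/-- Switching points of the first labelling with sources `α`. -/
def Pair.T₁ (ω : Pair d N) (α : Site d N → Set ℝ → ℕ) (y : Site d N) (U : Set ℝ) : ℕ :=
  ω.S y U + α y U

/-- Switching points of the second labelling with sources `β`. -/
def Pair.T₂ (ω : Pair d N) (β : Site d N → Set ℝ → ℕ) (y : Site d N) (U : Set ℝ) : ℕ :=
  ω.S' y U + β y U

/-- The product of the weights of the two labellings with sources. -/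
def srcWeight (δ : ℝ) (R : Regime) (r : ℝ) (α β : Site d N → Set ℝ → ℕ) (ω : Pair d N) : ℝ :=
  weight δ R.bc₁ r ω.coin (ω.T₁ α) * weight δ R.bc₂ r ω.coin' (ω.T₂ β)

/-- The cuts at points which are even in both labellings with sources. -/
def blocked (R : Regime) (r : ℝ) (ω : Pair d N) (α β : Site d N → Set ℝ → ℕ) :
    Set (Site d N × ℝ) :=
  {p | p.2 ∈ (ω.cuts p.1).points ∧ ¬ IsOdd R.bc₁ r (ω.coin p.1) (ω.T₁ α p.1) p.2 ∧
    ¬ IsOdd R.bc₂ r (ω.coin' p.1) (ω.T₂ β p.1) p.2}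

/-- A move along a line avoiding the set `Bl`. -/
def Seg (R : Regime) (r : ℝ) (Bl J : Set (Site d N × ℝ)) (p q : Site d N × ℝ) : Prop :=
  p.1 = q.1 ∧ ∃ I ∈ arcs R r p.2 q.2, ∀ u ∈ I, (p.1, u) ∈ J ∧ (p.1, u) ∉ Bl

/-- A move or a jump inside `J` avoiding `Bl`. -/
def Step (R : Regime) (r : ℝ) (ω : Pair d N) (Bl J : Set (Site d N × ℝ))
    (p q : Site d N × ℝ) : Prop :=
  (Seg R r Bl J p q ∨ Jump R r ω p q) ∧ q ∈ J ∧ q ∉ Bl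

/-- The points which can be reached from `o`. -/
def cluster (R : Regime) (r : ℝ) (ω : Pair d N) (α β : Site d N → Set ℝ → ℕ)
    (o : Site d N × ℝ) : Set (Site d N × ℝ) :=
  {q | Relation.ReflTransGen (Step R r ω (blocked R r ω α β) (subBox N N r)) o q}

lemma mem_subBox_iff {r : ℝ} {p : Site d N × ℝ} : p ∈ subBox N N r ↔ p.2 ∈ timeI r :=
  ⟨fun h => h.2, fun h => ⟨p.1.2, h⟩⟩

/-- Genericity: the points of all processes are inside the time interval, and no cut occurs at the
time of a bridge or at time `0`. -/
structure Generic (r : ℝ) (ω : Pair d N) : Prop where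
  bridge : ∀ e, ∀ t ∈ (ω.B e).points ∪ (ω.B' e).points, t ∈ Ioo (-r / 2) (r / 2)
  cut : ∀ y, ∀ t ∈ (ω.cuts y).points, t ∈ Ioo (-r / 2) (r / 2) ∧ t ≠ 0 ∧
    ∀ e, t ∉ (ω.B e).points ∪ (ω.B' e).points

/-- The configuration `ω'` arises from `ω` by exchanging the labellings in `C`. -/
structure SwapRel (R : Regime) (ω ω' : Pair d N) (C : Set (Site d N × ℝ)) : Prop where
  B : ∀ e U, (ω'.B e).count U = (ω.B e).count (U \ {t | (edgeFst e, t) ∈ C}) +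
    (ω.B' e).count (U ∩ {t | (edgeFst e, t) ∈ C})
  B' : ∀ e U, (ω'.B' e).count U = (ω.B' e).count (U \ {t | (edgeFst e, t) ∈ C}) +
    (ω.B e).count (U ∩ {t | (edgeFst e, t) ∈ C})
  G : ∀ y U, (ω'.G y).count U = (ω.G y).count U
  cuts : ∀ y U, (ω'.cuts y).count U = (ω.cuts y).count U
  thermal : R = .thermal → ∀ y, ((y, 0) ∈ C → ω'.coin y = ω.coin' y ∧ ω'.coin' y = ω.coin y) ∧
    ((y, 0) ∉ C → ω'.coin y = ω.coin y ∧ ω'.coin' y = ω.coin' y)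
  ground : R = .ground → ω'.coin = ω.coin ∧ ω'.coin' = ω.coin'

lemma points_eq_of_count {c c' : Config} (h : ∀ U, c.count U = c'.count U) :
    c.points = c'.points := by
  ext t; rw [Config.mem_points_iff, Config.mem_points_iff, h]

lemma jump_iff {R : Regime} {r : ℝ} {ω ω' : Pair d N}
    (hB : ∀ e, (ω'.B e).points ∪ (ω'.B' e).points = (ω.B e).points ∪ (ω.B' e).points)
    (hG : ∀ y, (ω'.G y).points = (ω.G y).points) (p q : Site d N × ℝ) :
    Jump R r ω' p q ↔ Jump R r ω p q := by
  have hg : ∀ y, ghost R r ω' y = ghost R r ω y := fun y => by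
    cases R <;> simp [ghost, hG]
  simp only [Jump, hB, hg]

/-- A bridge only changes its kind, so the union of both kinds, on which the possible jumps depend,
is unaffected. -/
lemma SwapRel.bridge {R : Regime} {ω ω' : Pair d N} {C : Set (Site d N × ℝ)}
    (h : SwapRel R ω ω' C) (e : Edge d N) :
    (ω'.B e).points ∪ (ω'.B' e).points = (ω.B e).points ∪ (ω.B' e).points := by
  ext t
  simp only [mem_union, Config.mem_points_iff]
  rw [h.B, h.B']
  have a1 := (ω.B e).count_additive {t} {t | (edgeFst e, t) ∈ C}
  have a2 := (ω.B' e).count_additive {t} {t | (edgeFst e, t) ∈ C}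
  omega

lemma measurableSet_isOdd {b : TemporalBC} {r : ℝ} {k : Bool} {S : Set ℝ → ℕ} (hS : Additive S) :
    MeasurableSet {t | IsOdd b r k S t} := by
  have h1 : Measurable fun t => S (Ico (-r / 2) t) :=
    Monotone.measurable fun s t hst => hS.mono (Ico_subset_Ico_right hst)
  have h2 : Measurable fun t => S (Icc (-r / 2) t) :=
    Monotone.measurable fun s t hst => hS.mono (Icc_subset_Icc_right hst)
  have hs : MeasurableSet {n : ℕ | Odd (startParity b r k S + n)} := MeasurableSet.of_discrete
  exact (h1 hs).union (h2 hs)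

lemma mem_ground_ends {r : ℝ} {ω : Pair d N} (y : Site d N) :
    -r / 2 ∈ ghost .ground r ω y ∧ r / 2 ∈ ghost .ground r ω y := by
  simp [ghost]

section Swap
variable {R : Regime} {r : ℝ} {ω ω' : Pair d N} {o q : Site d N × ℝ}
  {α β : Site d N → Set ℝ → ℕ}

lemma mem_cluster_of_step {p p' : Site d N × ℝ} (h : p ∈ cluster R r ω α β o)
    (hs : Step R r ω (blocked R r ω α β) (subBox N N r) p p') : p' ∈ cluster R r ω α β o :=
  Relation.ReflTransGen.tail h hs

lemma cluster_props (ho : o ∈ subBox N N r) (hob : o ∉ blocked R r ω α β) {p : Site d N × ℝ}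
    (h : p ∈ cluster R r ω α β o) : p ∈ subBox N N r ∧ p ∉ blocked R r ω α β := by
  rcases Relation.ReflTransGen.cases_tail h with h | ⟨_, _, h⟩
  · rw [h]; exact ⟨ho, hob⟩
  · exact h.2

lemma uIcc_mem_arcs (s t : ℝ) : uIcc s t ∈ arcs R r s t := by
  cases R <;> simp [arcs]

/-- An interval free of blocked points can be traversed in both directions. So on each line the
cluster is a union of components of the complement of the blocked points. -/
lemma cluster_line {y : Site d N} {v v' : ℝ} (hv : -r / 2 ≤ v) (hvv : v ≤ v') (hv' : v' ≤ r / 2)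
    (hfree : ∀ u ∈ Icc v v', (y, u) ∉ blocked R r ω α β) :
    (y, v) ∈ cluster R r ω α β o ↔ (y, v') ∈ cluster R r ω α β o := by
  have hin : ∀ u ∈ Icc v v', (y, u) ∈ subBox N N r := fun u hu =>
    mem_subBox_iff.2 ⟨hv.trans hu.1, hu.2.trans hv'⟩
  constructor
  · intro h
    refine mem_cluster_of_step h ⟨Or.inl ⟨rfl, uIcc v v', uIcc_mem_arcs _ _, ?_⟩,
      hin _ ⟨hvv, le_rfl⟩, hfree _ ⟨hvv, le_rfl⟩⟩
    intro u hu
    rw [uIcc_of_le hvv] at hu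
    exact ⟨hin u hu, hfree u hu⟩
  · intro h
    refine mem_cluster_of_step h ⟨Or.inl ⟨rfl, uIcc v' v, uIcc_mem_arcs _ _, ?_⟩,
      hin _ ⟨le_rfl, hvv⟩, hfree _ ⟨le_rfl, hvv⟩⟩
    intro u hu
    rw [uIcc_of_ge hvv] at hu
    exact ⟨hin u hu, hfree u hu⟩

/-- For the two ends of a line the complementary arc degenerates to these two points. Neither
carries a cut, by genericity, so one can always pass from one to the other. -/
lemma cluster_ends (hgen : Generic r ω) (hr : 0 ≤ r) (y : Site d N) :
    (y, -r / 2) ∈ cluster .thermal r ω α β o ↔ (y, r / 2) ∈ cluster .thermal r ω α β o := by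
  have h1 : (y, -r / 2) ∉ blocked .thermal r ω α β := fun h => lt_irrefl _ (hgen.cut y _ h.1).1.1
  have h2 : (y, r / 2) ∉ blocked .thermal r ω α β := fun h => lt_irrefl _ (hgen.cut y _ h.1).1.2
  have k1 : (y, -r / 2) ∈ subBox N N r := mem_subBox_iff.2 ⟨le_rfl, by simp; linarith⟩
  have k2 : (y, r / 2) ∈ subBox N N r := mem_subBox_iff.2 ⟨by simp; linarith, le_rfl⟩
  have hle : -r / 2 ≤ r / 2 := by linarith
  have key : ∀ u ∈ Icc (-r / 2) (-r / 2) ∪ Icc (r / 2) (r / 2), (y, u) ∈ subBox N N r ∧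
      (y, u) ∉ blocked .thermal r ω α β := by
    rintro u (hu | hu)
    · rw [Icc_self] at hu; rw [mem_singleton_iff.1 hu]; exact ⟨k1, h1⟩
    · rw [Icc_self] at hu; rw [mem_singleton_iff.1 hu]; exact ⟨k2, h2⟩
  constructor
  · intro h
    refine mem_cluster_of_step h ⟨Or.inl ⟨rfl, _, Or.inr rfl, ?_⟩, k2, h2⟩
    simpa only [min_eq_left hle, max_eq_right hle] using key
  · intro h
    refine mem_cluster_of_step h ⟨Or.inl ⟨rfl, _, Or.inr rfl, ?_⟩, k1, h1⟩
    simpa only [min_eq_right hle, max_eq_left hle] using key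

/-- Generically no cut occurs at the time of a bridge, so both endpoints are unblocked and can be
reached from each other. A bridge therefore never leaves the cluster. -/
lemma cluster_bridge (hgen : Generic r ω) {e : Edge d N} {t : ℝ}
    (ht : t ∈ (ω.B e).points ∪ (ω.B' e).points) :
    (edgeFst e, t) ∈ cluster R r ω α β o ↔ (edgeSnd e, t) ∈ cluster R r ω α β o := by
  have hin : t ∈ timeI r := Ioo_subset_Icc_self (hgen.bridge e t ht)
  have hub : ∀ y, (y, t) ∉ blocked R r ω α β := fun y hy => (hgen.cut y t hy.1).2.2 e ht
  constructor
  · exact fun h => mem_cluster_of_step h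
      ⟨Or.inr (Or.inl ⟨rfl, e, Or.inl rfl, ht⟩), mem_subBox_iff.2 hin, hub _⟩
  · exact fun h => mem_cluster_of_step h
      ⟨Or.inr (Or.inl ⟨rfl, e, Or.inr rfl, ht⟩), mem_subBox_iff.2 hin, hub _⟩

end Swap
end
end TFIM

/-! ### The switching argument for the cluster of the origin. -/

namespace TFIM
noncomputable section
open scoped ENNReal
variable {d N : ℕ} {R : Regime} {r : ℝ} {ω ω' : Pair d N} {o q : Site d N × ℝ}
  {β : Site d N → Set ℝ → ℕ}

lemma config_empty_count (U : Set ℝ) : Config.empty.count U = 0 :=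
  Config.count_eq_zero _ (by rintro t ⟨i, _⟩; exact i.elim0)

/-- The counts of the bridges at a site after the exchange. -/
lemma SwapRel.switchCount_eq {C : Set (Site d N × ℝ)} (h : SwapRel R ω ω' C)
    (hC : ∀ e, ∀ t ∈ (ω.B e).points ∪ (ω.B' e).points,
      ((edgeFst e, t) ∈ C ↔ (edgeSnd e, t) ∈ C))
    (hG : ∀ y, ∀ t ∈ (ω.G y).points, (y, t) ∉ C) (y : Site d N) (U : Set ℝ) :
    ω'.S y U = ω.S y (U \ {t | (y, t) ∈ C}) + ω.S' y (U ∩ {t | (y, t) ∈ C}) ∧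
    ω'.S' y U = ω.S' y (U \ {t | (y, t) ∈ C}) + ω.S y (U ∩ {t | (y, t) ∈ C}) := by
  -- The exchange rule tests membership in `C` at the first endpoint only; as bridges do not leave
  -- `C`, testing at `y` gives the same answer.
  have hy : ∀ e : Edge d N, (e.1.1 = y.1 ∨ e.1.2 = y.1) →
      ∀ t ∈ (ω.B e).points ∪ (ω.B' e).points, ((edgeFst e, t) ∈ C ↔ (y, t) ∈ C) := by
    intro e he t ht
    rcases (incident_iff e y).1 he with rfl | rfl
    · rfl
    · exact hC e t ht
  have c1 : ∀ e : Edge d N, (e.1.1 = y.1 ∨ e.1.2 = y.1) →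
      (ω'.B e).count U = (ω.B e).count (U \ {t | (y, t) ∈ C}) +
        (ω.B' e).count (U ∩ {t | (y, t) ∈ C}) := by
    intro e he
    rw [h.B]
    congr 1
    · exact Config.count_congr _ fun t ht => by
        have := hy e he t (Or.inl ht)
        simp only [mem_sdiff, mem_ofPred_eq, this]
    · exact Config.count_congr _ fun t ht => by
        have := hy e he t (Or.inr ht)
        simp only [mem_inter_iff, mem_ofPred_eq, this]
  have c2 : ∀ e : Edge d N, (e.1.1 = y.1 ∨ e.1.2 = y.1) →
      (ω'.B' e).count U = (ω.B' e).count (U \ {t | (y, t) ∈ C}) +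
        (ω.B e).count (U ∩ {t | (y, t) ∈ C}) := by
    intro e he
    rw [h.B']
    congr 1
    · exact Config.count_congr _ fun t ht => by
        have := hy e he t (Or.inr ht)
        simp only [mem_sdiff, mem_ofPred_eq, this]
    · exact Config.count_congr _ fun t ht => by
        have := hy e he t (Or.inl ht)
        simp only [mem_inter_iff, mem_ofPred_eq, this]
  have g1 : (ω.G y).count (U ∩ {t | (y, t) ∈ C}) = 0 :=
    Config.count_eq_zero _ fun t ht htC => hG y t ht htC.2
  have g2 : (ω.G y).count (U \ {t | (y, t) ∈ C}) = (ω.G y).count U := by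
    have := (ω.G y).count_additive U {t | (y, t) ∈ C}
    omega
  have hsum : ∀ (f g k : Edge d N → ℕ), (∀ e : Edge d N, (e.1.1 = y.1 ∨ e.1.2 = y.1) →
      f e = g e + k e) → (∑ e, if e.1.1 = y.1 ∨ e.1.2 = y.1 then f e else 0) =
        (∑ e, if e.1.1 = y.1 ∨ e.1.2 = y.1 then g e else 0) +
          ∑ e, if e.1.1 = y.1 ∨ e.1.2 = y.1 then k e else 0 := by
    intro f g k hfg
    rw [← Finset.sum_add_distrib]
    refine Finset.sum_congr rfl fun e _ => ?_
    split_ifs with he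
    · exact hfg e he
    · rfl
  have s1 := hsum _ _ _ c1
  have s2 := hsum _ _ _ c2
  simp only [Pair.S, Pair.S', switchCount, config_empty_count, h.G, g1, g2]
  omega

/-- The sum of two lengths is the length of the union plus that of the intersection, and both are
symmetric in the two labels. So exchanging the labels at some points leaves the total even length
unchanged. -/
lemma volume_even_add {b b' : TemporalBC} {k₁ k₂ k₁' k₂' : Bool} {T₁ T₂ T₁' T₂' : Set ℝ → ℕ}
    (h₂ : Additive T₂) (h₂' : Additive T₂')
    (h : ∀ u ∈ timeI r, ((IsOdd b r k₁' T₁' u ↔ IsOdd b r k₁ T₁ u) ∧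
      (IsOdd b' r k₂' T₂' u ↔ IsOdd b' r k₂ T₂ u)) ∨ ((IsOdd b r k₁' T₁' u ↔ IsOdd b' r k₂ T₂ u) ∧
      (IsOdd b' r k₂' T₂' u ↔ IsOdd b r k₁ T₁ u))) :
    (volume {t ∈ timeI r | ¬ IsOdd b r k₁ T₁ t}).toReal +
      (volume {t ∈ timeI r | ¬ IsOdd b' r k₂ T₂ t}).toReal =
    (volume {t ∈ timeI r | ¬ IsOdd b r k₁' T₁' t}).toReal +
      (volume {t ∈ timeI r | ¬ IsOdd b' r k₂' T₂' t}).toReal := by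
  have hfin : ∀ (P : ℝ → Prop), volume {t ∈ timeI r | P t} ≠ ∞ := fun P =>
    ((measure_mono (fun t ht => ht.1)).trans_lt (by
      rw [volume_timeI]; exact ENNReal.ofReal_lt_top : volume (timeI r) < ∞)).ne
  have hm : ∀ {b k} {T : Set ℝ → ℕ}, Additive T → MeasurableSet {t ∈ timeI r | ¬ IsOdd b r k T t} :=
    fun hT => (measurableSet_timeI r).inter (measurableSet_isOdd hT).compl
  rw [← ENNReal.toReal_add (hfin _) (hfin _), ← ENNReal.toReal_add (hfin _) (hfin _),
    ← measure_union_add_inter _ (hm h₂), ← measure_union_add_inter _ (hm h₂')]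
  congr 3
  · ext t
    simp only [mem_union, mem_ofPred_eq]
    constructor
    · rintro (⟨h1, h2⟩ | ⟨h1, h2⟩) <;> rcases h t h1 with h | h <;> tauto
    · rintro (⟨h1, h2⟩ | ⟨h1, h2⟩) <;> rcases h t h1 with h | h <;> tauto
  · ext t
    simp only [mem_inter_iff, mem_ofPred_eq]
    constructor
    · rintro ⟨⟨h1, h2⟩, ⟨-, h3⟩⟩; rcases h t h1 with h | h <;> tauto
    · rintro ⟨⟨h1, h2⟩, ⟨-, h3⟩⟩; rcases h t h1 with h | h <;> tauto

/-- The exchange of the two labellings in the cluster of `o`, provided that it is not connected to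
the ghost. -/
theorem swap_cluster (hr : 0 ≤ r) (hgen : Generic r ω) (ho : o.2 = 0)
    (hng : ∀ p ∈ cluster R r ω 0 (src o + src q) o, p.2 ∉ ghost R r ω p.1)
    (hrel : SwapRel R ω ω' (cluster R r ω 0 (src o + src q) o))
    (hc₁ : Consistent R.bc₁ r (ω.T₁ 0)) (hc₂ : Consistent R.bc₂ r (ω.T₂ (src o + src q)))
    (δ : ℝ) :
    srcWeight δ R r 0 (src o + src q) ω = srcWeight δ R r (src o + src q) 0 ω' ∧
      cluster R r ω' (src o + src q) 0 o = cluster R r ω 0 (src o + src q) o := by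
  classical
  set β : Site d N → Set ℝ → ℕ := src o + src q with hβ
  set C := cluster R r ω 0 β o with hCdef
  have hoK : o ∈ subBox N N r := mem_subBox_iff.2 (by
    rw [ho]; exact ⟨by linarith, by linarith⟩)
  have hob : o ∉ blocked R r ω 0 β := fun h => (hgen.cut _ _ h.1).2.1 ho
  have hoC : o ∈ C := Relation.ReflTransGen.refl
  have hprops : ∀ p ∈ C, p ∈ subBox N N r ∧ p ∉ blocked R r ω 0 β := fun p hp =>
    cluster_props hoK hob hp
  have hGC : ∀ y, ∀ t ∈ (ω.G y).points, (y, t) ∉ C := by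
    intro y t ht hC
    refine hng _ hC ?_
    cases R
    · exact ht
    · exact Or.inl ht
  have hSC := hrel.switchCount_eq (fun e t ht => cluster_bridge hgen ht) hGC
  have hβadd : ∀ y, Additive (β y) := fun y => (src_additive o y).add (src_additive q y)
  have hz : Additive (fun _ : Set ℝ => 0) := fun _ _ => rfl
  have hT1 : ∀ y, Additive (ω.T₁ 0 y) := fun y => (switchCount_additive _ _ y).add hz
  have hT2 : ∀ y, Additive (ω.T₂ β y) := fun y => (switchCount_additive _ _ y).add (hβadd y)
  -- the exchanged switching points
  let γ : Site d N → Set ℝ → ℕ := fun y U => β y (U ∩ {t | (y, t) ∈ C})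
  let γ' : Site d N → Set ℝ → ℕ := fun y U => β y (U \ {t | (y, t) ∈ C})
  have hline : ∀ y, LineSwap R r (ω.coin y) (ω.coin' y) (ω'.coin y) (ω'.coin' y) (ω.T₁ 0 y)
      (ω.T₂ β y) (ω'.T₁ γ y) (ω'.T₂ γ' y) {t | (y, t) ∈ blocked R r ω 0 β} {t | (y, t) ∈ C} := by
    intro y
    refine ⟨hr, hT1 y, hT2 y, ?_, ?_, ?_, ?_, ?_, ?_, ?_, ?_, ?_⟩
    · intro U
      have := (hSC y U).1
      simp only [Pair.T₁, Pair.T₂, γ, this, Pi.zero_apply]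
      ring
    · intro U
      have := (hSC y U).2
      simp only [Pair.T₁, Pair.T₂, γ', this, Pi.zero_apply]
      ring
    · exact (Set.finite_range (ω.cuts y).2).subset fun t ht => ht.1
    · exact fun z hz hzC => (hprops _ hzC).2 hz
    · exact fun z hz => hz.2.1
    · exact fun z hz => hz.2.2
    · exact fun v v' h1 h2 h3 h4 => cluster_line h1 h2 h3 h4
    · intro hR
      subst hR
      exact ⟨(hrel.thermal rfl y).1, (hrel.thermal rfl y).2, cluster_ends hgen hr y, hc₁ y, hc₂ y⟩
    · intro hR
      subst hR
      exact ⟨fun h => hng _ h (mem_ground_ends y).1, fun h => hng _ h (mem_ground_ends y).2,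
        congrFun (hrel.ground rfl).1 y, congrFun (hrel.ground rfl).2 y, hc₁ y⟩
  -- If `q` were outside `C`, the first labelling would after the exchange have `o` as its only
  -- source. But each line has an even number of switching points and sources in total, and the
  -- bridges contribute an even number, so a single source is impossible.
  have hqC : q ∈ C := by
    by_contra hq
    have h1 : ∀ y, Even (ω'.T₁ γ y (timeI r)) := fun y => (hline y).even_timeI.1
    have h2 : Even (∑ y, ω'.T₁ γ y (timeI r)) := Finset.even_sum _ fun y _ => h1 y
    have h3 : ∑ y, ω'.T₁ γ y (timeI r) = ∑ y, ω'.S y (timeI r) + 1 := by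
      simp only [Pair.T₁, Finset.sum_add_distrib]
      congr 1
      rw [Finset.sum_eq_single o.1]
      · have hoI : o.2 ∈ timeI r ∩ {t | (o.1, t) ∈ C} := ⟨hoK.2, hoC⟩
        have hqI : ¬ (o.1 = q.1 ∧ q.2 ∈ timeI r ∩ {t | (o.1, t) ∈ C}) := by
          rintro ⟨h1, h2⟩
          apply hq
          have := h2.2
          rw [h1] at this
          exact this
        simp only [γ, hβ, Pi.add_apply, src]
        rw [if_pos ⟨trivial, hoI⟩, if_neg hqI]
      · intro y _ hy
        have hqI : ¬ (y = q.1 ∧ q.2 ∈ timeI r ∩ {t | (y, t) ∈ C}) := by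
          rintro ⟨h1, h2⟩
          apply hq
          have := h2.2
          rw [h1] at this
          exact this
        simp only [γ, hβ, Pi.add_apply, src]
        rw [if_neg fun h => hy h.1, if_neg hqI, add_zero]
      · simp
    rw [h3] at h2
    have h4 : Even (∑ y, ω'.S y (timeI r)) := even_sum_switchCount _ _
    rw [Nat.even_iff] at h2 h4
    omega
  -- Since both sources lie in `C`, the exchange moves all of them: `γ = β` and nothing remains in
  -- `γ'`.
  have hsrc : ∀ s ∈ C, ∀ (y : Site d N) (U : Set ℝ), src s y (U ∩ {t | (y, t) ∈ C}) = src s y U := by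
    intro s hs y U
    unfold src
    congr 1
    refine propext ⟨fun h => ⟨h.1, h.2.1⟩, fun h => ⟨h.1, h.2, ?_⟩⟩
    rw [mem_ofPred_eq, h.1]; exact hs
  have hγ : γ = β := by
    funext y U
    simp only [γ, hβ, Pi.add_apply, hsrc o hoC, hsrc q hqC]
  have hγ' : γ' = 0 := by
    funext y U
    have h1 := hβadd y U {t | (y, t) ∈ C}
    have h2 : β y (U ∩ {t | (y, t) ∈ C}) = β y U := congrFun (congrFun hγ y) U
    simp only [γ', Pi.zero_apply]
    omega
  rw [hγ, hγ'] at hline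
  have hodd := fun y (u : ℝ) (hu : u ∈ timeI r) => (hline y).isOdd hu
  have hcons₁ : Consistent R.bc₁ r (ω'.T₁ β) := by
    cases R
    · exact fun y => (hline y).even_timeI.1
    · exact fun y => (hline y).even_timeI.1
  have hcons₂ : Consistent R.bc₂ r (ω'.T₂ 0) := by
    cases R
    · exact fun y => (hline y).even_timeI.2 rfl
    · exact trivial
  -- Being even in both labellings is symmetric in the two labels, so the same cuts are blocked
  -- after the exchange.
  have hbl : blocked R r ω' β 0 = blocked R r ω 0 β := by
    ext ⟨y, u⟩
    have hcp : (ω'.cuts y).points = (ω.cuts y).points := points_eq_of_count (hrel.cuts y)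
    simp only [blocked, mem_ofPred_eq, hcp]
    refine and_congr_right fun hu => ?_
    have huI : u ∈ timeI r := Ioo_subset_Icc_self (hgen.cut y u hu).1
    by_cases huC : u ∈ {t | (y, t) ∈ C}
    · have := (hodd y u huI).1 huC
      rw [this.1, this.2, and_comm]
    · have := (hodd y u huI).2 huC
      rw [this.1, this.2]
  constructor
  · have hvol : ∀ y, (volume {t ∈ timeI r | ¬ IsOdd R.bc₁ r (ω.coin y) (ω.T₁ 0 y) t}).toReal +
      (volume {t ∈ timeI r | ¬ IsOdd R.bc₂ r (ω.coin' y) (ω.T₂ β y) t}).toReal =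
      (volume {t ∈ timeI r | ¬ IsOdd R.bc₁ r (ω'.coin y) (ω'.T₁ β y) t}).toReal +
      (volume {t ∈ timeI r | ¬ IsOdd R.bc₂ r (ω'.coin' y) (ω'.T₂ 0 y) t}).toReal := by
      intro y
      refine volume_even_add (hT2 y) ((switchCount_additive _ _ y).add hz) fun u hu => ?_
      by_cases huC : u ∈ {t | (y, t) ∈ C}
      · exact Or.inr ((hodd y u hu).1 huC)
      · exact Or.inl ((hodd y u hu).2 huC)
    simp only [srcWeight, weight, if_pos hc₁, if_pos hc₂, if_pos hcons₁, if_pos hcons₂]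
    rw [← Real.exp_add, ← Real.exp_add, ← mul_add, ← mul_add, ← Finset.sum_add_distrib,
      ← Finset.sum_add_distrib, Finset.sum_congr rfl fun y _ => hvol y]
  · have hstep : Step R r ω' (blocked R r ω' β 0) (subBox N N r) =
        Step R r ω (blocked R r ω 0 β) (subBox N N r) := by
      funext p p'
      simp only [Step, hbl, jump_iff hrel.bridge (fun y => points_eq_of_count (hrel.G y))]
    simp only [hCdef, cluster, hstep]

end
end TFIM

namespace TFIM
noncomputable section
open scoped ENNReal
variable {d N : ℕ} {R : Regime} {r : ℝ} {o q : Site d N × ℝ}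

/-! ### Exchanging the colours of bridges -/

/-- Exchange of the marks of the two kinds of bridges. -/
def Mark.flip : Mark d N → Mark d N
  | Sum.inl e => Sum.inr (Sum.inl e)
  | Sum.inr (Sum.inl e) => Sum.inl e
  | Sum.inr (Sum.inr x) => Sum.inr (Sum.inr x)

lemma Mark.flip_flip (m : Mark d N) : m.flip.flip = m := by
  rcases m with e | e | x <;> rfl

lemma Mark.rate_flip (lam δ : ℝ) (m : Mark d N) : Mark.rate lam δ m.flip = Mark.rate lam δ m := by
  rcases m with e | e | x | x <;> rfl

namespace Mark
lemma exists_eq (m : Mark d N) :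
    (∃ e, m = b e) ∨ (∃ e, m = b' e) ∨ (∃ x, m = g x) ∨ ∃ x, m = cut x := by
  rcases m with e | e | x | x
  · exact Or.inl ⟨e, rfl⟩
  · exact Or.inr (Or.inl ⟨e, rfl⟩)
  · exact Or.inr (Or.inr (Or.inl ⟨x, rfl⟩))
  · exact Or.inr (Or.inr (Or.inr ⟨x, rfl⟩))

@[simp] lemma b_inj {e e' : Edge d N} : b e = b e' ↔ e = e' :=
  ⟨fun h => Sum.inl.inj h, fun h => h ▸ rfl⟩
@[simp] lemma b'_inj {e e' : Edge d N} : b' e = b' e' ↔ e = e' :=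
  ⟨fun h => Sum.inl.inj (Sum.inr.inj h), fun h => h ▸ rfl⟩
@[simp] lemma b_ne_b' {e e' : Edge d N} : b e ≠ b' e' := fun h => Sum.inl_ne_inr h
@[simp] lemma b'_ne_b {e e' : Edge d N} : b' e ≠ b e' := fun h => Sum.inr_ne_inl h
@[simp] lemma g_ne_b {x : Site d N} {e : Edge d N} : g x ≠ b e := fun h => Sum.inr_ne_inl h
@[simp] lemma g_ne_b' {x : Site d N} {e : Edge d N} : g x ≠ b' e :=
  fun h => Sum.inr_ne_inl (Sum.inr.inj h)
@[simp] lemma cut_ne_b {x : Site d N} {e : Edge d N} : cut x ≠ b e := fun h => Sum.inr_ne_inl h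
@[simp] lemma cut_ne_b' {x : Site d N} {e : Edge d N} : cut x ≠ b' e :=
  fun h => Sum.inr_ne_inl (Sum.inr.inj h)
@[simp] lemma flip_b (e : Edge d N) : flip (b e) = b' e := rfl
@[simp] lemma flip_b' (e : Edge d N) : flip (b' e) = b e := rfl
@[simp] lemma flip_g (x : Site d N) : flip (g x) = g x := rfl
@[simp] lemma flip_cut (x : Site d N) : flip (cut x) = cut x := rfl
end Mark

/-- Exchange of the colour of a marked point, if `a` holds. -/
def recolour (a : Bool) (p : Mark d N × ℝ) : Mark d N × ℝ := if a then (p.1.flip, p.2) else p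

lemma recolour_snd (a : Bool) (p : Mark d N × ℝ) : (recolour a p).2 = p.2 := by
  cases a <;> rfl

/-- Both kinds of bridges have the same rate `λ`, and all other marks are fixed. -/
lemma measurePreserving_recolour (lam δ r : ℝ) (a : Bool) :
    MeasurePreserving (recolour a) (Mark.meas d N lam δ r) (Mark.meas d N lam δ r) := by
  cases a
  · exact MeasurePreserving.id _
  · have hm : Measurable (recolour (d := d) (N := N) true) :=
      ((measurable_of_countable Mark.flip).comp measurable_fst).prodMk measurable_snd
    refine ⟨hm, ?_⟩
    ext s hs
    rw [Measure.map_apply hm hs, Mark.meas_apply _ _ _ (hm hs), Mark.meas_apply _ _ _ hs]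
    refine Fintype.sum_equiv (Function.Involutive.toPerm _ Mark.flip_flip) _ _ fun m => ?_
    change _ = rateMeas (Mark.rate lam δ m.flip) r {t | (m.flip, t) ∈ s}
    rw [Mark.rate_flip]
    rfl

/-- The configuration `c` with some points recoloured. -/
def recol (c : PConf (Mark d N × ℝ)) (a : Fin c.1 → Bool) : PConf (Mark d N × ℝ) :=
  PConf.mk c.1 fun i => recolour (a i) (c.2 i)

lemma recol_count (c : PConf (Mark d N × ℝ)) (a : Fin c.1 → Bool) (m : Mark d N) (U : Set ℝ)
    [∀ i, Decidable (recolour (a i) (c.2 i) ∈ ({m} : Set (Mark d N)) ×ˢ U)] :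
    (component (recol c a) m).count U =
      ∑ i : Fin c.1, if recolour (a i) (c.2 i) ∈ ({m} : Set (Mark d N)) ×ˢ U then 1 else 0 := by
  classical
  rw [component_count, PConf.cnt_eq_sum]
  refine Finset.sum_congr rfl fun i _ => ?_
  by_cases h : recolour (a i) (c.2 i) ∈ ({m} : Set (Mark d N)) ×ˢ U
  · rw [if_pos h]; exact if_pos h
  · rw [if_neg h]; exact if_neg h

/-- The time at which a configuration has a point with the mark `m`. -/
lemma mem_component_points {c : PConf (Mark d N × ℝ)} {m : Mark d N} {t : ℝ} :
    t ∈ (component c m).points ↔ ∃ i, c.2 i = (m, t) := by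
  classical
  rw [Config.mem_points_iff, component_count, PConf.cnt_eq_sum]
  rw [Ne, Finset.sum_eq_zero_iff]
  push Not
  refine exists_congr fun i => ?_
  simp [Prod.ext_iff]

/-- The times of the configuration are distinct, inside the time interval and not zero. -/
def GenericTimes (r : ℝ) (c : PConf (Mark d N × ℝ)) : Prop :=
  Function.Injective (fun i => (c.2 i).2) ∧ ∀ i, (c.2 i).2 ∈ Icc (-r / 2) (r / 2) \ {-r / 2, 0, r / 2}

lemma GenericTimes.generic {c : PConf (Mark d N × ℝ)} (h : GenericTimes r c) (k : Coins d N) :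
    Generic r (toPair (c, k)) := by
  have hI : ∀ m, ∀ t ∈ (component c m).points, t ∈ Ioo (-r / 2) (r / 2) ∧ t ≠ 0 := by
    intro m t ht
    obtain ⟨i, hi⟩ := mem_component_points.1 ht
    have := h.2 i
    rw [hi] at this
    simp only [mem_sdiff, mem_Icc, mem_insert_iff, mem_singleton_iff, not_or] at this
    exact ⟨⟨lt_of_le_of_ne this.1.1 (Ne.symm this.2.1), lt_of_le_of_ne this.1.2 this.2.2.2⟩,
      this.2.2.1⟩
  have hne : ∀ m m', m ≠ m' → ∀ t ∈ (component c m).points, t ∉ (component c m').points := by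
    intro m m' hm t ht ht'
    obtain ⟨i, hi⟩ := mem_component_points.1 ht
    obtain ⟨j, hj⟩ := mem_component_points.1 ht'
    have : i = j := h.1 (by simp [hi, hj])
    subst this
    rw [hi] at hj
    exact hm (congrArg Prod.fst hj)
  refine ⟨?_, ?_⟩
  · rintro e t (ht | ht)
    · exact (hI _ t ht).1
    · exact (hI _ t ht).1
  · intro y t ht
    refine ⟨(hI _ t ht).1, (hI _ t ht).2, ?_⟩
    rintro e (ht' | ht')
    · exact hne _ _ Mark.cut_ne_b t ht ht'
    · exact hne _ _ Mark.cut_ne_b' t ht ht'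

lemma GenericTimes.recol {c : PConf (Mark d N × ℝ)} (h : GenericTimes r c) (a : Fin c.1 → Bool) :
    GenericTimes r (recol c a) := by
  constructor
  · intro i j hij
    refine h.1 ?_
    simpa [TFIM.recol, PConf.mk, recolour_snd] using hij
  · intro i
    have := h.2 i
    rwa [← recolour_snd (a i)] at this

open Classical in
/-- The bridge with mark and time `p` belongs to `C`. -/
def inRegion (C : Set (Site d N × ℝ)) (p : Mark d N × ℝ) : Bool :=
  decide (∃ e, (p.1 = Mark.b e ∨ p.1 = Mark.b' e) ∧ (edgeFst e, p.2) ∈ C)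

open Classical in
/-- Exchange of the coins in `C`, in the thermal regime. -/
def swapCoins (R : Regime) (C : Set (Site d N × ℝ)) (k : Coins d N) : Coins d N :=
  (fun y => if R = .thermal ∧ (y, 0) ∈ C then k.2 y else k.1 y,
    fun y => if R = .thermal ∧ (y, 0) ∈ C then k.1 y else k.2 y)

lemma swapCoins_swapCoins (C : Set (Site d N × ℝ)) (k : Coins d N) :
    swapCoins R C (swapCoins R C k) = k := by
  ext y <;> by_cases h : R = .thermal ∧ (y, 0) ∈ C <;> simp [swapCoins, h]

/-- Exchanging the labellings in `C` is one more recolouring, applied to the bridges in `C`, and is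
thus an exclusive or on the indices `a`. In this form the exchange acts within a single orbit of
recolourings. -/
lemma recolour_mem_bridge (C : Set (Site d N × ℝ)) (a : Bool) (p : Mark d N × ℝ) (e : Edge d N)
    (U : Set ℝ) :
    (recolour (a ^^ inRegion C p) p ∈ ({Mark.b e} : Set (Mark d N)) ×ˢ U ↔
      (recolour a p ∈ ({Mark.b e} : Set (Mark d N)) ×ˢ (U \ {t | (edgeFst e, t) ∈ C}) ∨
        recolour a p ∈ ({Mark.b' e} : Set (Mark d N)) ×ˢ (U ∩ {t | (edgeFst e, t) ∈ C}))) ∧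
    (recolour (a ^^ inRegion C p) p ∈ ({Mark.b' e} : Set (Mark d N)) ×ˢ U ↔
      (recolour a p ∈ ({Mark.b' e} : Set (Mark d N)) ×ˢ (U \ {t | (edgeFst e, t) ∈ C}) ∨
        recolour a p ∈ ({Mark.b e} : Set (Mark d N)) ×ˢ (U ∩ {t | (edgeFst e, t) ∈ C}))) := by
  obtain ⟨m, t⟩ := p
  rcases m.exists_eq with ⟨e', rfl⟩ | ⟨e', rfl⟩ | ⟨x, rfl⟩ | ⟨x, rfl⟩
  · by_cases hC : (edgeFst e', t) ∈ C <;> by_cases he : e' = e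
    · subst he; cases a <;> simp [recolour, inRegion, hC]
    · cases a <;> simp [recolour, inRegion, hC, he]
    · subst he; cases a <;> simp [recolour, inRegion, hC]
    · cases a <;> simp [recolour, inRegion, hC, he]
  · by_cases hC : (edgeFst e', t) ∈ C <;> by_cases he : e' = e
    · subst he; cases a <;> simp [recolour, inRegion, hC]
    · cases a <;> simp [recolour, inRegion, hC, he]
    · subst he; cases a <;> simp [recolour, inRegion, hC]
    · cases a <;> simp [recolour, inRegion, hC, he]
  · cases a <;> simp [recolour, inRegion]
  · cases a <;> simp [recolour, inRegion]

lemma recolour_mem_other (a : Bool) (p : Mark d N × ℝ) {m : Mark d N} (hm : m.flip = m)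
    (U : Set ℝ) : recolour a p ∈ ({m} : Set (Mark d N)) ×ˢ U ↔
      p ∈ ({m} : Set (Mark d N)) ×ˢ U := by
  obtain ⟨m', t⟩ := p
  cases a
  · rfl
  · simp only [recolour, if_true, mem_prod, mem_singleton_iff]
    refine and_congr_left fun _ => ⟨fun h => ?_, fun h => by rw [h, hm]⟩
    rw [← m'.flip_flip, h, hm]

lemma swapRel_recol (R : Regime) (c : PConf (Mark d N × ℝ)) (a : Fin c.1 → Bool) (k : Coins d N)
    (C : Set (Site d N × ℝ)) :
    SwapRel R (toPair (recol c a, k))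
      (toPair (recol c fun i => a i ^^ inRegion C (c.2 i), swapCoins R C k)) C := by
  classical
  have key : ∀ (m m' : Mark d N) (U V V' : Set ℝ), m ≠ m' → (∀ i : Fin c.1,
      (recolour (a i ^^ inRegion C (c.2 i)) (c.2 i) ∈ ({m} : Set (Mark d N)) ×ˢ U ↔
      (recolour (a i) (c.2 i) ∈ ({m} : Set (Mark d N)) ×ˢ V ∨
        recolour (a i) (c.2 i) ∈ ({m'} : Set (Mark d N)) ×ˢ V'))) →
      (component (recol c fun i => a i ^^ inRegion C (c.2 i)) m).count U =
        (component (recol c a) m).count V + (component (recol c a) m').count V' := by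
    intro m m' U V V' hm h
    rw [recol_count, recol_count, recol_count, ← Finset.sum_add_distrib]
    refine Finset.sum_congr rfl fun i _ => ?_
    have h1 : ¬ (recolour (a i) (c.2 i) ∈ ({m} : Set (Mark d N)) ×ˢ V ∧
        recolour (a i) (c.2 i) ∈ ({m'} : Set (Mark d N)) ×ˢ V') := by
      rintro ⟨h1, h2⟩
      exact hm (h1.1.symm.trans h2.1)
    rw [if_congr (h i) rfl rfl]
    by_cases p1 : recolour (a i) (c.2 i) ∈ ({m} : Set (Mark d N)) ×ˢ V <;>
      by_cases p2 : recolour (a i) (c.2 i) ∈ ({m'} : Set (Mark d N)) ×ˢ V'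
    · exact absurd ⟨p1, p2⟩ h1
    all_goals simp only [p1, p2, if_true, if_false, or_true, or_false, add_zero, zero_add]
  have key2 : ∀ (m : Mark d N) (_ : m.flip = m) (U : Set ℝ),
      (component (recol c fun i => a i ^^ inRegion C (c.2 i)) m).count U =
        (component (recol c a) m).count U := by
    intro m hm U
    rw [recol_count, recol_count]
    refine Finset.sum_congr rfl fun i _ => ?_
    rw [if_congr ((recolour_mem_other _ _ hm U).trans (recolour_mem_other _ _ hm U).symm) rfl rfl]
  refine ⟨fun e U => key _ _ _ _ _ (by simp) fun i =>
      (recolour_mem_bridge C _ _ e U).1,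
    fun e U => key _ _ _ _ _ (by simp) fun i =>
      (recolour_mem_bridge C _ _ e U).2, fun y U => key2 _ rfl U, fun y U => key2 _ rfl U, ?_, ?_⟩
  · rintro rfl y
    constructor <;> intro h <;> simp [toPair, swapCoins, h]
  · rintro rfl
    simp [toPair, swapCoins]

lemma consistent_of_srcWeight {δ : ℝ} {ω : Pair d N} {α β : Site d N → Set ℝ → ℕ}
    (h : srcWeight δ R r α β ω ≠ 0) :
    Consistent R.bc₁ r (ω.T₁ α) ∧ Consistent R.bc₂ r (ω.T₂ β) := by
  constructor
  · by_contra hc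
    exact h (by rw [srcWeight, weight, if_neg hc, zero_mul])
  · by_contra hc
    exact h (by rw [srcWeight, weight, weight, if_neg hc, mul_zero])

/-- The inequality between weights with exchanged sources, summed over all recolourings. -/
lemma sum_recol_le (hr : 0 ≤ r) (ho : o.2 = 0) {c : PConf (Mark d N × ℝ)} (hc : GenericTimes r c)
    (δ : ℝ) {V : Base d N → ℝ≥0∞}
    (hV : ∀ p : Base d N, (∃ z ∈ cluster R r (toPair p) 0 (src o + src q) o,
      z.2 ∈ ghost R r (toPair p) z.1) →
      ENNReal.ofReal (srcWeight δ R r 0 (src o + src q) (toPair p)) ≤ V p) :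
    ∑ a : Fin c.1 → Bool, ∑ k,
        ENNReal.ofReal (srcWeight δ R r 0 (src o + src q) (toPair (recol c a, k))) ≤
      ∑ a : Fin c.1 → Bool, ∑ k,
        (ENNReal.ofReal (srcWeight δ R r (src o + src q) 0 (toPair (recol c a, k))) +
          V (recol c a, k)) := by
  classical
  rw [← Fintype.sum_prod_type', ← Fintype.sum_prod_type', Finset.sum_add_distrib]
  let C : (Fin c.1 → Bool) × Coins d N → Set (Site d N × ℝ) := fun x =>
    cluster R r (toPair (recol c x.1, x.2)) 0 (src o + src q) o
  -- The exchange in the cluster, as a map on colourings and coins over the fixed uncoloured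
  -- configuration.
  let Φ : (Fin c.1 → Bool) × Coins d N → (Fin c.1 → Bool) × Coins d N := fun x =>
    (fun i => x.1 i ^^ inRegion (C x) (c.2 i), swapCoins R (C x) x.2)
  let good : (Fin c.1 → Bool) × Coins d N → Prop := fun x =>
    srcWeight δ R r 0 (src o + src q) (toPair (recol c x.1, x.2)) ≠ 0 ∧
      ∀ p ∈ C x, p.2 ∉ ghost R r (toPair (recol c x.1, x.2)) p.1
  have hgood : ∀ x, good x →
      srcWeight δ R r 0 (src o + src q) (toPair (recol c x.1, x.2)) =
        srcWeight δ R r (src o + src q) 0 (toPair (recol c (Φ x).1, (Φ x).2)) ∧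
      cluster R r (toPair (recol c (Φ x).1, (Φ x).2)) (src o + src q) 0 o = C x := by
    intro x hx
    have hcons := consistent_of_srcWeight hx.1
    exact swap_cluster hr ((hc.recol x.1).generic x.2) ho hx.2 (swapRel_recol R c x.1 x.2 (C x))
      hcons.1 hcons.2 δ
  -- The cluster of the image, computed with the sources in the first labelling, is the old cluster,
  -- so `C x` is determined by `Φ x`. For a fixed cluster the exchange is an involution.
  have hinj : Set.InjOn Φ {x | good x} := by
    intro x hx y hy hxy
    have h1 := (hgood x hx).2
    have h2 := (hgood y hy).2
    rw [hxy] at h1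
    have hC : C x = C y := h1.symm.trans h2
    have i1 : ∀ i, (x.1 i ^^ inRegion (C x) (c.2 i)) = (y.1 i ^^ inRegion (C y) (c.2 i)) :=
      fun i => congrFun (congrArg Prod.fst hxy) i
    have i2 : swapCoins R (C x) x.2 = swapCoins R (C y) y.2 := congrArg Prod.snd hxy
    rw [hC] at i1 i2
    refine Prod.ext (funext fun i => by simpa using i1 i) ?_
    rw [← swapCoins_swapCoins (R := R) (C y) x.2, i2, swapCoins_swapCoins]
  rw [← Finset.sum_filter_add_sum_filter_not Finset.univ good]
  refine add_le_add ?_ ?_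
  · calc _ = ∑ x ∈ Finset.univ.filter good, ENNReal.ofReal
          (srcWeight δ R r (src o + src q) 0 (toPair (recol c (Φ x).1, (Φ x).2))) :=
        Finset.sum_congr rfl fun x hx => by rw [(hgood x (Finset.mem_filter.1 hx).2).1]
      _ = ∑ x ∈ (Finset.univ.filter good).image Φ, ENNReal.ofReal
          (srcWeight δ R r (src o + src q) 0 (toPair (recol c x.1, x.2))) := by
        rw [Finset.sum_image]
        intro x hx y hy hxy
        exact hinj (Finset.mem_filter.1 hx).2 (Finset.mem_filter.1 hy).2 hxy
      _ ≤ _ := Finset.sum_le_sum_of_subset (Finset.subset_univ _)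
  -- A colouring that is not good has weight zero or a cluster meeting the ghost, and `V` majorises
  -- the weight in the second case.
  · calc _ ≤ ∑ x ∈ Finset.univ.filter (fun x => ¬ good x), V (recol c x.1, x.2) := by
          refine Finset.sum_le_sum fun x hx => ?_
          have hx := (Finset.mem_filter.1 hx).2
          by_cases h0 : srcWeight δ R r 0 (src o + src q) (toPair (recol c x.1, x.2)) = 0
          · rw [h0]; simp
          · refine hV _ ?_
            by_contra hcon
            push Not at hcon
            exact hx ⟨h0, hcon⟩
      _ ≤ _ := Finset.sum_le_sum_of_subset (Finset.subset_univ _)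

lemma ae_genericTimes (lam δ r : ℝ) :
    ∀ᵐ c ∂PConf.pois (Mark.meas d N lam δ r), GenericTimes r c := by
  have h0 : ∀ {s : Set ℝ}, MeasurableSet s → volume (s ∩ timeI r) = 0 →
      Mark.meas d N lam δ r (Prod.snd ⁻¹' s) = 0 := by
    intro s hs h
    rw [Mark.meas_apply _ _ _ (measurable_snd hs)]
    refine Finset.sum_eq_zero fun m _ => ?_
    change rateMeas _ r s = 0
    rw [rateMeas, Measure.smul_apply, Measure.restrict_apply hs, h, smul_zero]
  refine PConf.ae_pois_generic measurable_snd (fun t => h0 (measurableSet_singleton t) ?_)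
    (Set.Countable.insert _ (Set.Countable.insert _ (Set.countable_singleton _))) ?_
  · exact measure_mono_null inter_subset_left (measure_singleton t)
  · have : {x : Mark d N × ℝ | ¬ x.2 ∈ Icc (-r / 2) (r / 2)} = Prod.snd ⁻¹' (Icc (-r / 2) (r / 2))ᶜ := rfl
    rw [ae_iff, this]
    exact h0 measurableSet_Icc.compl (by simp [timeI])

/-- The difference of the partition functions with exchanged sources is controlled by the
contribution of the configurations in which the source is connected to the ghost. -/
theorem lintegral_srcWeight_le (hr : 0 ≤ r) (ho : o.2 = 0) (lam δ : ℝ) {V : Base d N → ℝ≥0∞}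
    (hVm : Measurable V)
    (hm₁ : Measurable fun p : Base d N => srcWeight δ R r 0 (src o + src q) (toPair p))
    (hm₂ : Measurable fun p : Base d N => srcWeight δ R r (src o + src q) 0 (toPair p))
    (hV : ∀ p : Base d N, (∃ z ∈ cluster R r (toPair p) 0 (src o + src q) o,
      z.2 ∈ ghost R r (toPair p) z.1) →
      ENNReal.ofReal (srcWeight δ R r 0 (src o + src q) (toPair p)) ≤ V p) :
    ∫⁻ p, ENNReal.ofReal (srcWeight δ R r 0 (src o + src q) (toPair p)) ∂baseLaw d N lam δ r ≤
      ∫⁻ p, ENNReal.ofReal (srcWeight δ R r (src o + src q) 0 (toPair p)) ∂baseLaw d N lam δ r +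
        ∫⁻ p, V p ∂baseLaw d N lam δ r := by
  rw [← lintegral_add_right _ hVm]
  refine PConf.lintegral_pois_le_of_orbit (coinsLaw d N) _ coinsLaw_singleton _
    (fun a => measurePreserving_recolour lam δ r a) hm₁.ennreal_ofReal
    (hm₂.ennreal_ofReal.add hVm) ?_
  filter_upwards [ae_genericTimes lam δ r] with c hc
  exact sum_recol_le hr ho hc δ hV

end
end TFIM

namespace TFIM
noncomputable section
open scoped ENNReal
variable {d N : ℕ} {R : Regime} {r : ℝ}

/-! ### Measurability of the weights -/

/-- A random counting function which is measurable jointly with a parameter. -/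
def MeasCount {Ω : Type*} [MeasurableSpace Ω] (T : Ω → Set ℝ → ℕ) : Prop :=
  ∀ D : Set ((Ω × ℝ) × ℝ), MeasurableSet D → Measurable fun p : Ω × ℝ => T p.1 {s | (p, s) ∈ D}

section MeasCount
variable {Ω : Type*} [MeasurableSpace Ω]

lemma MeasCount.add {T T' : Ω → Set ℝ → ℕ} (h : MeasCount T) (h' : MeasCount T') :
    MeasCount fun ω U => T ω U + T' ω U :=
  fun D hD => (h D hD).add (h' D hD)

lemma MeasCount.sum {ι : Type*} [Fintype ι] {T : ι → Ω → Set ℝ → ℕ} (h : ∀ i, MeasCount (T i)) :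
    MeasCount fun ω U => ∑ i, T i ω U :=
  fun D hD => Finset.measurable_fun_sum _ fun i _ => h i D hD

lemma measCount_zero : MeasCount fun (_ : Ω) _ => 0 := fun _ _ => measurable_const

lemma measCount_count {c : Ω → Config} (hc : Measurable c) : MeasCount fun ω U => (c ω).count U :=
  fun _ hD => (PConf.measurable_cnt_prod hD).fun_comp
    (measurable_id.prodMk (hc.comp measurable_fst))

lemma measCount_src (q : Site d N × ℝ) (y : Site d N) : MeasCount fun (_ : Ω) U => src q y U := by
  classical
  intro D hD
  simp only [src]
  refine Measurable.ite ?_ measurable_const measurable_const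
  by_cases h : y = q.1
  · simp only [h, true_and]
    exact (measurable_id.prodMk measurable_const) hD
  · simp [h]

lemma measCount_switchCount {B : Ω → Edge d N → Config} {G : Ω → Site d N → Config}
    (hB : ∀ e, Measurable fun ω => B ω e) (hG : ∀ y, Measurable fun ω => G ω y) (y : Site d N) :
    MeasCount fun ω U => switchCount (B ω) (G ω) y U := by
  refine (MeasCount.sum fun e => ?_).add (measCount_count (hG y))
  split_ifs
  · exact measCount_count (hB e)
  · exact measCount_zero

lemma MeasCount.apply {T : Ω → Set ℝ → ℕ} (h : MeasCount T) {U : Set ℝ} (hU : MeasurableSet U) :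
    Measurable fun ω => T ω U :=
  (h {p | p.2 ∈ U} (measurable_snd hU)).comp (measurable_id.prodMk (measurable_const (a := (0 : ℝ))))

lemma measurable_startParity {T : Ω → Set ℝ → ℕ} (h : MeasCount T) {k : Ω → Bool}
    (hk : Measurable k) (b : TemporalBC) (r : ℝ) :
    Measurable fun ω => startParity b r (k ω) (T ω) := by
  have h1 : Measurable fun ω => (k ω).toNat := (measurable_of_countable Bool.toNat).comp hk
  cases b
  · exact measurable_const
  · exact h1
  · exact h1.add (h.apply measurableSet_Ico)

lemma measurableSet_isOdd_prod {T : Ω → Set ℝ → ℕ} (h : MeasCount T) {k : Ω → Bool}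
    (hk : Measurable k) (b : TemporalBC) (r : ℝ) :
    MeasurableSet {p : Ω × ℝ | IsOdd b r (k p.1) (T p.1) p.2} := by
  have h0 : Measurable fun p : Ω × ℝ => startParity b r (k p.1) (T p.1) :=
    (measurable_startParity h hk b r).comp measurable_fst
  have h1 : Measurable fun p : Ω × ℝ => T p.1 (Ico (-r / 2) p.2) :=
    h {x | x.2 ∈ Ico (-r / 2) x.1.2} ((measurableSet_le measurable_const measurable_snd).inter
      (measurableSet_lt measurable_snd (measurable_snd.comp measurable_fst)))
  have h2 : Measurable fun p : Ω × ℝ => T p.1 (Icc (-r / 2) p.2) :=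
    h {x | x.2 ∈ Icc (-r / 2) x.1.2} ((measurableSet_le measurable_const measurable_snd).inter
      (measurableSet_le measurable_snd (measurable_snd.comp measurable_fst)))
  have hs : MeasurableSet {n : ℕ | Odd n} := MeasurableSet.of_discrete
  exact ((h0.add h1) hs).union ((h0.add h2) hs)

lemma measurable_weight {T : Site d N → Ω → Set ℝ → ℕ} (h : ∀ y, MeasCount (T y))
    {k : Ω → Site d N → Bool} (hk : Measurable k) (δ : ℝ) (b : TemporalBC) (r : ℝ) :
    Measurable fun ω => weight δ b r (k ω) (fun y => T y ω) := by
  have hky : ∀ y, Measurable fun ω => k ω y := fun y => (measurable_pi_apply y).comp hk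
  have hev : MeasurableSet {ω | ∀ y, Even (T y ω (timeI r))} := by
    have : {ω | ∀ y, Even (T y ω (timeI r))} =
        ⋂ y, (fun ω => T y ω (timeI r)) ⁻¹' {n | Even n} := by ext; simp
    rw [this]
    exact MeasurableSet.iInter fun y =>
      ((h y).apply (measurableSet_timeI r)) MeasurableSet.of_discrete
  unfold weight
  refine Measurable.ite ?_ ?_ measurable_const
  · cases b
    · exact hev
    · exact MeasurableSet.univ
    · exact hev
  · refine Real.measurable_exp.comp (Measurable.const_mul (Finset.measurable_fun_sum _ fun y _ => ?_) _)
    refine Measurable.ennreal_toReal ?_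
    exact measurable_measure_prodMk_left (ν := (volume : Measure ℝ))
      (s := {p : Ω × ℝ | p.2 ∈ timeI r ∧ ¬ IsOdd b r (k p.1 y) (T y p.1) p.2})
      ((measurable_snd (measurableSet_timeI r)).inter
        (measurableSet_isOdd_prod (h y) (hky y) b r).compl)

end MeasCount

lemma weight_nonneg (δ : ℝ) (b : TemporalBC) (r : ℝ) (k : Site d N → Bool)
    (S : Site d N → Set ℝ → ℕ) : 0 ≤ weight δ b r k S := by
  unfold weight; split_ifs
  · exact (Real.exp_pos _).le
  · exact le_rfl

lemma volume_sep_timeI_le (hr : 0 ≤ r) (P : ℝ → Prop) : (volume {t ∈ timeI r | P t}).toReal ≤ r := by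
  have h : volume {t ∈ timeI r | P t} ≤ ENNReal.ofReal r :=
    (measure_mono fun t ht => ht.1).trans (volume_timeI r).le
  exact (ENNReal.toReal_mono ENNReal.ofReal_ne_top h).trans (ENNReal.toReal_ofReal hr).le

lemma weight_le {δ : ℝ} (hδ : 0 ≤ δ) (hr : 0 ≤ r) (b : TemporalBC) (k : Site d N → Bool)
    (S : Site d N → Set ℝ → ℕ) :
    weight δ b r k S ≤ Real.exp (2 * δ * (Fintype.card (Site d N) * r)) := by
  unfold weight; split_ifs
  · refine Real.exp_le_exp.2 (mul_le_mul_of_nonneg_left ?_ (by positivity))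
    refine (Finset.sum_le_card_nsmul _ _ r fun y _ => volume_sep_timeI_le hr _).trans ?_
    simp
  · positivity

lemma srcWeight_nonneg (δ : ℝ) (R : Regime) (r : ℝ) (α β : Site d N → Set ℝ → ℕ) (ω : Pair d N) :
    0 ≤ srcWeight δ R r α β ω :=
  mul_nonneg (weight_nonneg _ _ _ _ _) (weight_nonneg _ _ _ _ _)

lemma measurable_srcWeight {α β : Site d N → Set ℝ → ℕ}
    (hα : ∀ y, MeasCount fun (_ : Base d N) => α y) (hβ : ∀ y, MeasCount fun (_ : Base d N) => β y)
    (δ : ℝ) (R : Regime) (r : ℝ) :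
    Measurable fun p : Base d N => srcWeight δ R r α β (toPair p) := by
  have hm : ∀ m, Measurable fun p : Base d N => component p.1 m := fun m =>
    (measurable_component m).comp measurable_fst
  refine Measurable.mul ?_ ?_
  · exact measurable_weight (T := fun y (p : Base d N) => (toPair p).T₁ α y)
      (fun y => (measCount_switchCount (fun e => hm _) (fun _ => measurable_const) y).add (hα y))
      (measurable_fst.comp measurable_snd) δ R.bc₁ r
  · exact measurable_weight (T := fun y (p : Base d N) => (toPair p).T₂ β y)
      (fun y => (measCount_switchCount (fun e => hm _) (fun _ => hm _) y).add (hβ y))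
      (measurable_snd.comp measurable_snd) δ R.bc₂ r

lemma measCount_src_add {Ω : Type*} [MeasurableSpace Ω] (o q : Site d N × ℝ) (y : Site d N) :
    MeasCount fun (_ : Ω) => (src o + src q) y :=
  (measCount_src o y).add (measCount_src q y)

end
end TFIM

namespace TFIM
noncomputable section
open scoped ENNReal
variable {r : ℝ}

/-! ### The spins on a single line -/

/-- The times whose flips affect the spin at `t`. -/
def flipWindow (t : ℝ) : Set ℝ := if 0 ≤ t then Ioc 0 t else Ioc t 0

/-- The spin at height `t` of a line with flips `D` and bit `ξ`. -/
def lineSpin (D : Config) (ξ : Bool) (t : ℝ) : ℝ := (-1) ^ (ξ.toNat + D.count (flipWindow t))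

lemma measurableSet_flipWindow : MeasurableSet {p : ℝ × ℝ | p.2 ∈ flipWindow p.1} := by
  have : {p : ℝ × ℝ | p.2 ∈ flipWindow p.1} =
      {p | 0 ≤ p.1} ∩ {p | p.2 ∈ Ioc 0 p.1} ∪ {p | p.1 < 0} ∩ {p | p.2 ∈ Ioc p.1 0} := by
    ext p
    by_cases h : 0 ≤ p.1
    · simp [flipWindow, h]
    · simp [flipWindow, h, not_le.1 h]
  rw [this]
  refine ((measurableSet_le measurable_const measurable_fst).inter
    ((measurableSet_lt measurable_const measurable_snd).inter
      (measurableSet_le measurable_snd measurable_fst))).union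
    ((measurableSet_lt measurable_fst measurable_const).inter
      ((measurableSet_lt measurable_fst measurable_snd).inter
        (measurableSet_le measurable_snd measurable_const)))

lemma measurable_neg_one_pow {Ω : Type*} [MeasurableSpace Ω] {n : Ω → ℕ} (hn : Measurable n) :
    Measurable fun ω => (-1 : ℝ) ^ n ω :=
  (measurable_of_countable fun n : ℕ => (-1 : ℝ) ^ n).comp hn

lemma measurable_lineSpin : Measurable fun p : (Config × Bool) × ℝ => lineSpin p.1.1 p.1.2 p.2 := by
  refine measurable_neg_one_pow (Measurable.add ?_ ?_)
  · exact (measurable_of_countable Bool.toNat).comp (measurable_snd.comp measurable_fst)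
  · exact (PConf.measurable_cnt_prod measurableSet_flipWindow).fun_comp
      (measurable_snd.prodMk (measurable_fst.comp measurable_fst))

lemma lineSpin_sq (D : Config) (ξ : Bool) (t : ℝ) : lineSpin D ξ t = 1 ∨ lineSpin D ξ t = -1 :=
  neg_one_pow_eq_or _ _

lemma neg_one_pow_cnt (D : Config) (U : Set ℝ) [DecidablePred (· ∈ U)] :
    (-1 : ℝ) ^ D.count U = ∏ i, if D.2 i ∈ U then -1 else 1 := by
  classical
  rw [Config.count_eq_cnt, PConf.cnt_eq_sum, ← Finset.prod_pow_eq_pow_sum]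
  refine Finset.prod_congr rfl fun i _ => ?_
  by_cases h : D.2 i ∈ U <;> simp [h]

/-- The product of the spins at the points of `L`. -/
def lineProd (L : Multiset ℝ) (D : Config) (ξ : Bool) : ℝ := (L.map (lineSpin D ξ)).prod

lemma abs_multiset_prod_le {L : Multiset ℝ} {f : ℝ → ℝ} (hf : ∀ t, |f t| ≤ 1) :
    |(L.map f).prod| ≤ 1 := by
  induction L using Multiset.induction with
  | empty => simp
  | cons a L ih =>
    rw [Multiset.map_cons, Multiset.prod_cons, abs_mul]
    exact mul_le_one₀ (hf a) (abs_nonneg _) ih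

lemma abs_lineProd_le (L : Multiset ℝ) (D : Config) (ξ : Bool) : |lineProd L D ξ| ≤ 1 :=
  abs_multiset_prod_le fun t => by rcases lineSpin_sq D ξ t with h | h <;> simp [h]

lemma measurable_lineProd (L : Multiset ℝ) : Measurable fun p : Config × Bool => lineProd L p.1 p.2 := by
  unfold lineProd
  induction L using Multiset.induction with
  | empty => simp
  | cons a L ih =>
    simp only [Multiset.map_cons, Multiset.prod_cons]
    exact (measurable_lineSpin.fun_comp (measurable_id.prodMk measurable_const)).mul ih

open Classical in
/-- The sign attached to a flip at `s` in the product over `L`. -/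
def flipSign (L : Multiset ℝ) (s : ℝ) : ℝ := (L.map fun t => if s ∈ flipWindow t then (-1 : ℝ) else 1).prod

/-- Interchanging the two products collects, for each flip, its effect on all spins of `L`. The bit
enters once for each element of `L`. -/
lemma lineProd_eq (L : Multiset ℝ) (D : Config) (ξ : Bool) :
    lineProd L D ξ = ((-1) ^ ξ.toNat) ^ L.card * ∏ i, flipSign L (D.2 i) := by
  classical
  unfold lineProd flipSign
  induction L using Multiset.induction with
  | empty => simp
  | cons a L ih =>
    simp only [Multiset.map_cons, Multiset.prod_cons, Multiset.card_cons, Finset.prod_mul_distrib]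
    rw [ih, lineSpin, pow_add, neg_one_pow_cnt, pow_succ]
    ring

-- Spins are determined from time `0`: a flip at `s > 0` affects the heights `t ≥ s`, a flip at `s ≤
-- 0` those with `t < s`. When `L` has an even number of elements, both sets contain the same number
-- modulo two.
open Classical in
lemma flipSign_eq_of_even {L : Multiset ℝ} (hL : Even L.card) (s : ℝ) :
    flipSign L s = (-1) ^ L.countP (· < s) := by
  have h1 : ∀ L : Multiset ℝ, flipSign L s = (-1) ^ L.countP (fun t => s ∈ flipWindow t) := by
    intro L
    unfold flipSign
    induction L using Multiset.induction with
    | empty => simp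
    | cons a L ih =>
      by_cases h : s ∈ flipWindow a
      · simp [h, ih, pow_succ]
      · simp [h, ih]
  rw [h1]
  by_cases hs : 0 < s
  · have h2 : L.countP (fun t => s ∈ flipWindow t) = L.countP (fun t => ¬ t < s) := by
      refine Multiset.countP_congr rfl fun t _ => ?_
      simp only [flipWindow, not_lt, eq_iff_iff]
      split_ifs with h
      · exact ⟨fun h => h.2, fun h => ⟨hs, h⟩⟩
      · exact ⟨fun h => absurd h.2 (not_le.2 hs), fun h' => absurd (hs.le.trans h') h⟩
    have h3 := Multiset.card_eq_countP_add_countP (· < s) L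
    rw [h2]
    rw [h3] at hL
    rcases Nat.even_or_odd (L.countP (· < s)) with he | ho
    · rw [he.neg_one_pow, ((Nat.even_add.1 hL).1 he).neg_one_pow]
    · rw [ho.neg_one_pow, Odd.neg_one_pow]
      by_contra hc
      rw [Nat.not_odd_iff_even] at hc
      exact Nat.not_even_iff_odd.2 ho ((Nat.even_add.1 hL).2 hc)
  · congr 1
    refine Multiset.countP_congr rfl fun t _ => ?_
    simp only [flipWindow, eq_iff_iff]
    split_ifs with h
    · exact ⟨fun h => absurd h.1 hs, fun h' => absurd h (by linarith [not_lt.1 hs])⟩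
    · exact ⟨fun h => h.1, fun h => ⟨h, not_lt.1 hs⟩⟩

open Classical in
/-- The exponential weight of the odd set, with parity `k` at the lower end. -/
def oddWeight (δ r : ℝ) (L : Multiset ℝ) (k : ℕ) : ℝ :=
  Real.exp (-(2 * δ) * (volume {s ∈ timeI r | Odd (k + L.countP (· < s))}).toReal)

open Classical in
lemma measurable_countP_lt (L : Multiset ℝ) : Measurable fun s : ℝ => L.countP (· < s) :=
  Monotone.measurable fun s t hst => by
    induction L using Multiset.induction with
    | empty => simp
    | cons a L ih =>
      simp only [Multiset.countP_cons]
      refine add_le_add ih ?_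
      split_ifs with h1 h2
      · exact le_rfl
      · exact absurd (h1.trans_le hst) h2
      · exact zero_le
      · exact le_rfl

open Classical in
/-- The expectation of the product of the spins at the points of `L`. -/
lemma integral_lineProd {δ : ℝ} (hδ : 0 ≤ δ) (L : Multiset ℝ) :
    ∫ ξ, ∫ D, lineProd L D ξ ∂PConf.pois (rateMeas δ r) ∂coinLaw =
      if Even L.card then oddWeight δ r L 0 else 0 := by
  have hm : Measurable (flipSign L) := by
    unfold flipSign
    induction L using Multiset.induction with
    | empty => simp
    | cons a L ih =>
      simp only [Multiset.map_cons, Multiset.prod_cons]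
      refine Measurable.mul (Measurable.ite ?_ measurable_const measurable_const) ih
      exact (measurable_const.prodMk measurable_id) measurableSet_flipWindow
  have hb : ∀ s, |flipSign L s| ≤ 1 := fun s =>
    abs_multiset_prod_le fun t => by split_ifs <;> simp
  have h1 : ∀ ξ, ∫ D, lineProd L D ξ ∂PConf.pois (rateMeas δ r) =
      ((-1) ^ ξ.toNat) ^ L.card * Real.exp (∫ s, (flipSign L s - 1) ∂rateMeas δ r) := by
    intro ξ
    simp only [lineProd_eq]
    rw [integral_const_mul, PConf.integral_pois_prod _ hm hb]
  simp only [h1, integral_coinLaw]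
  split_ifs with hL
  -- The sign is `-1` exactly on the odd set, so the exponent in the Laplace functional is `-2δ`
  -- times its length.
  · have h2 : ∀ s, flipSign L s - 1 =
        {s | Odd (0 + L.countP (· < s))}.indicator (fun _ => (-2 : ℝ)) s := by
      intro s
      rw [flipSign_eq_of_even hL]
      by_cases h : Odd (L.countP (· < s))
      · rw [h.neg_one_pow, Set.indicator_of_mem (by simpa using h)]; norm_num
      · rw [(Nat.not_odd_iff_even.1 h).neg_one_pow, Set.indicator_of_notMem (by simpa using h)]
        norm_num
    have hs : MeasurableSet {s | Odd (0 + L.countP (· < s))} := by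
      simp only [zero_add]
      exact measurable_countP_lt L (MeasurableSet.of_discrete (s := {n | Odd n}))
    simp only [h2]
    rw [integral_indicator_const _ hs, Measure.real, rateMeas, Measure.smul_apply,
      Measure.restrict_apply hs, oddWeight]
    have h3 : {s | Odd (0 + L.countP (· < s))} ∩ timeI r =
        {s ∈ timeI r | Odd (0 + L.countP (· < s))} := by ext; simp [and_comm]
    rw [h3, smul_eq_mul, smul_eq_mul, ENNReal.toReal_mul, ENNReal.toReal_ofReal hδ]
    simp only [Bool.toNat_false, Bool.toNat_true, pow_zero, one_pow, pow_one, hL.neg_one_pow, one_mul]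
    rw [add_self_div_two]
    congr 1; ring
  -- With an odd number of spins the two values of the bit cancel.
  · rw [Nat.not_even_iff_odd] at hL
    simp [hL.neg_one_pow]

open Classical in
lemma oddWeight_congr {δ : ℝ} {L L' : Multiset ℝ} {k k' : ℕ}
    (h : ∀ᵐ s, s ∈ timeI r → (Odd (k + L.countP (· < s)) ↔ Odd (k' + L'.countP (· < s)))) :
    oddWeight δ r L k = oddWeight δ r L' k' := by
  unfold oddWeight
  congr 3
  refine measure_congr ?_
  filter_upwards [h] with s hs
  exact propext (and_congr_right fun h => hs h)

lemma oddWeight_mod (δ : ℝ) (L : Multiset ℝ) (k : ℕ) :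
    oddWeight δ r L k = oddWeight δ r L (k % 2) :=
  oddWeight_congr (Filter.Eventually.of_forall fun s _ => by
    rw [Nat.odd_iff, Nat.odd_iff, Nat.mod_add_mod])

/-- A spin at the lower end switches the label of the whole line above it, up to a null set, hence
shifts the initial parity. At the upper end there is nothing left to switch
(`oddWeight_cons_right`). -/
lemma oddWeight_cons_left (δ : ℝ) (L : Multiset ℝ) (k : ℕ) :
    oddWeight δ r ((-r / 2) ::ₘ L) k = oddWeight δ r L (k + 1) := by
  classical
  refine oddWeight_congr ?_
  filter_upwards [Measure.ae_ne volume (-r / 2)] with s hs hsI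
  have : -r / 2 < s := lt_of_le_of_ne hsI.1 (Ne.symm hs)
  rw [Multiset.countP_cons_of_pos (p := (· < s)) _ this, add_right_comm, add_assoc]

lemma oddWeight_cons_right (δ : ℝ) (L : Multiset ℝ) (k : ℕ) :
    oddWeight δ r ((r / 2) ::ₘ L) k = oddWeight δ r L k := by
  classical
  refine oddWeight_congr (Filter.Eventually.of_forall fun s hsI => ?_)
  rw [Multiset.countP_cons_of_neg (p := (· < s)) _ (not_lt.2 hsI.2)]

/-- The temporal boundary condition on a single line. -/
def LineOK (b : TemporalBC) (r : ℝ) (D : Config) (ξ : Bool) : Prop :=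
  match b with
  | .free => True
  | .wired => lineSpin D ξ (-r / 2) = 1 ∧ lineSpin D ξ (r / 2) = 1
  | .periodic => lineSpin D ξ (-r / 2) = lineSpin D ξ (r / 2)

/-- Consistency on a single line. -/
def LineCons (b : TemporalBC) (r : ℝ) (S : Set ℝ → ℕ) : Prop :=
  match b with
  | .free => Even (S (timeI r))
  | .wired => True
  | .periodic => Even (S (timeI r))

/-- The normalisation of the temporal boundary condition. -/
def lineConst : TemporalBC → ℝ
  | .free => 1
  | .wired => 1 / 2
  | .periodic => 1

open Classical in
/-- The indicator function of the temporal boundary condition. -/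
def lineInd (b : TemporalBC) (r : ℝ) (D : Config) (ξ : Bool) : ℝ := if LineOK b r D ξ then 1 else 0

/-- The constraints are polynomials in the end spins: `1{σ = 1} = (1 + σ) / 2` and `1{σ = σ'} = (1 +
σσ') / 2`. Expanding turns them into additional spins at the ends of the line. -/
lemma lineInd_mul_lineProd (b : TemporalBC) (L : Multiset ℝ) (D : Config) (ξ : Bool) :
    lineInd b r D ξ * lineProd L D ξ = match b with
      | .free => lineProd L D ξ
      | .wired => (lineProd L D ξ + lineProd ((-r / 2) ::ₘ L) D ξ + lineProd ((r / 2) ::ₘ L) D ξ +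
          lineProd ((-r / 2) ::ₘ (r / 2) ::ₘ L) D ξ) / 4
      | .periodic => (lineProd L D ξ + lineProd ((-r / 2) ::ₘ (r / 2) ::ₘ L) D ξ) / 2 := by
  cases b
  · simp [lineInd, LineOK]
  · have hv : lineInd .wired r D ξ = (1 + lineSpin D ξ (-r / 2)) * (1 + lineSpin D ξ (r / 2)) / 4 := by
      unfold lineInd
      rcases lineSpin_sq D ξ (-r / 2) with h1 | h1 <;> rcases lineSpin_sq D ξ (r / 2) with h2 | h2
      · rw [if_pos ⟨h1, h2⟩, h1, h2]; norm_num
      · rw [if_neg fun h => by have := h.2; rw [h2] at this; norm_num at this, h1, h2]; norm_num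
      · rw [if_neg fun h => by have := h.1; rw [h1] at this; norm_num at this, h1, h2]; norm_num
      · rw [if_neg fun h => by have := h.1; rw [h1] at this; norm_num at this, h1, h2]; norm_num
    simp only [hv, lineProd, Multiset.map_cons, Multiset.prod_cons]
    ring
  · have hv : lineInd .periodic r D ξ = (1 + lineSpin D ξ (-r / 2) * lineSpin D ξ (r / 2)) / 2 := by
      unfold lineInd
      rcases lineSpin_sq D ξ (-r / 2) with h1 | h1 <;> rcases lineSpin_sq D ξ (r / 2) with h2 | h2
      · rw [if_pos (show LineOK .periodic r D ξ from h1.trans h2.symm), h1, h2]; norm_num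
      · rw [if_neg fun h => by
          have h : lineSpin D ξ (-r / 2) = lineSpin D ξ (r / 2) := h
          rw [h1, h2] at h; norm_num at h, h1, h2]
        norm_num
      · rw [if_neg fun h => by
          have h : lineSpin D ξ (-r / 2) = lineSpin D ξ (r / 2) := h
          rw [h1, h2] at h; norm_num at h, h1, h2]
        norm_num
      · rw [if_pos (show LineOK .periodic r D ξ from h1.trans h2.symm), h1, h2]; norm_num
    simp only [hv, lineProd, Multiset.map_cons, Multiset.prod_cons]
    ring

open Classical in
/-- The counting function of a multiset of times. -/
def mcount (L : Multiset ℝ) (U : Set ℝ) : ℕ := L.countP (· ∈ U)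

lemma mcount_eq_countP {L : Multiset ℝ} {U : Set ℝ} {p : ℝ → Prop} [DecidablePred p]
    (h : ∀ t ∈ L, t ∈ U ↔ p t) : mcount L U = L.countP p := by
  classical
  exact Multiset.countP_congr rfl fun t ht => propext (h t ht)

/-- Taking the odd set closed, or counting the switches strictly below `s`, makes a difference only
at the finitely many points of `L`. -/
lemma exp_volume_isOdd {δ : ℝ} {L : Multiset ℝ} (hL : ∀ t ∈ L, t ∈ timeI r) (b : TemporalBC) (k : Bool) :
    Real.exp (-(2 * δ) * (volume {t ∈ timeI r | IsOdd b r k (mcount L) t}).toReal) =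
      oddWeight δ r L (startParity b r k (mcount L)) := by
  classical
  unfold oddWeight
  congr 3
  refine measure_congr ?_
  have hfin : ∀ᵐ s : ℝ, s ∉ {t | t ∈ L} := by
    have : Set.Countable {t | t ∈ L} := (L.toFinset.finite_toSet.subset fun t ht => by simpa using ht).countable
    exact this.ae_notMem _
  filter_upwards [hfin] with s hs
  refine propext (and_congr_right fun h => ?_)
  have h1 : mcount L (Ico (-r / 2) s) = L.countP (· < s) :=
    mcount_eq_countP fun t ht => by simp [(hL t ht).1]
  have h2 : mcount L (Icc (-r / 2) s) = L.countP (· < s) :=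
    mcount_eq_countP fun t ht => by
      have hts : t ≠ s := fun h => hs (h ▸ ht)
      simp [(hL t ht).1, le_iff_lt_or_eq, hts]
  simp only [IsOdd, h1, h2, or_self]

open Classical in
/-- The random-parity representation of a single line. -/
theorem integral_line {δ : ℝ} (hδ : 0 ≤ δ) {L : Multiset ℝ} (hL : ∀ t ∈ L, t ∈ timeI r)
    (b : TemporalBC) :
    ∫ ξ, ∫ D, lineInd b r D ξ * lineProd L D ξ ∂PConf.pois (rateMeas δ r) ∂coinLaw =
      lineConst b * ∫ k, (if LineCons b r (mcount L) then
        Real.exp (-(2 * δ) * (volume {t ∈ timeI r | IsOdd b r k (mcount L) t}).toReal) else 0)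
          ∂coinLaw := by
  have hcard : mcount L (timeI r) = L.card := Multiset.countP_eq_card.2 hL
  have hi : ∀ (L : Multiset ℝ) (ξ : Bool), Integrable (fun D => lineProd L D ξ)
      (PConf.pois (rateMeas δ r)) := fun L ξ =>
    Integrable.of_bound ((measurable_lineProd L).comp
      (measurable_id.prodMk measurable_const)).aestronglyMeasurable 1
      (Filter.Eventually.of_forall fun _ => abs_lineProd_le _ _ _)
  have hi' : ∀ f : Bool → ℝ, Integrable f coinLaw := fun f => Integrable.of_finite
  simp only [lineInd_mul_lineProd, exp_volume_isOdd hL]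
  cases b
  · simp only [integral_lineProd hδ, LineCons, hcard, startParity, lineConst, one_mul,
      integral_coinLaw, add_self_div_two]
  -- Of the four terms only the two with an even number of spins survive, namely none or both ends
  -- if `L.card` is even and exactly one end if it is odd. In either case one of them starts even
  -- and the other odd, which is the coin for the lower label; the factor `1 / 4` leaves `lineConst
  -- = 1 / 2`.
  · have hcw : LineCons .wired r (mcount L) := trivial
    simp only [integral_div]
    have e1 : ∀ ξ, ∫ D, (lineProd L D ξ + lineProd ((-r / 2) ::ₘ L) D ξ + lineProd ((r / 2) ::ₘ L) D ξ +
          lineProd ((-r / 2) ::ₘ (r / 2) ::ₘ L) D ξ) ∂PConf.pois (rateMeas δ r) =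
        ∫ D, lineProd L D ξ ∂PConf.pois (rateMeas δ r) +
        ∫ D, lineProd ((-r / 2) ::ₘ L) D ξ ∂PConf.pois (rateMeas δ r) +
        ∫ D, lineProd ((r / 2) ::ₘ L) D ξ ∂PConf.pois (rateMeas δ r) +
        ∫ D, lineProd ((-r / 2) ::ₘ (r / 2) ::ₘ L) D ξ ∂PConf.pois (rateMeas δ r) := by
      intro ξ
      rw [integral_add (((hi _ _).fun_add (hi _ _)).fun_add (hi _ _)) (hi _ _),
        integral_add ((hi _ _).fun_add (hi _ _)) (hi _ _), integral_add (hi _ _) (hi _ _)]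
    simp only [e1]
    rw [integral_add (hi' _) (hi' _), integral_add (hi' _) (hi' _), integral_add (hi' _) (hi' _)]
    simp only [integral_lineProd hδ, Multiset.card_cons, oddWeight_cons_left, oddWeight_cons_right,
      if_pos hcw, integral_coinLaw, startParity, lineConst]
    by_cases h : Even L.card
    · have h' : ¬ Even (L.card + 1) := by rw [Nat.even_add_one]; simpa using h
      have h'' : Even (L.card + 1 + 1) := by rw [Nat.even_add_one]; exact h'
      simp only [h, h', h'', if_true, if_false, Bool.toNat_false, Bool.toNat_true, zero_add]
      ring
    · have h' : Even (L.card + 1) := by rw [Nat.even_add_one]; simpa using h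
      have h'' : ¬ Even (L.card + 1 + 1) := by rw [Nat.even_add_one]; simpa using h'
      simp only [h, h', h'', if_true, if_false, Bool.toNat_false, Bool.toNat_true, zero_add]
      ring
  -- The two terms start with the two possible parities at the lower end, whereas the coin
  -- determines the label at height `0`. These differ by the number of switches in between, which at
  -- most interchanges the two terms of the average.
  · simp only [integral_div]
    have e1 : ∀ ξ, ∫ D, (lineProd L D ξ +
          lineProd ((-r / 2) ::ₘ (r / 2) ::ₘ L) D ξ) ∂PConf.pois (rateMeas δ r) =
        ∫ D, lineProd L D ξ ∂PConf.pois (rateMeas δ r) +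
        ∫ D, lineProd ((-r / 2) ::ₘ (r / 2) ::ₘ L) D ξ ∂PConf.pois (rateMeas δ r) := by
      intro ξ
      rw [integral_add (hi _ _) (hi _ _)]
    simp only [e1]
    rw [integral_add (hi' _) (hi' _)]
    simp only [integral_lineProd hδ, Multiset.card_cons, oddWeight_cons_left, oddWeight_cons_right,
      LineCons, integral_coinLaw, startParity, lineConst, hcard]
    by_cases h : Even L.card
    · have h' : Even (L.card + 1 + 1) := by rw [Nat.even_add_one, Nat.even_add_one]; simpa using h
      simp only [h, h', if_true, Bool.toNat_false, Bool.toNat_true, zero_add, one_mul]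
      rw [oddWeight_mod δ L (mcount L _), oddWeight_mod δ L (1 + mcount L _)]
      rcases Nat.even_or_odd (mcount L (Ico (-r / 2) 0)) with hm | hm
      · rw [Nat.even_iff.1 hm, Nat.odd_iff.1 (by rw [add_comm]; exact hm.add_one)]
      · rw [Nat.odd_iff.1 hm, Nat.even_iff.1 (by rw [add_comm]; exact hm.add_one), add_comm]
    · have h' : ¬ Even (L.card + 1 + 1) := by rw [Nat.even_add_one, Nat.even_add_one]; simpa using h
      simp only [h, h', if_false]
      simp

end
end TFIM

namespace TFIM
noncomputable section
open scoped ENNReal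
variable {d N : ℕ} {r : ℝ}

/-! ### The random-parity representation -/

lemma PConf.measurable_prod_points_param {Z X : Type*} [MeasurableSpace Z] [MeasurableSpace X]
    {f : Z × X → ℝ} (hf : Measurable f) :
    Measurable fun p : Z × PConf X => ∏ i, f (p.1, p.2.2 i) := by
  apply PConf.measurable_prod_iff
  intro n
  change Measurable fun p : Z × (Fin n → X) => ∏ i, f (p.1, p.2 i)
  exact Finset.measurable_fun_prod _ fun i _ =>
    hf.fun_comp (measurable_fst.prodMk ((measurable_pi_apply i).comp measurable_snd))

/-- The Laplace functional read from right to left: the exponential of an integral becomes an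
average over Poisson points of the product of the integrand. Applied to products of neighbouring
spins, these points are the bridges. -/
lemma exp_mul_integral {a : ℝ} (ha : 0 ≤ a) (hr : 0 ≤ r) {f : ℝ → ℝ} (hf : Measurable f)
    (hb : ∀ t, |f t| ≤ 1) :
    Real.exp (a * ∫ t in timeI r, f t) =
      Real.exp (a * r) * ∫ c, ∏ i, f (c.2 i) ∂PConf.pois (rateMeas a r) := by
  have hfin : IsFiniteMeasure (volume.restrict (timeI r)) :=
    ⟨by rw [Measure.restrict_apply_univ, volume_timeI]; exact ENNReal.ofReal_lt_top⟩
  have hfi : Integrable f (volume.restrict (timeI r)) :=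
    Integrable.of_bound hf.aestronglyMeasurable 1 (Filter.Eventually.of_forall hb)
  rw [PConf.integral_pois_prod _ hf hb, ← Real.exp_add, rateMeas, integral_smul_measure,
    integral_sub hfi (integrable_const _), ENNReal.toReal_ofReal ha]
  simp only [integral_const, smul_eq_mul, mul_one, Measure.real, Measure.restrict_apply_univ,
    volume_timeI, ENNReal.toReal_ofReal hr]
  congr 1; ring

/-- The multiset of points of a configuration. -/
def Config.mset (c : Config) : Multiset ℝ := Finset.univ.val.map c.2

lemma mcount_mset (c : Config) (U : Set ℝ) : mcount c.mset U = c.count U := by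
  classical
  rw [Config.count_eq_cnt, PConf.cnt_eq_sum, mcount, Config.mset, Multiset.countP_map,
    Finset.sum_boole]
  rfl

lemma mem_mset {c : Config} {t : ℝ} : t ∈ c.mset ↔ t ∈ c.points := by
  simp [Config.mset, Config.points]

lemma lineProd_mset (c D : Config) (ξ : Bool) : lineProd c.mset D ξ = ∏ i, lineSpin D ξ (c.2 i) := by
  rw [lineProd, Config.mset, Multiset.map_map]; rfl

lemma lineProd_add (L L' : Multiset ℝ) (D : Config) (ξ : Bool) :
    lineProd (L + L') D ξ = lineProd L D ξ * lineProd L' D ξ := by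
  simp [lineProd]

lemma lineProd_zero (D : Config) (ξ : Bool) : lineProd 0 D ξ = 1 := by simp [lineProd]

lemma lineProd_sum {ι : Type*} (s : Finset ι) (L : ι → Multiset ℝ) (D : Config) (ξ : Bool) :
    lineProd (∑ i ∈ s, L i) D ξ = ∏ i ∈ s, lineProd (L i) D ξ := by
  classical
  induction s using Finset.induction_on with
  | empty => simp [lineProd_zero]
  | insert a s ha ih => rw [Finset.sum_insert ha, Finset.prod_insert ha, lineProd_add, ih]

lemma mcount_add (L L' : Multiset ℝ) (U : Set ℝ) :
    mcount (L + L') U = mcount L U + mcount L' U := by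
  simp [mcount]

lemma mcount_zero (U : Set ℝ) : mcount 0 U = 0 := by simp [mcount]

lemma mcount_sum {ι : Type*} (s : Finset ι) (L : ι → Multiset ℝ) (U : Set ℝ) :
    mcount (∑ i ∈ s, L i) U = ∑ i ∈ s, mcount (L i) U := by
  classical
  induction s using Finset.induction_on with
  | empty => simp [mcount_zero]
  | insert a s ha ih => rw [Finset.sum_insert ha, Finset.sum_insert ha, mcount_add, ih]

/-- Bridges together with points attached to the ghost. -/
abbrev Switches (d N : ℕ) : Type := (Edge d N → Config) × (Site d N → Config)

/-- All points on the line at `x`, including sources `s`. -/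
def lineMset (s : Site d N → Multiset ℝ) (p : Switches d N) (x : Site d N) : Multiset ℝ :=
  (∑ e : Edge d N, if e.1.1 = x.1 ∨ e.1.2 = x.1 then (p.1 e).mset else 0) + (p.2 x).mset + s x

lemma mcount_lineMset (s : Site d N → Multiset ℝ) (p : Switches d N) (x : Site d N) (U : Set ℝ) :
    mcount (lineMset s p x) U = switchCount p.1 p.2 x U + mcount (s x) U := by
  rw [lineMset, mcount_add, mcount_add, mcount_sum, switchCount, mcount_mset]
  congr 2
  refine Finset.sum_congr rfl fun e _ => ?_
  split_ifs
  · exact mcount_mset _ _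
  · exact mcount_zero _

/-- The spin in `Λ_N`. -/
def siteSpin (ω : SpinSpace d N) (x : Site d N) (t : ℝ) : ℝ := lineSpin (ω.1 x) (ω.2 x) t

lemma spin_site (ω : SpinSpace d N) (x : Site d N) (t : ℝ) : spin ω x.1 t = siteSpin ω x t := by
  rw [spin, dif_pos x.2, siteSpin, lineSpin, flipWindow]
  split_ifs <;> rfl

lemma spin_of_notMem (ω : SpinSpace d N) {x : Lattice d} (hx : x ∉ box d N) (t : ℝ) :
    spin ω x t = 1 := dif_neg hx

lemma abs_siteSpin_le (ω : SpinSpace d N) (x : Site d N) (t : ℝ) : |siteSpin ω x t| ≤ 1 := by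
  rcases lineSpin_sq (ω.1 x) (ω.2 x) t with h | h <;> simp [siteSpin, h]

lemma measurable_siteSpin (x : Site d N) :
    Measurable fun p : SpinSpace d N × ℝ => siteSpin p.1 x p.2 :=
  measurable_lineSpin.comp (g := fun p : (Config × Bool) × ℝ => lineSpin p.1.1 p.1.2 p.2)
    (f := fun p : SpinSpace d N × ℝ => ((p.1.1 x, p.1.2 x), p.2)) ((((measurable_pi_apply x).comp (measurable_fst.comp measurable_fst)).prodMk
    ((measurable_pi_apply x).comp (measurable_snd.comp measurable_fst))).prodMk measurable_snd)

/-- The product of the spins at all switching points. -/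
def switchProd (p : Switches d N) (ω : SpinSpace d N) : ℝ :=
  (∏ e, ∏ i, siteSpin ω (edgeFst e) ((p.1 e).2 i) * siteSpin ω (edgeSnd e) ((p.1 e).2 i)) *
    ∏ x, ∏ i, siteSpin ω x ((p.2 x).2 i)

/-- A bridge contributes one spin to each of the two lines it joins, so the product over bridges can
be regrouped line by line. -/
lemma switchProd_mul (s : Site d N → Multiset ℝ) (p : Switches d N) (ω : SpinSpace d N) :
    switchProd p ω * ∏ x, lineProd (s x) (ω.1 x) (ω.2 x) =
      ∏ x, lineProd (lineMset s p x) (ω.1 x) (ω.2 x) := by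
  classical
  simp only [lineMset, lineProd_add, lineProd_sum, Finset.prod_mul_distrib, lineProd_mset]
  rw [switchProd]
  congr 2
  rw [Finset.prod_comm]
  refine Finset.prod_congr rfl fun e _ => ?_
  have h : ∀ x : Site d N, lineProd (if e.1.1 = x.1 ∨ e.1.2 = x.1 then (p.1 e).mset else 0) (ω.1 x)
      (ω.2 x) = if x = edgeFst e ∨ x = edgeSnd e then ∏ i, siteSpin ω x ((p.1 e).2 i) else 1 := by
    intro x
    simp only [incident_iff]
    split_ifs
    · exact lineProd_mset _ _ _
    · exact lineProd_zero _ _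
  simp only [h]
  rw [← Finset.prod_filter]
  have h2 : (Finset.univ.filter fun x : Site d N => x = edgeFst e ∨ x = edgeSnd e) =
      {edgeFst e, edgeSnd e} := by ext; simp
  rw [h2, Finset.prod_pair (edgeFst_ne_edgeSnd e), Finset.prod_mul_distrib]

lemma measurable_switchProd :
    Measurable fun q : SpinSpace d N × Switches d N => switchProd q.2 q.1 := by
  refine Measurable.mul (Finset.measurable_fun_prod _ fun e _ => ?_)
    (Finset.measurable_fun_prod _ fun x _ => ?_)
  · exact (PConf.measurable_prod_points_param (f := fun z : SpinSpace d N × ℝ =>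
      siteSpin z.1 (edgeFst e) z.2 * siteSpin z.1 (edgeSnd e) z.2)
      ((measurable_siteSpin _).mul (measurable_siteSpin _))).comp
      (measurable_fst.prodMk ((measurable_pi_apply e).comp (measurable_fst.comp measurable_snd)))
  · exact (PConf.measurable_prod_points_param (f := fun z : SpinSpace d N × ℝ =>
      siteSpin z.1 x z.2) (measurable_siteSpin _)).comp
      (measurable_fst.prodMk ((measurable_pi_apply x).comp (measurable_snd.comp measurable_snd)))

lemma measurable_lineInd (b : TemporalBC) (r : ℝ) :
    Measurable fun p : Config × Bool => lineInd b r p.1 p.2 := by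
  have h := fun t : ℝ => measurable_lineSpin.fun_comp
    (measurable_id.prodMk (measurable_const (a := t)) : Measurable fun p : Config × Bool => (p, t))
  refine Measurable.ite ?_ measurable_const measurable_const
  cases b
  · exact MeasurableSet.univ
  · exact (measurableSet_eq_fun (h _) measurable_const).inter
      (measurableSet_eq_fun (h _) measurable_const)
  · exact measurableSet_eq_fun (h _) (h _)

lemma abs_lineInd_le (b : TemporalBC) (r : ℝ) (D : Config) (ξ : Bool) : |lineInd b r D ξ| ≤ 1 := by
  unfold lineInd; split_ifs <;> simp

lemma temporalOK_iff (b : TemporalBC) (r : ℝ) (ω : SpinSpace d N) :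
    TemporalOK b r ω ↔ ∀ x, LineOK b r (ω.1 x) (ω.2 x) := by
  cases b
  · simp [TemporalOK, LineOK]
  · constructor
    · intro h x
      have := h x.1 x.2
      rw [spin_site, spin_site] at this
      exact this
    · intro h x hx
      have := spin_site ω ⟨x, hx⟩
      simp only at this
      rw [this, this]
      exact h ⟨x, hx⟩
  · constructor
    · intro h x
      have := h x.1 x.2
      rw [spin_site, spin_site] at this
      exact this
    · intro h x hx
      have := spin_site ω ⟨x, hx⟩
      simp only at this
      rw [this, this]
      exact h ⟨x, hx⟩

lemma spinDensity_eq (lam : ℝ) (s : SpatialBC) (b : TemporalBC) (r : ℝ) (ω : SpinSpace d N) :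
    spinDensity lam s b r ω =
      (∏ x, lineInd b r (ω.1 x) (ω.2 x)) * Real.exp (lam * interaction s r ω) := by
  classical
  unfold spinDensity
  by_cases h : ∀ x, LineOK b r (ω.1 x) (ω.2 x)
  · rw [if_pos ((temporalOK_iff _ _ _).2 h), Finset.prod_eq_one, one_mul]
    intro x _
    exact if_pos (h x)
  · rw [if_neg fun h' => h ((temporalOK_iff _ _ _).1 h')]
    push Not at h
    obtain ⟨x, hx⟩ := h
    rw [Finset.prod_eq_zero (Finset.mem_univ x) (if_neg hx), zero_mul]

lemma consistent_iff (b : TemporalBC) (r : ℝ) (S : Site d N → Set ℝ → ℕ) :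
    Consistent b r S ↔ ∀ x, LineCons b r (S x) := by
  cases b <;> simp [Consistent, LineCons]

-- On each line the even length is `r` minus the odd length, which brings the weight into the form
-- produced by `integral_line`.
open Classical in
lemma weight_eq_prod {δ : ℝ} (hr : 0 ≤ r) (b : TemporalBC) (k : Site d N → Bool)
    {S : Site d N → Set ℝ → ℕ} (hS : ∀ x, Additive (S x)) :
    weight δ b r k S = Real.exp (2 * δ * r) ^ Fintype.card (Site d N) * ∏ x,
      if LineCons b r (S x) then
        Real.exp (-(2 * δ) * (volume {t ∈ timeI r | IsOdd b r (k x) (S x) t}).toReal) else 0 := by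
  have hvol : ∀ x, (volume {t ∈ timeI r | ¬ IsOdd b r (k x) (S x) t}).toReal =
      r - (volume {t ∈ timeI r | IsOdd b r (k x) (S x) t}).toReal := by
    intro x
    have h1 := measure_inter_add_sdiff (μ := volume) (timeI r) (measurableSet_isOdd (hS x) (b := b) (r := r) (k := k x))
    have h2 : timeI r \ {t | IsOdd b r (k x) (S x) t} = {t ∈ timeI r | ¬ IsOdd b r (k x) (S x) t} := rfl
    have h3 : timeI r ∩ {t | IsOdd b r (k x) (S x) t} = {t ∈ timeI r | IsOdd b r (k x) (S x) t} := rfl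
    rw [h2, h3, volume_timeI] at h1
    have h4 := congrArg ENNReal.toReal h1
    rw [ENNReal.toReal_add, ENNReal.toReal_ofReal hr] at h4
    · linarith
    · exact ((measure_mono (fun t ht => ht.1)).trans_lt (by
        rw [volume_timeI]; exact ENNReal.ofReal_lt_top : volume (timeI r) < ∞)).ne
    · exact ((measure_mono (fun t ht => ht.1)).trans_lt (by
        rw [volume_timeI]; exact ENNReal.ofReal_lt_top : volume (timeI r) < ∞)).ne
  unfold weight
  by_cases h : ∀ x, LineCons b r (S x)
  · rw [if_pos ((consistent_iff _ _ _).2 h)]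
    simp only [h, if_true]
    rw [← Finset.card_univ, ← Finset.prod_const, ← Finset.prod_mul_distrib, Finset.mul_sum,
      Real.exp_sum]
    refine Finset.prod_congr rfl fun x _ => ?_
    rw [← Real.exp_add, hvol]
    congr 1; ring
  · rw [if_neg fun h' => h ((consistent_iff _ _ _).1 h')]
    push Not at h
    obtain ⟨x, hx⟩ := h
    rw [Finset.prod_eq_zero (Finset.mem_univ x) (if_neg hx), mul_zero]

lemma abs_prod_le_one {ι : Type*} (s : Finset ι) {f : ι → ℝ} (h : ∀ i ∈ s, |f i| ≤ 1) :
    |∏ i ∈ s, f i| ≤ 1 := by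
  rw [Finset.abs_prod]
  exact Finset.prod_le_one (fun _ _ => abs_nonneg _) h

lemma integral_spinLaw_prod {δ : ℝ} (hδ : 0 ≤ δ) (hr : 0 ≤ r) {F : Site d N → Config → Bool → ℝ}
    (hF : ∀ x, Measurable fun p : Config × Bool => F x p.1 p.2) (hb : ∀ x D ξ, |F x D ξ| ≤ 1) :
    ∫ ω, ∏ x, F x (ω.1 x) (ω.2 x) ∂spinLaw d δ N r =
      ∏ x, ∫ ξ, ∫ D, F x D ξ ∂PConf.pois (rateMeas δ r) ∂coinLaw := by
  rw [spinLaw, poissonLaw_eq_pois hδ hr, integral_prod_symm]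
  · simp only
    rw [← integral_fintype_prod_eq_prod (fun x ξ => ∫ D, F x D ξ ∂PConf.pois (rateMeas δ r))]
    congr 1; ext ξ
    exact integral_fintype_prod_eq_prod (fun x D => F x D (ξ x))
  · refine Integrable.of_bound (Measurable.aestronglyMeasurable ?_) 1
      (Filter.Eventually.of_forall fun ω => abs_prod_le_one _ fun x _ => hb _ _ _)
    exact Finset.measurable_fun_prod _ fun x _ => (hF x).comp
      (f := fun ω : SpinSpace d N => (ω.1 x, ω.2 x)) (((measurable_pi_apply x).comp measurable_fst).prodMk
        ((measurable_pi_apply x).comp measurable_snd))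

/-- The random-parity representation of the spin correlations. -/
theorem integral_spin_eq {lam δ : ℝ} (hδ : 0 ≤ δ) (hr : 0 ≤ r) (sp : SpatialBC) (b : TemporalBC)
    (ν : Measure (Switches d N)) [IsProbabilityMeasure ν] {K : ℝ}
    (hpts : ∀ᵐ p ∂ν, (∀ e, ∀ t ∈ (p.1 e).points, t ∈ timeI r) ∧
      ∀ x, ∀ t ∈ (p.2 x).points, t ∈ timeI r)
    (hK : ∀ ω : SpinSpace d N, Real.exp (lam * interaction sp r ω) = K * ∫ p, switchProd p ω ∂ν)
    {s : Site d N → Multiset ℝ} (hs : ∀ x, ∀ t ∈ s x, t ∈ timeI r) :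
    ∫ ω, (∏ x, lineProd (s x) (ω.1 x) (ω.2 x)) * spinDensity lam sp b r ω ∂spinLaw d δ N r =
      K * (lineConst b / Real.exp (2 * δ * r)) ^ Fintype.card (Site d N) *
        ∫ p, ∫ k, weight δ b r k (fun x U => switchCount p.1 p.2 x U + mcount (s x) U)
          ∂(Measure.pi fun _ => coinLaw) ∂ν := by
  classical
  have : IsProbabilityMeasure (spinLaw d δ N r) := by
    rw [spinLaw, poissonLaw_eq_pois hδ hr]; infer_instance
  have h1 : ∀ ω : SpinSpace d N, (∏ x, lineProd (s x) (ω.1 x) (ω.2 x)) * spinDensity lam sp b r ω =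
      K * ∫ p, ∏ x, (lineInd b r (ω.1 x) (ω.2 x) * lineProd (lineMset s p x) (ω.1 x) (ω.2 x)) ∂ν := by
    intro ω
    simp only [Finset.prod_mul_distrib, ← switchProd_mul]
    rw [integral_const_mul, integral_mul_const, spinDensity_eq, hK]
    ring
  simp only [h1]
  rw [integral_const_mul, mul_assoc]
  congr 1
  -- Once the switching points are fixed, the lines are independent under the a-priori spin law, and
  -- each factor is evaluated by `integral_line`.
  rw [integral_integral_swap]
  · rw [← integral_const_mul]
    refine integral_congr_ae ?_
    filter_upwards [hpts] with p hp
    have hL : ∀ x, ∀ t ∈ lineMset s p x, t ∈ timeI r := by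
      intro x t ht
      rw [lineMset, Multiset.mem_add, Multiset.mem_add, Multiset.mem_sum] at ht
      rcases ht with (⟨e, -, ht⟩ | ht) | ht
      · split_ifs at ht
        · exact hp.1 e t (mem_mset.1 ht)
        · simp at ht
      · exact hp.2 x t (mem_mset.1 ht)
      · exact hs x t ht
    have hcount : ∀ x, mcount (lineMset s p x) = fun U => switchCount p.1 p.2 x U + mcount (s x) U :=
      fun x => funext fun U => mcount_lineMset s p x U
    have hadd : ∀ x, Additive (fun U => switchCount p.1 p.2 x U + mcount (s x) U) := by
      intro x
      refine (switchCount_additive _ _ x).add ?_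
      intro U V
      induction s x using Multiset.induction with
      | empty => simp [mcount_zero]
      | cons a L ih =>
        simp only [mcount, Multiset.countP_cons] at ih ⊢
        rw [ih]
        by_cases hU : a ∈ U <;> by_cases hV : a ∈ V <;> simp [hU, hV] <;> ring
    rw [integral_spinLaw_prod hδ hr (F := fun x D ξ => lineInd b r D ξ * lineProd (lineMset s p x) D ξ)
      (fun x => (measurable_lineInd b r).mul (measurable_lineProd _)) (fun x D ξ => by
        rw [abs_mul]; exact mul_le_one₀ (abs_lineInd_le _ _ _ _) (abs_nonneg _) (abs_lineProd_le _ _ _))]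
    simp only [weight_eq_prod hr b _ hadd]
    rw [integral_const_mul]
    rw [integral_fintype_prod_eq_prod (fun x k => if LineCons b r (fun U => switchCount p.1 p.2 x U + mcount (s x) U) then
        Real.exp (-(2 * δ) * (volume {t ∈ timeI r | IsOdd b r k (fun U => switchCount p.1 p.2 x U + mcount (s x) U) t}).toReal) else 0)]
    simp only [integral_line hδ (hL _), hcount, Finset.prod_mul_distrib, Finset.prod_const,
      Finset.card_univ]
    rw [← mul_assoc, div_pow, div_mul_cancel₀ _ (pow_ne_zero _ (Real.exp_ne_zero _))]
  · refine Integrable.of_bound (Measurable.aestronglyMeasurable ?_) 1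
      (Filter.Eventually.of_forall fun q => abs_prod_le_one _ fun x _ => by
        rw [abs_mul]; exact mul_le_one₀ (abs_lineInd_le _ _ _ _) (abs_nonneg _) (abs_lineProd_le _ _ _))
    have h2 : (Function.uncurry fun (ω : SpinSpace d N) (p : Switches d N) =>
        ∏ x, (lineInd b r (ω.1 x) (ω.2 x) * lineProd (lineMset s p x) (ω.1 x) (ω.2 x))) =
        fun q => (∏ x, lineInd b r (q.1.1 x) (q.1.2 x)) * (switchProd q.2 q.1 *
          ∏ x, lineProd (s x) (q.1.1 x) (q.1.2 x)) := by
      funext q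
      simp only [Function.uncurry, Finset.prod_mul_distrib, ← switchProd_mul]
    rw [h2]
    have hx : ∀ x, Measurable fun q : SpinSpace d N × Switches d N => (q.1.1 x, q.1.2 x) := fun x =>
      ((measurable_pi_apply x).comp (measurable_fst.comp measurable_fst)).prodMk
        ((measurable_pi_apply x).comp (measurable_snd.comp measurable_fst))
    exact (Finset.measurable_fun_prod _ fun x _ => (measurable_lineInd b r).comp (hx x)).mul
      (measurable_switchProd.mul (Finset.measurable_fun_prod _ fun x _ =>
        (measurable_lineProd _).comp (hx x)))

end
end TFIM

namespace TFIM
noncomputable section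
open scoped ENNReal
variable {d N : ℕ} {r : ℝ}

/-! ### Expansion of the interaction -/

lemma Nbr.symm {x y : Lattice d} (h : Nbr x y) : Nbr y x := by
  unfold Nbr at h ⊢
  rw [← h]
  exact Finset.sum_congr rfl fun i _ => abs_sub_comm _ _

lemma Nbr.ne {x y : Lattice d} (h : Nbr x y) : x ≠ y := by
  rintro rfl
  simp [Nbr] at h

/-- Incomparable points differ in at least two coordinates, so their `ℓ¹`-distance is at least two.
-/
lemma Nbr.lt_or_lt {x y : Lattice d} (h : Nbr x y) : x < y ∨ y < x := by
  by_cases h1 : x ≤ y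
  · exact Or.inl (lt_of_le_of_ne h1 h.ne)
  · by_cases h2 : y ≤ x
    · exact Or.inr (lt_of_le_of_ne h2 h.ne.symm)
    · exfalso
      rw [Pi.le_def] at h1 h2
      push Not at h1 h2
      obtain ⟨i, hi⟩ := h1
      obtain ⟨j, hj⟩ := h2
      have hij : i ≠ j := by rintro rfl; exact lt_asymm hi hj
      have hle : ∑ k ∈ {i, j}, |x k - y k| ≤ ∑ k, |x k - y k| :=
        Finset.sum_le_sum_of_subset_of_nonneg (Finset.subset_univ _) fun _ _ _ => abs_nonneg _
      rw [Finset.sum_pair hij, h] at hle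
      have a1 : 1 ≤ |x i - y i| := Int.one_le_abs (by omega)
      have a2 : 1 ≤ |x j - y j| := Int.one_le_abs (by omega)
      omega

lemma box_mono {M N : ℕ} (h : M ≤ N) : box d M ⊆ box d N := by
  intro x hx
  simp only [box, Fintype.mem_piFinset, Finset.mem_Icc] at hx ⊢
  intro i
  have := hx i
  omega

open Classical in
/-- The edges of the larger box: edges of `Λ_N`, edges at the boundary, and the others. -/
lemma sum_edges_succ (I : Lattice d → Lattice d → ℝ) (J : Lattice d → ℝ) (c : ℝ)
    (h1 : ∀ x ∈ box d N, ∀ y, y ∉ box d N → I x y = J x)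
    (h2 : ∀ x, x ∉ box d N → ∀ y ∈ box d N, I x y = J y)
    (h3 : ∀ x, x ∉ box d N → ∀ y, y ∉ box d N → I x y = c) :
    ∑ e ∈ edges d (N + 1), I e.1 e.2 = ∑ e ∈ edges d N, I e.1 e.2 +
      ∑ x : Site d N, (outDegree x : ℝ) * J x.1 +
      (((edges d (N + 1)).filter fun e => e.1 ∉ box d N ∧ e.2 ∉ box d N).card : ℝ) * c := by
  have hsub := box_mono (d := d) (Nat.le_succ N)
  have e0 : edges d N = (edges d (N + 1)).filter fun e => e.1 ∈ box d N ∧ e.2 ∈ box d N := by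
    ext e
    simp only [mem_edges, Finset.mem_filter]
    constructor
    · exact fun h => ⟨⟨⟨hsub h.1.1, hsub h.1.2⟩, h.2⟩, h.1⟩
    · exact fun h => ⟨h.2, h.1.2⟩
  have e1 : ∑ x : Site d N, (outDegree x : ℝ) * J x.1 =
      ∑ x ∈ box d (N + 1), ∑ y ∈ box d (N + 1),
        if x ∈ box d N ∧ y ∉ box d N ∧ Nbr x y then J x else 0 := by
    rw [← Finset.sum_subset hsub]
    · rw [← Finset.sum_coe_sort (box d N)]
      refine Finset.sum_congr rfl fun x _ => ?_
      rw [← Finset.sum_filter, Finset.sum_const, nsmul_eq_mul]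
      congr 2
      unfold outDegree
      congr 1
      refine Finset.filter_congr fun y _ => ?_
      simp [x.2]
    · intro x _ hx
      exact Finset.sum_eq_zero fun y _ => if_neg fun h => hx h.1
  have e2 : ∀ (P : Lattice d × Lattice d → Prop) [DecidablePred P], ∀ F : Lattice d × Lattice d → ℝ,
      ∑ e ∈ (edges d (N + 1)).filter P, F e =
      ∑ x ∈ box d (N + 1), ∑ y ∈ box d (N + 1),
        if (x < y ∧ Nbr x y) ∧ P (x, y) then F (x, y) else 0 := by
    intro P _ F
    rw [edges, Finset.filter_filter, Finset.sum_filter, Finset.sum_product]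
  -- Each pair of an inner site and an outer neighbour is listed as exactly one ordered edge; which
  -- of its ends is the inner site depends on the coordinatewise order.
  have e3 : ∑ x ∈ box d (N + 1), ∑ y ∈ box d (N + 1),
        (if x ∈ box d N ∧ y ∉ box d N ∧ Nbr x y then J x else 0) =
      ∑ e ∈ (edges d (N + 1)).filter (fun e => e.1 ∈ box d N ∧ e.2 ∉ box d N), J e.1 +
      ∑ e ∈ (edges d (N + 1)).filter (fun e => e.1 ∉ box d N ∧ e.2 ∈ box d N), J e.2 := by
    rw [e2, e2, Finset.sum_comm (s := box d (N + 1)) (t := box d (N + 1)) (f := fun x y =>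
      if (x < y ∧ Nbr x y) ∧ x ∉ box d N ∧ y ∈ box d N then J y else 0),
      ← Finset.sum_add_distrib]
    refine Finset.sum_congr rfl fun x _ => ?_
    rw [← Finset.sum_add_distrib]
    refine Finset.sum_congr rfl fun y _ => ?_
    by_cases hx : x ∈ box d N <;> by_cases hy : y ∈ box d N
    · simp [hx, hy]
    · by_cases hn : Nbr x y
      · rcases hn.lt_or_lt with h | h
        · simp [hx, hy, hn, h, h.not_gt]
        · simp [hx, hy, hn, hn.symm, h, h.not_gt]
      · have : ¬ Nbr y x := fun h => hn h.symm
        simp [hx, hn, this]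
    · simp [hx]
    · simp [hx]
  rw [e1, e3, e0, ← nsmul_eq_mul, ← Finset.sum_const]
  simp only [Finset.sum_filter]
  rw [← Finset.sum_add_distrib, ← Finset.sum_add_distrib, ← Finset.sum_add_distrib]
  refine Finset.sum_congr rfl fun e _ => ?_
  by_cases hx : e.1 ∈ box d N <;> by_cases hy : e.2 ∈ box d N
  · simp [hx, hy]
  · simp [hx, hy, h1 _ hx _ hy]
  · simp [hx, hy, h2 _ hx _ hy]
  · simp [hx, hy, h3 _ hx _ hy]

/-- The law of the bridges and the ghost points with the free spatial boundary condition. -/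
def freeLaw (d N : ℕ) (lam r : ℝ) : Measure (Switches d N) :=
  (Measure.pi fun _ => PConf.pois (rateMeas lam r)).prod (Measure.dirac fun _ => Config.empty)

/-- The law of the bridges and the ghost points with the wired spatial boundary condition. -/
def wiredLaw (d N : ℕ) (lam r : ℝ) : Measure (Switches d N) :=
  (Measure.pi fun _ => PConf.pois (rateMeas lam r)).prod
    (Measure.pi fun x : Site d N => PConf.pois (rateMeas (lam * (outDegree x : ℝ)) r))

instance (lam r : ℝ) : IsProbabilityMeasure (freeLaw d N lam r) := by
  unfold freeLaw; infer_instance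

instance (lam r : ℝ) : IsProbabilityMeasure (wiredLaw d N lam r) := by
  unfold wiredLaw; infer_instance

lemma measurable_siteSpin_right (ω : SpinSpace d N) (x : Site d N) : Measurable (siteSpin ω x) :=
  (measurable_siteSpin x).comp (measurable_const.prodMk measurable_id)

lemma exp_edges {lam : ℝ} (hlam : 0 ≤ lam) (hr : 0 ≤ r) (ω : SpinSpace d N) :
    Real.exp (lam * ∑ e ∈ edges d N, ∫ t in timeI r, spin ω e.1 t * spin ω e.2 t) =
      Real.exp (lam * r) ^ Fintype.card (Edge d N) *
        ∫ B, ∏ e, ∏ i, siteSpin ω (edgeFst e) ((B e).2 i) * siteSpin ω (edgeSnd e) ((B e).2 i)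
          ∂(Measure.pi fun _ : Edge d N => PConf.pois (rateMeas lam r)) := by
  rw [integral_fintype_prod_eq_prod (fun (e : Edge d N) (c : Config) =>
    ∏ i, siteSpin ω (edgeFst e) (c.2 i) * siteSpin ω (edgeSnd e) (c.2 i)), ← Finset.sum_coe_sort,
    Finset.mul_sum, Real.exp_sum, ← Finset.card_univ, ← Finset.prod_const,
    ← Finset.prod_mul_distrib]
  refine Finset.prod_congr rfl fun e _ => ?_
  have := exp_mul_integral hlam hr (f := fun t => siteSpin ω (edgeFst e) t * siteSpin ω (edgeSnd e) t)
    ((measurable_siteSpin_right ω _).mul (measurable_siteSpin_right ω _)) (fun t => by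
      rw [abs_mul]; exact mul_le_one₀ (abs_siteSpin_le _ _ _) (abs_nonneg _) (abs_siteSpin_le _ _ _))
  rw [← this]
  congr 2
  refine integral_congr_ae (Filter.Eventually.of_forall fun t => ?_)
  exact congrArg₂ _ (spin_site ω (edgeFst e) t) (spin_site ω (edgeSnd e) t)

lemma exp_interaction_free {lam : ℝ} (hlam : 0 ≤ lam) (hr : 0 ≤ r) (ω : SpinSpace d N) :
    Real.exp (lam * interaction .free r ω) =
      Real.exp (lam * r) ^ Fintype.card (Edge d N) * ∫ p, switchProd p ω ∂freeLaw d N lam r := by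
  rw [interaction, exp_edges hlam hr, freeLaw]
  congr 1
  simp only [switchProd]
  rw [integral_prod_mul (f := fun B : Edge d N → Config => ∏ e, ∏ i, siteSpin ω (edgeFst e) ((B e).2 i) *
    siteSpin ω (edgeSnd e) ((B e).2 i)) (g := fun G : Site d N → Config => ∏ x, ∏ i, siteSpin ω x ((G x).2 i))]
  rw [integral_dirac']
  · rw [Finset.prod_eq_one fun x _ => ?_, mul_one]
    exact Finset.prod_eq_one fun i _ => Fin.elim0 i
  · refine (Measurable.stronglyMeasurable ?_)
    exact Finset.measurable_fun_prod _ fun x _ =>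
      (PConf.measurable_prod_points (measurable_siteSpin_right ω x)).comp (measurable_pi_apply x)

/-- With outer spins `+1`, an edge crossing the boundary acts as a field on its inner endpoint and
produces the points of `G`; an edge with both ends outside contributes the constant `r`. All
constants are collected in `K`, which does not depend on `ω`. -/
lemma exp_interaction_wired {lam : ℝ} (hlam : 0 ≤ lam) (hr : 0 ≤ r) :
    ∃ K : ℝ, 0 < K ∧ ∀ ω : SpinSpace d N, Real.exp (lam * interaction .wired r ω) =
      K * ∫ p, switchProd p ω ∂wiredLaw d N lam r := by
  classical
  refine ⟨Real.exp (lam * r) ^ Fintype.card (Edge d N) *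
    (∏ x : Site d N, Real.exp (lam * (outDegree x : ℝ) * r)) * Real.exp (lam *
    ((((edges d (N + 1)).filter fun e => e.1 ∉ box d N ∧ e.2 ∉ box d N).card : ℝ) * r)),
    by positivity, fun ω => ?_⟩
  rw [interaction, sum_edges_succ (N := N) (I := fun x y => ∫ t in timeI r, spin ω x t * spin ω y t)
    (J := fun x => ∫ t in timeI r, spin ω x t) (c := r), mul_add, mul_add, Real.exp_add, Real.exp_add,
    exp_edges hlam hr, wiredLaw]
  · simp only [switchProd]
    rw [integral_prod_mul (f := fun B : Edge d N → Config => ∏ e, ∏ i, siteSpin ω (edgeFst e) ((B e).2 i) *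
      siteSpin ω (edgeSnd e) ((B e).2 i)) (g := fun G : Site d N → Config => ∏ x, ∏ i, siteSpin ω x ((G x).2 i)),
      integral_fintype_prod_eq_prod (fun (x : Site d N) (c : Config) => ∏ i, siteSpin ω x (c.2 i)),
      Finset.mul_sum, Real.exp_sum]
    have : ∀ x : Site d N, Real.exp (lam * ((outDegree x : ℝ) * ∫ t in timeI r, spin ω x.1 t)) =
        Real.exp (lam * (outDegree x : ℝ) * r) *
          ∫ c, ∏ i, siteSpin ω x (c.2 i) ∂PConf.pois (rateMeas (lam * (outDegree x : ℝ)) r) := by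
      intro x
      rw [← exp_mul_integral (by positivity) hr (measurable_siteSpin_right ω x) (abs_siteSpin_le ω x),
        mul_assoc]
      congr 3
      exact integral_congr_ae (Filter.Eventually.of_forall fun t => spin_site ω x t)
    simp only [this, Finset.prod_mul_distrib]
    ring
  · intro x hx y hy
    simp [spin_of_notMem ω hy]
  · intro x hx y hy
    simp [spin_of_notMem ω hx]
  · intro x hx y hy
    simp [spin_of_notMem ω hx, spin_of_notMem ω hy, Measure.real, volume_timeI, hr]

lemma ae_pois_points (a r : ℝ) : ∀ᵐ c ∂PConf.pois (rateMeas a r), ∀ t ∈ Config.points c, t ∈ timeI r := by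
  have h := PConf.ae_pois_generic (μ := rateMeas a r) measurable_id (fun t => by
    rw [rateMeas, Measure.smul_apply, preimage_id, nonpos_iff_eq_zero.1
      ((Measure.restrict_apply_le _ _).trans (measure_singleton t).le), smul_zero]) Set.countable_empty
    (T := timeI r) (Measure.ae_smul_measure (ae_restrict_mem (measurableSet_timeI r)) _)
  filter_upwards [h] with c hc
  rintro t ⟨i, rfl⟩
  exact (hc.2 i).1

lemma ae_pi_points {ι : Type*} [Fintype ι] (a : ι → ℝ) (r : ℝ) :
    ∀ᵐ c ∂Measure.pi fun i => PConf.pois (rateMeas (a i) r),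
      ∀ i, ∀ t ∈ Config.points (c i), t ∈ timeI r :=
  ae_all_iff.2 fun i => (Measure.tendsto_eval_ae_ae (i := i)
    (μ := fun i => PConf.pois (rateMeas (a i) r))).eventually (ae_pois_points (a i) r)

lemma ae_freeLaw (lam r : ℝ) : ∀ᵐ p ∂freeLaw d N lam r,
    (∀ e, ∀ t ∈ (p.1 e).points, t ∈ timeI r) ∧ ∀ x, ∀ t ∈ (p.2 x).points, t ∈ timeI r := by
  have h1 : ∀ᵐ p ∂freeLaw d N lam r, ∀ e, ∀ t ∈ (p.1 e).points, t ∈ timeI r :=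
    Measure.quasiMeasurePreserving_fst.ae (ae_pi_points _ r)
  have h2 : ∀ᵐ p ∂freeLaw d N lam r, ∀ x, ∀ t ∈ (p.2 x).points, t ∈ timeI r := by
    refine Measure.quasiMeasurePreserving_snd.ae (p := fun G : Site d N → Config =>
      ∀ x, ∀ t ∈ (G x).points, t ∈ timeI r) ?_
    rw [ae_iff]
    -- The exceptional set is enlarged to one described by counts, which is measurable, so that the
    -- Dirac mass can be evaluated on it.
    refine measure_mono_null (t := {G | ∃ x, (G x).count univ ≠ 0}) ?_ ?_
    · intro G hG
      by_contra hc
      refine hG fun x t ht => ?_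
      have h0 : (G x).count univ = 0 := by
        by_contra hx; exact hc ⟨x, hx⟩
      have := (G x).count_additive.mono (subset_univ {t})
      exact absurd (Nat.le_zero.1 (h0 ▸ this)) ((Config.mem_points_iff _ _).1 ht)
    · have hm : MeasurableSet {G : Site d N → Config | ∃ x, (G x).count univ ≠ 0} := by
        have : {G : Site d N → Config | ∃ x, (G x).count univ ≠ 0} =
            ⋃ x, (fun G : Site d N → Config => (G x).count univ) ⁻¹' {0}ᶜ := by ext; simp
        rw [this]
        exact MeasurableSet.iUnion fun x =>
          ((PConf.measurable_cnt MeasurableSet.univ).comp (measurable_pi_apply x))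
            (MeasurableSet.of_discrete)
      rw [Measure.dirac_apply' _ hm, Set.indicator_of_notMem]
      rintro ⟨x, hx⟩
      exact hx (config_empty_count _)
  exact h1.and h2

lemma ae_wiredLaw (lam r : ℝ) : ∀ᵐ p ∂wiredLaw d N lam r,
    (∀ e, ∀ t ∈ (p.1 e).points, t ∈ timeI r) ∧ ∀ x, ∀ t ∈ (p.2 x).points, t ∈ timeI r :=
  (Measure.quasiMeasurePreserving_fst.ae (ae_pi_points _ r)).and
    (Measure.quasiMeasurePreserving_snd.ae (ae_pi_points _ r))

end
end TFIM

namespace TFIM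
noncomputable section
open scoped ENNReal
variable {d N : ℕ} {r : ℝ}

/-! ### Correlations as ratios of partition functions -/

/-- The partition function of a labelling with sources `s`. -/
def partition (δ : ℝ) (b : TemporalBC) (r : ℝ) (ν : Measure (Switches d N))
    (s : Site d N → Set ℝ → ℕ) : ℝ :=
  ∫ p, ∫ k, weight δ b r k (fun x U => switchCount p.1 p.2 x U + s x U)
    ∂(Measure.pi fun _ => coinLaw) ∂ν

open Classical in
/-- The source `q` as a multiset of times on the line at `y`. -/
def srcMset (q : Site d N × ℝ) (y : Site d N) : Multiset ℝ := if y = q.1 then {q.2} else 0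

lemma mcount_srcMset (q : Site d N × ℝ) (y : Site d N) (U : Set ℝ) :
    mcount (srcMset q y) U = src q y U := by
  classical
  unfold srcMset src
  by_cases h : y = q.1 <;> by_cases h2 : q.2 ∈ U <;> simp [h, h2, mcount, ← Multiset.cons_zero]

lemma prod_lineProd_srcMset (q : Site d N × ℝ) (ω : SpinSpace d N) :
    ∏ y, lineProd (srcMset q y) (ω.1 y) (ω.2 y) = siteSpin ω q.1 q.2 := by
  classical
  rw [Finset.prod_eq_single q.1]
  · simp [srcMset, lineProd, siteSpin]
  · intro y _ hy
    simp [srcMset, hy, lineProd]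
  · simp

/-- Numerator and denominator carry the same prefactor, which is nonzero and cancels. Only the two
spins survive as sources. -/
lemma twoPoint_eq {lam δ : ℝ} (hδ : 0 ≤ δ) (hr : 0 ≤ r) (sp : SpatialBC) (b : TemporalBC)
    (ν : Measure (Switches d N)) [IsProbabilityMeasure ν] {K : ℝ} (hK0 : 0 < K)
    (hpts : ∀ᵐ p ∂ν, (∀ e, ∀ t ∈ (p.1 e).points, t ∈ timeI r) ∧
      ∀ x, ∀ t ∈ (p.2 x).points, t ∈ timeI r)
    (hK : ∀ ω : SpinSpace d N, Real.exp (lam * interaction sp r ω) = K * ∫ p, switchProd p ω ∂ν)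
    (x : Site d N) {t : ℝ} (ht : t ∈ timeI r) :
    twoPoint d lam δ sp b N r x.1 t =
      partition δ b r ν (src (⟨0, zero_mem_box d N⟩, 0) + src (x, t)) / partition δ b r ν 0 := by
  have h0 : (0 : ℝ) ∈ timeI r := ⟨by linarith, by linarith⟩
  have e1 := integral_spin_eq hδ hr sp b ν hpts hK (s := fun _ => 0) (by simp)
  have e2 := integral_spin_eq hδ hr sp b ν hpts hK
    (s := fun y => srcMset (⟨0, zero_mem_box d N⟩, 0) y + srcMset (x, t) y) (by
      intro y s hs
      rw [Multiset.mem_add] at hs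
      unfold srcMset at hs
      rcases hs with hs | hs <;> split_ifs at hs
      · rw [Multiset.mem_singleton.1 hs]; exact h0
      · simp at hs
      · rw [Multiset.mem_singleton.1 hs]; exact ht
      · simp at hs)
  simp only [lineProd_zero, Finset.prod_const_one, one_mul, mcount_zero] at e1
  simp only [lineProd_add, Finset.prod_mul_distrib, prod_lineProd_srcMset, mcount_add,
    mcount_srcMset] at e2
  have hne : K * (lineConst b / Real.exp (2 * δ * r)) ^ Fintype.card (Site d N) ≠ 0 := by
    refine mul_ne_zero hK0.ne' (pow_ne_zero _ (div_ne_zero ?_ (Real.exp_ne_zero _)))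
    cases b <;> simp [lineConst]
  have e3 : ∀ ω : SpinSpace d N, spin ω 0 0 * spin ω x.1 t =
      siteSpin ω ⟨0, zero_mem_box d N⟩ 0 * siteSpin ω x t := fun ω => by
    rw [← spin_site, ← spin_site]
  simp only [twoPoint, e3]
  rw [e1, e2, mul_div_mul_left _ _ hne]
  rfl

lemma measurable_pair_components :
    (∀ e, Measurable fun ω : Pair d N => ω.B e) ∧ (∀ e, Measurable fun ω : Pair d N => ω.B' e) ∧
    (∀ x, Measurable fun ω : Pair d N => ω.G x) ∧ (Measurable fun ω : Pair d N => ω.coin) ∧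
    (Measurable fun ω : Pair d N => ω.coin') := by
  have h := measurable_toProd (d := d) (N := N)
  have h1 := measurable_fst.comp h
  have h2 := measurable_fst.comp (measurable_snd.comp h)
  exact ⟨fun e => (measurable_pi_apply e).comp (measurable_fst.comp h1),
    fun e => (measurable_pi_apply e).comp (measurable_fst.comp h2),
    fun e => (measurable_pi_apply e).comp (measurable_fst.comp (measurable_snd.comp h2)),
    measurable_snd.comp h1, measurable_snd.comp (measurable_snd.comp h2)⟩

lemma measurable_srcWeight_pair {α β : Site d N → Set ℝ → ℕ}
    (hα : ∀ y, MeasCount fun (_ : Pair d N) => α y) (hβ : ∀ y, MeasCount fun (_ : Pair d N) => β y)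
    (δ : ℝ) (R : Regime) (r : ℝ) : Measurable (srcWeight δ R r α β) := by
  obtain ⟨hB, hB', hG, hk, hk'⟩ := measurable_pair_components (d := d) (N := N)
  refine Measurable.mul ?_ ?_
  · exact measurable_weight (T := fun y (ω : Pair d N) => ω.T₁ α y)
      (fun y => (measCount_switchCount hB (fun _ => measurable_const) y).add (hα y)) hk δ R.bc₁ r
  · exact measurable_weight (T := fun y (ω : Pair d N) => ω.T₂ β y)
      (fun y => (measCount_switchCount hB' hG y).add (hβ y)) hk' δ R.bc₂ r

/-- A family of sources which does not depend on the randomness. -/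
def GoodSource (α : Site d N → Set ℝ → ℕ) : Prop :=
  ∀ (Ω : Type) [MeasurableSpace Ω] (y : Site d N), MeasCount fun (_ : Ω) => α y

lemma goodSource_zero : GoodSource (0 : Site d N → Set ℝ → ℕ) := fun _ _ _ => measCount_zero

lemma goodSource_src_add (o q : Site d N × ℝ) : GoodSource (src o + src q) :=
  fun _ _ y => measCount_src_add o q y

lemma integrable_weight {Ω : Type} [MeasurableSpace Ω] {δ : ℝ} (hδ : 0 ≤ δ) (hr : 0 ≤ r)
    (b : TemporalBC) {B : Ω → Edge d N → Config} {G : Ω → Site d N → Config}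
    {k : Ω → Site d N → Bool} (hB : Measurable B) (hG : Measurable G) (hk : Measurable k)
    {α : Site d N → Set ℝ → ℕ} (hα : GoodSource α) (μ : Measure Ω) [IsFiniteMeasure μ] :
    Integrable (fun ω => weight δ b r (k ω) fun x U => switchCount (B ω) (G ω) x U + α x U) μ := by
  refine Integrable.of_bound (Measurable.aestronglyMeasurable ?_)
    (Real.exp (2 * δ * (Fintype.card (Site d N) * r))) (Filter.Eventually.of_forall fun ω => ?_)
  · exact measurable_weight (T := fun y (ω : Ω) U => switchCount (B ω) (G ω) y U + α y U)
      (fun y => (measCount_switchCount (fun e => (measurable_pi_apply e).comp hB)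
        (fun x => (measurable_pi_apply x).comp hG) y).add (hα Ω y)) hk δ b r
  · rw [Real.norm_of_nonneg (weight_nonneg _ _ _ _ _)]
    exact weight_le hδ hr _ _ _

/-- The two labellings are built from independent components and the weight is a product; the cuts
integrate to one. -/
lemma integral_srcWeight {lam δ : ℝ} (hlam : 0 ≤ lam) (hδ : 0 ≤ δ) (hr : 0 ≤ r) (R : Regime)
    {α β : Site d N → Set ℝ → ℕ} (hα : GoodSource α) (hβ : GoodSource β) :
    ∫ p, srcWeight δ R r α β (toPair p) ∂baseLaw d N lam δ r =
      partition δ R.bc₁ r (freeLaw d N lam r) α * partition δ R.bc₂ r (wiredLaw d N lam r) β := by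
  have hm : Measurable (srcWeight δ R r α β) :=
    measurable_srcWeight_pair (fun y => hα _ y) (fun y => hβ _ y) δ R r
  have hmp := map_toPair (d := d) (N := N) hlam hδ hr
  rw [← integral_map (f := srcWeight δ R r α β) hmp.measurable.aemeasurable
    hm.aestronglyMeasurable, hmp.map_eq, pairLaw,
    integral_map measurable_ofProd.aemeasurable hm.aestronglyMeasurable]
  have e1 : ∀ x : Site d N, poissonLaw (lam * (outDegree x : ℝ)) r =
      PConf.pois (rateMeas (lam * (outDegree x : ℝ)) r) :=
    fun x => poissonLaw_eq_pois (by positivity) hr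
  simp only [e1, poissonLaw_eq_pois hlam hr, poissonLaw_eq_pois (show 0 ≤ 4 * δ by positivity) hr]
  set μB := Measure.pi fun _ : Edge d N => PConf.pois (rateMeas lam r) with hμB
  set μG := Measure.pi fun x : Site d N => PConf.pois (rateMeas (lam * (outDegree x : ℝ)) r) with hμG
  set μC := Measure.pi fun _ : Site d N => PConf.pois (rateMeas (4 * δ) r)
  set κ := Measure.pi fun _ : Site d N => coinLaw with hκ
  let f : (Edge d N → Config) × (Site d N → Bool) → ℝ := fun p =>
    weight δ R.bc₁ r p.2 (fun x U => switchCount p.1 (fun _ => Config.empty) x U + α x U)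
  let g : (Edge d N → Config) × (Site d N → Config) × (Site d N → Bool) → ℝ := fun p =>
    weight δ R.bc₂ r p.2.2 (fun x U => switchCount p.1 p.2.1 x U + β x U)
  change ∫ p, f p.1 * g p.2.1 ∂((μB.prod κ).prod ((μB.prod (μG.prod κ)).prod μC)) = _
  rw [integral_prod_mul (f := f) (g := fun p : ((Edge d N → Config) × (Site d N → Config) ×
    (Site d N → Bool)) × (Site d N → Config) => g p.1)]
  congr 1
  · rw [partition, freeLaw, integral_prod, ← hμB, Measure.prod_dirac,
      integral_map (φ := fun B : Edge d N → Config => (B, fun _ : Site d N => Config.empty))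
        (measurable_id.prodMk measurable_const).aemeasurable]
    · refine Measurable.aestronglyMeasurable ?_
      refine (StronglyMeasurable.integral_prod_right' (ν := κ) (f := fun q : Switches d N × (Site d N → Bool) =>
        weight δ R.bc₁ r q.2 fun x U => switchCount q.1.1 q.1.2 x U + α x U) ?_).measurable
      refine (measurable_weight (T := fun y (q : Switches d N × (Site d N → Bool)) U =>
        switchCount q.1.1 q.1.2 y U + α y U) (fun y => (measCount_switchCount
          (fun e => (measurable_pi_apply e).comp (measurable_fst.comp measurable_fst))
          (fun x => (measurable_pi_apply x).comp (measurable_snd.comp measurable_fst)) y).add (hα _ y))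
          measurable_snd δ R.bc₁ r).stronglyMeasurable
    · exact integrable_weight hδ hr _ measurable_fst measurable_const measurable_snd hα _
  · rw [integral_fun_fst (μ := μB.prod (μG.prod κ)) (ν := μC) g, probReal_univ, one_smul,
      ← (measurePreserving_prodAssoc μB μG κ).integral_comp' g, partition, wiredLaw, ← hμB, ← hμG,
      integral_prod]
    · rfl
    · exact integrable_weight hδ hr _ (measurable_fst.comp measurable_fst)
        (measurable_snd.comp measurable_fst) measurable_snd hβ _

/-- The difference of the two-point functions in terms of partition functions of pairs. -/
theorem twoPoint_sub_eq {lam δ : ℝ} (hlam : 0 ≤ lam) (hδ : 0 ≤ δ) (hr : 0 ≤ r) (R : Regime)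
    (x : Site d N) {t : ℝ} (ht : t ∈ timeI r)
    (hZ : ∫ p : Base d N, srcWeight δ R r 0 0 (toPair p) ∂baseLaw d N lam δ r ≠ 0) :
    twoPoint d lam δ .wired R.bc₂ N r x.1 t - twoPoint d lam δ .free R.bc₁ N r x.1 t =
      (∫ p, srcWeight δ R r 0 (src (⟨0, zero_mem_box d N⟩, 0) + src (x, t)) (toPair p)
          ∂baseLaw d N lam δ r -
        ∫ p, srcWeight δ R r (src (⟨0, zero_mem_box d N⟩, 0) + src (x, t)) 0 (toPair p)
          ∂baseLaw d N lam δ r) /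
        ∫ p : Base d N, srcWeight δ R r 0 0 (toPair p) ∂baseLaw d N lam δ r := by
  obtain ⟨K, hK0, hK⟩ := exp_interaction_wired (d := d) (N := N) hlam hr
  rw [twoPoint_eq hδ hr .wired R.bc₂ (wiredLaw d N lam r) hK0 (ae_wiredLaw lam r) hK x ht,
    twoPoint_eq hδ hr .free R.bc₁ (freeLaw d N lam r) (by positivity) (ae_freeLaw lam r)
      (exp_interaction_free hlam hr) x ht]
  rw [integral_srcWeight hlam hδ hr R goodSource_zero goodSource_zero] at hZ ⊢
  rw [integral_srcWeight hlam hδ hr R goodSource_zero (goodSource_src_add _ _),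
    integral_srcWeight hlam hδ hr R (goodSource_src_add _ _) goodSource_zero]
  have h1 := left_ne_zero_of_mul hZ
  have h2 := right_ne_zero_of_mul hZ
  field_simp

end
end TFIM

namespace TFIM
noncomputable section
open scoped ENNReal
variable {d N : ℕ} {R : Regime} {r : ℝ} {ω ω' : Pair d N}

/-! ### Open paths -/

/-- On the circle, an arc from `s` to `t` and an arc from `t` to `u` together always cover one of
the two arcs from `s` to `u`. -/
lemma arcs_trans {A : Set ℝ} {s t u : ℝ} (hs : s ∈ timeI r) (hu : u ∈ timeI r)
    (h₁ : ∃ I ∈ arcs R r s t, I ⊆ A) (h₂ : ∃ I ∈ arcs R r t u, I ⊆ A) :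
    ∃ I ∈ arcs R r s u, I ⊆ A := by
  obtain ⟨I₁, hI₁, hA₁⟩ := h₁
  obtain ⟨I₂, hI₂, hA₂⟩ := h₂
  cases R
  -- Otherwise each arc from `s` to `u` has a point, `v` or `w`, outside both given arcs, and every
  -- relative order of `s`, `t`, `u` excludes this.
  · by_contra hcon
    push Not at hcon
    have c1 := hcon _ (Or.inl rfl)
    have c2 := hcon _ (Or.inr rfl)
    rw [Set.not_subset] at c1 c2
    obtain ⟨v, hv, hvA⟩ := c1
    obtain ⟨w, hw, hwA⟩ := c2
    have v1 : v ∉ I₁ := fun h => hvA (hA₁ h)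
    have v2 : v ∉ I₂ := fun h => hvA (hA₂ h)
    have w1 : w ∉ I₁ := fun h => hwA (hA₁ h)
    have w2 : w ∉ I₂ := fun h => hwA (hA₂ h)
    clear hvA hwA hA₁ hA₂ hcon
    simp only [timeI, mem_Icc] at hs hu
    rcases hI₁ with rfl | rfl <;> rcases hI₂ with rfl | rfl <;>
      rcases le_total s t with h1 | h1 <;> rcases le_total t u with h2 | h2 <;>
      rcases le_total s u with h3 | h3 <;>
      simp only [uIcc_of_le, uIcc_of_ge, min_eq_left, min_eq_right, max_eq_left, max_eq_right,
        h1, h2, h3, mem_union, mem_Icc, not_or, not_and, not_le] at hv hw v1 v2 w1 w2 <;>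
      grind
  · rw [show I₁ = uIcc s t from hI₁] at hA₁
    rw [show I₂ = uIcc t u from hI₂] at hA₂
    exact ⟨_, rfl, fun v hv => (uIcc_subset_uIcc_union_uIcc hv).elim (fun h => hA₁ h) fun h => hA₂ h⟩

lemma segment_trans {J : Set (Site d N × ℝ)} {p q z : Site d N × ℝ} (hp : p.2 ∈ timeI r)
    (hz : z.2 ∈ timeI r) (h₁ : Segment R r ω J p q) (h₂ : Segment R r ω J q z) :
    Segment R r ω J p z := by
  refine ⟨h₁.1.trans h₂.1, ?_⟩
  obtain ⟨I, hI, h⟩ := arcs_trans (A := {u | (p.1, u) ∈ J ∧ ¬ Blocked R r ω (p.1, u)}) hp hz h₁.2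
    (by obtain ⟨I, hI, h⟩ := h₂.2; exact ⟨I, hI, fun u hu => by rw [h₁.1]; exact h u hu⟩)
  exact ⟨I, hI, h⟩

lemma segment_refl {J : Set (Site d N × ℝ)} {p : Site d N × ℝ} (hp : p ∈ J)
    (hb : ¬ Blocked R r ω p) : Segment R r ω J p p := by
  refine ⟨rfl, uIcc p.2 p.2, uIcc_mem_arcs _ _, fun u hu => ?_⟩
  rw [uIcc_self, mem_singleton_iff] at hu
  rw [hu]
  exact ⟨hp, hb⟩

/-- Reachability by moves and jumps inside `J`. -/
def Reach (R : Regime) (r : ℝ) (ω : Pair d N) (J : Set (Site d N × ℝ)) :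
    Site d N × ℝ → Site d N × ℝ → Prop :=
  Relation.ReflTransGen (Step R r ω (blocked R r ω 0 0) J)

lemma OpenPath.append {J : Set (Site d N × ℝ)} {p z z₂ z' : Site d N × ℝ}
    (h : OpenPath R r ω J p z) (hj : Jump R r ω z z₂) (h' : OpenPath R r ω J z₂ z') :
    OpenPath R r ω J p z' := by
  induction h with
  | single h => exact .cons h hj h'
  | cons h hj' _ ih => exact .cons h hj' (ih hj)

/-- Reachability permits moves and jumps in any order, while an open path alternates. Consecutive
moves are merged by `segment_trans`, and a trivial move is placed between consecutive jumps. -/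
lemma openPath_of_reach {J : Set (Site d N × ℝ)} (hJ : ∀ p ∈ J, p.2 ∈ timeI r)
    {p q : Site d N × ℝ} (hp : p ∈ J) (hb : p ∉ blocked R r ω 0 0) (h : Reach R r ω J p q) :
    OpenPath R r ω J p q := by
  -- The induction keeps the starting point `w` of the current, still extendable, last segment.
  have key : ∃ w ∈ J, Segment R r ω J w q ∧ ∀ z, Segment R r ω J w z → OpenPath R r ω J p z := by
    induction h with
    | refl => exact ⟨p, hp, segment_refl hp hb, fun z hz => .single hz⟩
    | @tail z z' _ hs ih =>
      obtain ⟨w, hw, hwz, hcont⟩ := ih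
      rcases hs.1 with hseg | hjump
      · exact ⟨w, hw, segment_trans (hJ _ hw) (hJ _ hs.2.1) hwz hseg, hcont⟩
      · exact ⟨z', hs.2.1, segment_refl hs.2.1 hs.2.2, fun y hy =>
          (hcont z hwz).append hjump (.single hy)⟩
  obtain ⟨w, _, hwq, hcont⟩ := key
  exact hcont q hwq

/-- The two configurations differ only by the order of the points. -/
structure SameCounts (ω ω' : Pair d N) : Prop where
  B : ∀ e U, (ω'.B e).count U = (ω.B e).count U
  B' : ∀ e U, (ω'.B' e).count U = (ω.B' e).count U
  G : ∀ y U, (ω'.G y).count U = (ω.G y).count U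
  cuts : ∀ y U, (ω'.cuts y).count U = (ω.cuts y).count U
  coin : ω'.coin = ω.coin
  coin' : ω'.coin' = ω.coin'

namespace SameCounts

lemma S (h : SameCounts ω ω') : ω'.S = ω.S := by
  funext y U
  simp only [Pair.S, switchCount, h.B]

lemma S' (h : SameCounts ω ω') : ω'.S' = ω.S' := by
  funext y U
  simp only [Pair.S', switchCount, h.B', h.G]

lemma srcWeight_eq (h : SameCounts ω ω') (δ : ℝ) (R : Regime) (r : ℝ) (α β : Site d N → Set ℝ → ℕ) :
    srcWeight δ R r α β ω' = srcWeight δ R r α β ω := by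
  have h1 : ω'.T₁ α = ω.T₁ α := by funext y U; simp only [Pair.T₁, h.S]
  have h2 : ω'.T₂ β = ω.T₂ β := by funext y U; simp only [Pair.T₂, h.S']
  simp only [srcWeight, h1, h2, h.coin, h.coin']

lemma blocked_iff (h : SameCounts ω ω') (p : Site d N × ℝ) :
    Blocked R r ω' p ↔ Blocked R r ω p := by
  simp only [Blocked, points_eq_of_count (h.cuts p.1), Pair.Odd₁, Pair.Odd₂, h.S, h.S', h.coin, h.coin']

lemma jump_iff (h : SameCounts ω ω') (p q : Site d N × ℝ) : Jump R r ω' p q ↔ Jump R r ω p q :=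
  TFIM.jump_iff (fun e => by rw [points_eq_of_count (h.B e), points_eq_of_count (h.B' e)])
    (fun y => points_eq_of_count (h.G y)) p q

lemma segment_iff (h : SameCounts ω ω') (J : Set (Site d N × ℝ)) (p q : Site d N × ℝ) :
    Segment R r ω' J p q ↔ Segment R r ω J p q := by
  simp only [Segment, h.blocked_iff]

lemma openPath (h : SameCounts ω ω') {J : Set (Site d N × ℝ)} {p q : Site d N × ℝ}
    (hp : OpenPath R r ω J p q) : OpenPath R r ω' J p q := by
  induction hp with
  | single hs => exact .single ((h.segment_iff J _ _).2 hs)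
  | cons hs hj _ ih => exact .cons ((h.segment_iff J _ _).2 hs) ((h.jump_iff _ _).2 hj) ih

lemma mem_connGhost (h : SameCounts ω ω') (hω : ω ∈ connGhost d R N r) :
    ω' ∈ connGhost d R N r := by
  obtain ⟨q, hq, hp⟩ := hω
  refine ⟨q, ?_, h.openPath hp⟩
  have : ghost R r ω' q.1 = ghost R r ω q.1 := by
    cases R <;> simp [ghost, points_eq_of_count (h.G q.1)]
  rwa [this]

lemma mem_fullyConnected (h : SameCounts ω ω') {N₀ : ℕ} {r₀ : ℝ}
    (hω : ω ∈ fullyConnected d R N r N₀ r₀) : ω' ∈ fullyConnected d R N r N₀ r₀ :=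
  fun p hp q hq => h.openPath (hω p hp q hq)

end SameCounts

/-- Weights and connectivity depend on a configuration only through its counts and coins, so neither
depends on the order of the points. -/
lemma sameCounts_reorder (c : PConf (Mark d N × ℝ)) (k : Coins d N) (σ : Equiv.Perm (Fin c.1)) :
    SameCounts (toPair (c, k)) (toPair (c.reorder σ, k)) := by
  have : ∀ m U, (component (c.reorder σ) m).count U = (component c m).count U := fun m U => by
    rw [component_count, component_count]
    exact PConf.cnt_congr_perm (PConf.toList_reorder_perm c σ) _
  exact ⟨fun e U => this _ U, fun e U => this _ U, fun e U => this _ U, fun e U => this _ U,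
    rfl, rfl⟩

/-! ### Connectivity of boxes -/

/-- The inclusion of the sites of a smaller box. -/
def liftSite {N₀ : ℕ} (h : N₀ ≤ N) (x : Site d N₀) : Site d N := ⟨x.1, box_mono h x.2⟩

/-- The inclusion of the edges of a smaller box. -/
def liftEdge {N₀ : ℕ} (h : N₀ ≤ N) (e : Edge d N₀) : Edge d N :=
  ⟨e.1, mem_edges.2 ⟨⟨box_mono h (mem_edges.1 e.2).1.1, box_mono h (mem_edges.1 e.2).1.2⟩,
    (mem_edges.1 e.2).2⟩⟩

lemma liftEdge_injective {N₀ : ℕ} (h : N₀ ≤ N) : Function.Injective (liftEdge (d := d) h) := by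
  intro a b hab
  rw [liftEdge, liftEdge, Subtype.mk.injEq] at hab
  exact Subtype.ext hab

lemma liftSite_injective {N₀ : ℕ} (h : N₀ ≤ N) : Function.Injective (liftSite (d := d) h) := by
  intro a b hab
  exact Subtype.ext (show a.1 = b.1 from congrArg (fun s : Site d N => s.1) hab)

lemma exists_edge {x y : Site d N} (h : Nbr x.1 y.1) :
    ∃ e : Edge d N, (x = edgeFst e ∧ y = edgeSnd e) ∨ (y = edgeFst e ∧ x = edgeSnd e) := by
  rcases h.lt_or_lt with hl | hl
  · exact ⟨⟨(x.1, y.1), mem_edges.2 ⟨⟨x.2, y.2⟩, hl, h⟩⟩, Or.inl ⟨rfl, rfl⟩⟩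
  · exact ⟨⟨(y.1, x.1), mem_edges.2 ⟨⟨y.2, x.2⟩, hl, h.symm⟩⟩, Or.inr ⟨rfl, rfl⟩⟩

/-- The box is connected. -/
lemma box_induction {P : Site d N → Prop} (h0 : P ⟨0, zero_mem_box d N⟩)
    (hstep : ∀ x y : Site d N, Nbr x.1 y.1 → P x → P y) (x : Site d N) : P x := by
  induction hn : ∑ i, (x.1 i).natAbs generalizing x with
  | zero =>
    have : x = ⟨0, zero_mem_box d N⟩ := by
      ext i
      have := (Finset.sum_eq_zero_iff.1 hn) i (Finset.mem_univ i)
      simpa using this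
    rwa [this]
  | succ n ih =>
    have : ∃ i, x.1 i ≠ 0 := by
      by_contra hcon
      push Not at hcon
      simp [hcon] at hn
    obtain ⟨i, hi⟩ := this
    -- A neighbour one step closer to the origin along a nonzero coordinate, hence still in the box.
    set y : Lattice d := Function.update x.1 i (x.1 i - (x.1 i).sign) with hy
    have hyi : y i = x.1 i - (x.1 i).sign := by simp [hy]
    have hyj : ∀ j, j ≠ i → y j = x.1 j := fun j hj => by simp [hy, hj]
    have hsign : ((x.1 i).sign = 1 ∧ 0 < x.1 i) ∨ ((x.1 i).sign = -1 ∧ x.1 i < 0) := by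
      rcases lt_or_gt_of_ne hi with h | h
      · exact Or.inr ⟨Int.sign_eq_neg_one_of_neg h, h⟩
      · exact Or.inl ⟨Int.sign_eq_one_of_pos h, h⟩
    have hxb := x.2
    simp only [box, Fintype.mem_piFinset, Finset.mem_Icc] at hxb
    have hyb : y ∈ box d N := by
      simp only [box, Fintype.mem_piFinset, Finset.mem_Icc]
      intro j
      by_cases hj : j = i
      · subst hj
        have := hxb j
        rw [hyi]; omega
      · rw [hyj j hj]; exact hxb j
    refine hstep ⟨y, hyb⟩ x ?_ (ih ⟨y, hyb⟩ ?_)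
    · change ∑ j, |y j - x.1 j| = 1
      rw [Finset.sum_eq_single i]
      · rw [hyi]
        rcases hsign with h | h <;> rw [h.1] <;> simp
      · intro j _ hj
        rw [hyj j hj]; simp
      · simp
    · change ∑ j, (y j).natAbs = n
      rw [← Finset.add_sum_erase _ _ (Finset.mem_univ i)] at hn ⊢
      rw [Finset.sum_congr rfl fun j hj => by rw [hyj j (Finset.ne_of_mem_erase hj)], hyi]
      omega

/-- There is a set of edges whose odd vertices are `0` and `x`. -/
lemma exists_edge_set (x : Site d N) : ∃ J : Edge d N → ℕ, ∀ y : Site d N,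
    Even ((∑ e : Edge d N, if e.1.1 = y.1 ∨ e.1.2 = y.1 then J e else 0) +
      ((if y.1 = 0 then 1 else 0) + if y = x then 1 else 0)) := by
  classical
  refine box_induction (P := fun x => ∃ J : Edge d N → ℕ, ∀ y : Site d N,
    Even ((∑ e : Edge d N, if e.1.1 = y.1 ∨ e.1.2 = y.1 then J e else 0) +
      ((if y.1 = 0 then 1 else 0) + if y = x then 1 else 0))) ⟨fun _ => 0, fun y => ?_⟩ ?_ x
  · by_cases h : y.1 = 0
    · have : y = ⟨0, zero_mem_box d N⟩ := Subtype.ext h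
      simp [this]
    · have : y ≠ ⟨0, zero_mem_box d N⟩ := fun h' => h (congrArg Subtype.val h')
      simp [this, h]
  · rintro x z hn ⟨J, hJ⟩
    obtain ⟨f, hf⟩ := exists_edge hn
    -- Adding the edge from `x` to `z` changes the degree parity at these two sites only, so the odd
    -- end moves from `x` to `z`.
    refine ⟨fun e => J e + if e = f then 1 else 0, fun y => ?_⟩
    have h1 : ∀ e : Edge d N, (if e.1.1 = y.1 ∨ e.1.2 = y.1 then J e + (if e = f then 1 else 0) else 0)
        = (if e.1.1 = y.1 ∨ e.1.2 = y.1 then J e else 0) +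
          if e = f then (if f.1.1 = y.1 ∨ f.1.2 = y.1 then 1 else 0) else 0 := by
      intro e
      by_cases he : e = f
      · subst he; split_ifs <;> rfl
      · simp [he]
    simp only [h1, Finset.sum_add_distrib, Finset.sum_ite_eq', Finset.mem_univ, if_true]
    have h2 := hJ y
    have hne : x ≠ z := fun h => hn.ne (congrArg Subtype.val h)
    have h3 : (if f.1.1 = y.1 ∨ f.1.2 = y.1 then 1 else 0) =
        (if y = x then 1 else 0) + (if y = z then 1 else 0 : ℕ) := by
      rw [if_congr (incident_iff f y) rfl rfl]
      have hxz : y = x → ¬ y = z := fun h h' => hne (h.symm.trans h')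
      rcases hf with ⟨ha, hb⟩ | ⟨ha, hb⟩ <;> rw [← ha, ← hb] <;> split_ifs <;>
        first | rfl | (exfalso; tauto)
    rw [h3]
    rw [Nat.even_iff] at h2 ⊢
    omega

end
end TFIM

namespace TFIM
noncomputable section
open scoped ENNReal
variable {d N N₀ : ℕ} {R : Regime} {r r₀ : ℝ} {ω ω' : Pair d N} {β : Site d N → Set ℝ → ℕ}

/-! ### Modifying a configuration in a box: deterministic part -/

/-- Two counting functions which agree outside `I_{r₀}` and have the same parity on it. -/
structure LineAgree (r₀ : ℝ) (S S' : Set ℝ → ℕ) : Prop where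
  add : Additive S
  add' : Additive S'
  far : ∀ V, Disjoint V (timeI r₀) → S' V = S V
  even : Even (S (timeI r₀) + S' (timeI r₀))

lemma odd_add_congr {m a b : ℕ} (h : Even (a + b)) : Odd (m + a) ↔ Odd (m + b) := by
  rw [Nat.even_iff] at h
  rw [Nat.odd_iff, Nat.odd_iff]
  omega

namespace LineAgree
variable {S S' : Set ℝ → ℕ}

lemma even_of_superset (h : LineAgree r₀ S S') {V : Set ℝ} (hV : timeI r₀ ⊆ V) :
    Even (S V + S' V) := by
  have h1 := h.add V (timeI r₀)
  have h2 := h.add' V (timeI r₀)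
  rw [inter_eq_right.2 hV] at h1 h2
  have h3 := h.far (V \ timeI r₀) disjoint_sdiff_left
  have h4 := h.even
  rw [Nat.even_iff] at h4 ⊢
  omega

lemma even_iff (h : LineAgree r₀ S S') (hr : r₀ ≤ r) : Even (S (timeI r)) ↔ Even (S' (timeI r)) := by
  have hsub : timeI r₀ ⊆ timeI r := Icc_subset_Icc (by linarith) (by linarith)
  exact Nat.even_add.1 (h.even_of_superset hsub)

/-- Below `I_{r₀}` no switch has changed, and above it the total change is even. Periodic conditions
are excluded because there the label is fixed at height `0`, inside the changed part; in the thermal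
regime the box fills whole lines and this lemma is not needed. -/
lemma isOdd_iff (h : LineAgree r₀ S S') (hr : r₀ ≤ r) {b : TemporalBC}
    (hb : b ≠ .periodic) (k : Bool) {t : ℝ} (ht : t ∉ timeI r₀) :
    IsOdd b r k S' t ↔ IsOdd b r k S t := by
  have hstart : startParity b r k S' = startParity b r k S := by
    cases b
    · rfl
    · rfl
    · exact absurd rfl hb
  unfold IsOdd
  rw [hstart]
  by_cases hlt : t < -r₀ / 2
  · rw [h.far (Ico (-r / 2) t), h.far (Icc (-r / 2) t)]
    · exact Set.disjoint_left.2 fun u hu hu' => absurd (hu.2.trans_lt hlt) (not_lt.2 hu'.1)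
    · exact Set.disjoint_left.2 fun u hu hu' => absurd (hu.2.trans hlt) (not_lt.2 hu'.1)
  · have hgt : r₀ / 2 < t := by
      by_contra hc
      exact ht ⟨not_lt.1 hlt, not_lt.1 hc⟩
    have s1 : timeI r₀ ⊆ Ico (-r / 2) t := fun u hu => ⟨by linarith [hu.1], hu.2.trans_lt hgt⟩
    have s2 : timeI r₀ ⊆ Icc (-r / 2) t := s1.trans Ico_subset_Icc_self
    rw [odd_add_congr (h.even_of_superset s1), odd_add_congr (h.even_of_superset s2)]

end LineAgree

/-- `ω'` arises from `ω` by changing the bridges and cuts inside `K(N₀, r₀)`; there are no cuts left,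
each edge carries a bridge, and the parities of the numbers of bridges change according to `J`. -/
structure Resample (h : N₀ ≤ N) (r₀ : ℝ) (J : Edge d N₀ → ℕ) (ω ω' : Pair d N) : Prop where
  coin : ω'.coin = ω.coin
  coin' : ω'.coin' = ω.coin'
  G : ∀ y U, (ω'.G y).count U = (ω.G y).count U
  B_out : ∀ e, (∀ f, liftEdge h f ≠ e) → ∀ U, (ω'.B e).count U = (ω.B e).count U
  B'_out : ∀ e, (∀ f, liftEdge h f ≠ e) → ∀ U, (ω'.B' e).count U = (ω.B' e).count U
  B_far : ∀ e U, Disjoint U (timeI r₀) → (ω'.B e).count U = (ω.B e).count U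
  B'_far : ∀ e U, Disjoint U (timeI r₀) → (ω'.B' e).count U = (ω.B' e).count U
  cuts_out : ∀ y, y.1 ∉ box d N₀ → ∀ U, (ω'.cuts y).count U = (ω.cuts y).count U
  cuts_far : ∀ y U, Disjoint U (timeI r₀) → (ω'.cuts y).count U = (ω.cuts y).count U
  cuts_in : ∀ y, y.1 ∈ box d N₀ → (ω'.cuts y).count (timeI r₀) = 0
  B_in : ∀ f, Even ((ω.B (liftEdge h f)).count (timeI r₀) + (ω'.B (liftEdge h f)).count (timeI r₀))
  B'_in : ∀ f, Even ((ω.B' (liftEdge h f)).count (timeI r₀) +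
    (ω'.B' (liftEdge h f)).count (timeI r₀) + J f)
  B_pos : ∀ f, (ω'.B (liftEdge h f)).count (timeI r₀) ≠ 0

/-- Sources `β` inside `K(N₀, r₀)` which are compensated by the edge set `J`. -/
structure Compensates (N : ℕ) (r₀ : ℝ) (J : Edge d N₀ → ℕ) (β : Site d N → Set ℝ → ℕ) : Prop where
  add : ∀ y, Additive (β y)
  out : ∀ y U, y.1 ∉ box d N₀ → β y U = 0
  far : ∀ y U, Disjoint U (timeI r₀) → β y U = 0
  even : ∀ y : Site d N, y.1 ∈ box d N₀ →
    Even ((∑ f : Edge d N₀, if f.1.1 = y.1 ∨ f.1.2 = y.1 then J f else 0) + β y (timeI r₀))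

lemma not_lift_of_out {h : N₀ ≤ N} {y : Site d N} (hy : y.1 ∉ box d N₀) {e : Edge d N}
    (he : e.1.1 = y.1 ∨ e.1.2 = y.1) (f : Edge d N₀) : liftEdge h f ≠ e := by
  rintro rfl
  rcases he with he | he
  · exact hy (he ▸ (mem_edges.1 f.2).1.1)
  · exact hy (he ▸ (mem_edges.1 f.2).1.2)

namespace Resample
variable {h : N₀ ≤ N} {J : Edge d N₀ → ℕ}

lemma S_out (hω : Resample h r₀ J ω ω') {y : Site d N} (hy : y.1 ∉ box d N₀) (U : Set ℝ) :
    ω'.S y U = ω.S y U := by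
  simp only [Pair.S, switchCount]
  congr 1
  refine Finset.sum_congr rfl fun e _ => ?_
  split_ifs with he
  · exact hω.B_out e (not_lift_of_out hy he) U
  · rfl

lemma S'_out (hω : Resample h r₀ J ω ω') {y : Site d N} (hy : y.1 ∉ box d N₀) (U : Set ℝ) :
    ω'.S' y U = ω.S' y U := by
  simp only [Pair.S', switchCount, hω.G]
  congr 1
  refine Finset.sum_congr rfl fun e _ => ?_
  split_ifs with he
  · exact hω.B'_out e (not_lift_of_out hy he) U
  · rfl

lemma lineAgree₁ (hω : Resample h r₀ J ω ω') (y : Site d N) :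
    LineAgree r₀ (ω.T₁ 0 y) (ω'.T₁ 0 y) := by
  have hz : Additive (fun _ : Set ℝ => 0) := fun _ _ => rfl
  refine ⟨(switchCount_additive _ _ y).add hz, (switchCount_additive _ _ y).add hz, ?_, ?_⟩
  · intro V hV
    simp only [Pair.T₁, Pair.S, switchCount]
    congr 2
    refine Finset.sum_congr rfl fun e _ => ?_
    rw [hω.B_far e V hV]
  · simp only [Pair.T₁, Pair.S, switchCount, config_empty_count, Pi.zero_apply, add_zero]
    rw [← Finset.sum_add_distrib]
    refine Finset.even_sum _ fun e _ => ?_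
    split_ifs
    · by_cases he : ∃ f, liftEdge h f = e
      · obtain ⟨f, rfl⟩ := he
        exact hω.B_in f
      · push Not at he
        rw [hω.B_out e he]
        exact ⟨_, rfl⟩
    · exact ⟨0, rfl⟩

/-- On a line of the box, removing the sources changes the parity of the count exactly as the parity
shifts `J` of the incident edges do, by the compensation condition. -/
lemma lineAgree₂ (hω : Resample h r₀ J ω ω') (hβ : Compensates N r₀ J β) {y : Site d N}
    (hy : y.1 ∈ box d N₀) : LineAgree r₀ (ω.T₂ β y) (ω'.T₂ 0 y) := by
  classical
  have hz : Additive (fun _ : Set ℝ => 0) := fun _ _ => rfl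
  refine ⟨(switchCount_additive _ _ y).add (hβ.add y), (switchCount_additive _ _ y).add hz, ?_, ?_⟩
  · intro V hV
    simp only [Pair.T₂, Pair.S', switchCount, hω.G, hβ.far y V hV]
    congr 2
    refine Finset.sum_congr rfl fun e _ => ?_
    rw [hω.B'_far e V hV]
  -- The shifts are indexed by the edges of the small box; extended by zero to all edges, they have
  -- the same sum at `y`.
  · have h1 : (∑ e : Edge d N, if e.1.1 = y.1 ∨ e.1.2 = y.1 then
        (∑ f, if liftEdge h f = e then J f else 0) else 0) =
        ∑ f : Edge d N₀, if f.1.1 = y.1 ∨ f.1.2 = y.1 then J f else 0 := by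
      have : ∀ e : Edge d N, (if e.1.1 = y.1 ∨ e.1.2 = y.1 then
        (∑ f, if liftEdge h f = e then J f else 0) else 0) =
        ∑ f, if liftEdge h f = e then (if f.1.1 = y.1 ∨ f.1.2 = y.1 then J f else 0) else 0 := by
        intro e
        split_ifs with he
        · refine Finset.sum_congr rfl fun f _ => ?_
          by_cases hf : liftEdge h f = e
          · rw [if_pos hf, if_pos hf, if_pos]; rw [← hf] at he; exact he
          · rw [if_neg hf, if_neg hf]
        · symm
          refine Finset.sum_eq_zero fun f _ => ?_
          by_cases hf : liftEdge h f = e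
          · rw [if_pos hf, if_neg]; rw [← hf] at he; exact he
          · rw [if_neg hf]
      simp only [this]
      rw [Finset.sum_comm]
      simp
    have h2 : Even ((∑ e : Edge d N, if e.1.1 = y.1 ∨ e.1.2 = y.1 then
          (ω.B' e).count (timeI r₀) else 0) +
        (∑ e : Edge d N, if e.1.1 = y.1 ∨ e.1.2 = y.1 then (ω'.B' e).count (timeI r₀) else 0) +
        ∑ e : Edge d N, if e.1.1 = y.1 ∨ e.1.2 = y.1 then
          (∑ f, if liftEdge h f = e then J f else 0) else 0) := by
      rw [← Finset.sum_add_distrib, ← Finset.sum_add_distrib]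
      refine Finset.even_sum _ fun e _ => ?_
      split_ifs
      · by_cases he : ∃ f, liftEdge h f = e
        · obtain ⟨f, rfl⟩ := he
          have := hω.B'_in f
          simpa [(liftEdge_injective h).eq_iff] using this
        · push Not at he
          rw [hω.B'_out e he]
          simp [he]
      · exact ⟨0, rfl⟩
    have h3 := hβ.even y hy
    rw [h1] at h2
    simp only [Pair.T₂, Pair.S', switchCount, hω.G, Pi.zero_apply]
    rw [Nat.even_iff] at h2 h3 ⊢
    omega

lemma T₂_out (hω : Resample h r₀ J ω ω') (hβ : Compensates N r₀ J β) {y : Site d N}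
    (hy : y.1 ∉ box d N₀) : ω'.T₂ 0 y = ω.T₂ β y := by
  funext U
  simp only [Pair.T₂, hω.S'_out hy, hβ.out y U hy, Pi.zero_apply]

lemma T₁_out (hω : Resample h r₀ J ω ω') {y : Site d N}
    (hy : y.1 ∉ box d N₀) : ω'.T₁ 0 y = ω.T₁ 0 y := by
  funext U
  simp only [Pair.T₁, hω.S_out hy]

/-- Outside the box the labels agree. -/
lemma labels (hω : Resample h r₀ J ω ω') (hβ : Compensates N r₀ J β)
    (hR : (R = .thermal ∧ r₀ = r) ∨ (R = .ground ∧ r₀ ≤ r)) {p : Site d N × ℝ}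
    (hp : p ∈ subBox N N r) (hp' : p ∉ subBox N N₀ r₀) :
    (IsOdd R.bc₁ r (ω'.coin p.1) (ω'.T₁ 0 p.1) p.2 ↔ IsOdd R.bc₁ r (ω.coin p.1) (ω.T₁ 0 p.1) p.2) ∧
    (IsOdd R.bc₂ r (ω'.coin' p.1) (ω'.T₂ 0 p.1) p.2 ↔
      IsOdd R.bc₂ r (ω.coin' p.1) (ω.T₂ β p.1) p.2) := by
  rw [hω.coin, hω.coin']
  by_cases hy : p.1.1 ∈ box d N₀
  · have ht : p.2 ∉ timeI r₀ := fun h => hp' ⟨hy, h⟩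
    rcases hR with ⟨rfl, rfl⟩ | ⟨rfl, hlt⟩
    · exact absurd hp.2 ht
    · exact ⟨(hω.lineAgree₁ p.1).isOdd_iff hlt (by simp [Regime.bc₁]) _ ht,
        (hω.lineAgree₂ hβ hy).isOdd_iff hlt (by simp [Regime.bc₂]) _ ht⟩
  · rw [hω.T₁_out hy, hω.T₂_out hβ hy]
    exact ⟨Iff.rfl, Iff.rfl⟩

lemma cuts_points (hω : Resample h r₀ J ω ω') {p : Site d N × ℝ} (hp' : p ∉ subBox N N₀ r₀) :
    p.2 ∈ (ω'.cuts p.1).points ↔ p.2 ∈ (ω.cuts p.1).points := by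
  rw [Config.mem_points_iff, Config.mem_points_iff]
  by_cases hy : p.1.1 ∈ box d N₀
  · rw [hω.cuts_far _ _ (Set.disjoint_singleton_left.2 fun h => hp' ⟨hy, h⟩)]
  · rw [hω.cuts_out _ hy]

lemma blocked_iff (hω : Resample h r₀ J ω ω') (hβ : Compensates N r₀ J β)
    (hR : (R = .thermal ∧ r₀ = r) ∨ (R = .ground ∧ r₀ ≤ r)) {p : Site d N × ℝ}
    (hp : p ∈ subBox N N r) (hp' : p ∉ subBox N N₀ r₀) :
    p ∈ blocked R r ω' 0 0 ↔ p ∈ blocked R r ω 0 β := by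
  have hl := hω.labels hβ hR hp hp'
  simp only [blocked, mem_ofPred_eq, hω.cuts_points hp', hl.1, hl.2]

lemma not_blocked (hω : Resample h r₀ J ω ω') {p : Site d N × ℝ} (hp : p ∈ subBox N N₀ r₀) :
    p ∉ blocked R r ω' 0 0 := by
  intro hb
  have h1 := (Config.mem_points_iff _ _).1 hb.1
  have h2 := (ω'.cuts p.1).count_additive.mono (singleton_subset_iff.2 hp.2)
  rw [hω.cuts_in _ hp.1] at h2
  omega

/-- Inside the box every two points are connected. -/
lemma reach (hω : Resample h r₀ J ω ω') {p q : Site d N × ℝ} (hp : p ∈ subBox N N₀ r₀)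
    (hq : q ∈ subBox N N₀ r₀) : Reach R r ω' (subBox N N₀ r₀) p q := by
  have hline : ∀ (y : Site d N) (s t : ℝ), y.1 ∈ box d N₀ → s ∈ timeI r₀ → t ∈ timeI r₀ →
      Reach R r ω' (subBox N N₀ r₀) (y, s) (y, t) := by
    intro y s t hy hs ht
    refine Relation.ReflTransGen.single ⟨Or.inl ⟨rfl, _, uIcc_mem_arcs _ _, fun u hu => ?_⟩,
      ⟨hy, ht⟩, hω.not_blocked ⟨hy, ht⟩⟩
    have hu : u ∈ timeI r₀ := (uIcc_subset_Icc hs ht : uIcc s t ⊆ timeI r₀) hu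
    exact ⟨⟨hy, hu⟩, hω.not_blocked ⟨hy, hu⟩⟩
  have key : ∀ y : Site d N₀, ∀ t ∈ timeI r₀, ∀ s ∈ timeI r₀,
      Reach R r ω' (subBox N N₀ r₀) (⟨0, zero_mem_box d N⟩, s) (liftSite h y, t) ∧
      Reach R r ω' (subBox N N₀ r₀) (liftSite h y, t) (⟨0, zero_mem_box d N⟩, s) := by
    refine box_induction ?_ ?_
    · intro t ht s hs
      exact ⟨hline _ _ _ (zero_mem_box d N₀) hs ht, hline _ _ _ (zero_mem_box d N₀) ht hs⟩
    · intro x y hn ih t ht s hs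
      obtain ⟨f, hf⟩ := exists_edge hn
      have hpos := hω.B_pos f
      have : ∃ u ∈ timeI r₀, u ∈ (ω'.B (liftEdge h f)).points := by
        by_contra hcon
        push Not at hcon
        exact hpos (Config.count_eq_zero _ fun u hu hu' => hcon u hu' hu)
      obtain ⟨u, hu, hup⟩ := this
      have hjump : Jump R r ω' (liftSite h x, u) (liftSite h y, u) ∧
          Jump R r ω' (liftSite h y, u) (liftSite h x, u) := by
        rcases hf with ⟨ha, hb⟩ | ⟨ha, hb⟩ <;> subst ha <;> subst hb
        · exact ⟨Or.inl ⟨rfl, liftEdge h f, Or.inl rfl, Or.inl hup⟩,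
            Or.inl ⟨rfl, liftEdge h f, Or.inr rfl, Or.inl hup⟩⟩
        · exact ⟨Or.inl ⟨rfl, liftEdge h f, Or.inr rfl, Or.inl hup⟩,
            Or.inl ⟨rfl, liftEdge h f, Or.inl rfl, Or.inl hup⟩⟩
      have hx : (liftSite h x, u) ∈ subBox N N₀ r₀ := ⟨x.2, hu⟩
      have hy : (liftSite h y, u) ∈ subBox N N₀ r₀ := ⟨y.2, hu⟩
      constructor
      · exact ((ih u hu s hs).1.tail ⟨Or.inr hjump.1, hy, hω.not_blocked hy⟩).trans
          (hline _ _ _ y.2 hu ht)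
      · exact ((hline _ _ _ y.2 ht hu).tail ⟨Or.inr hjump.2, hx, hω.not_blocked hx⟩).trans
          (ih u hu s hs).2
  have h1 := (key ⟨p.1.1, hp.1⟩ p.2 hp.2 p.2 hp.2).2
  have h2 := (key ⟨q.1.1, hq.1⟩ q.2 hq.2 p.2 hp.2).1
  exact h1.trans h2

lemma mem_fullyConnected (hω : Resample h r₀ J ω ω') (hr : r₀ ≤ r) :
    ω' ∈ fullyConnected d R N r N₀ r₀ := by
  intro p hp q hq
  refine openPath_of_reach (fun p hp => ?_) hp (hω.not_blocked hp) (hω.reach hp hq)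
  exact ⟨by linarith [hp.2.1], by linarith [hp.2.2]⟩

lemma subBox_subset (hr : r₀ ≤ r) : subBox (d := d) N N₀ r₀ ⊆ subBox N N r := fun p hp =>
  mem_subBox_iff.2 ⟨by linarith [hp.2.1], by linarith [hp.2.2]⟩

/-- Every point reached before the modification is reached after it. -/
lemma reach_of_cluster (hω : Resample h r₀ J ω ω') (hβ : Compensates N r₀ J β) (h0 : 0 ≤ r₀)
    (hR : (R = .thermal ∧ r₀ = r) ∨ (R = .ground ∧ r₀ ≤ r)) {o p : Site d N × ℝ}
    (ho : o ∈ subBox N N₀ r₀) (hp : p ∈ cluster R r ω 0 β o) :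
    Reach R r ω' (subBox N N r) o p := by
  have hr : r₀ ≤ r := by rcases hR with ⟨_, h⟩ | ⟨_, h⟩ <;> linarith
  have hin : ∀ q ∈ subBox N N₀ r₀, Reach R r ω' (subBox N N r) o q := by
    intro q hq
    refine Relation.ReflTransGen.mono ?_ _ _ (hω.reach (R := R) (r := r) ho hq)
    rintro a b ⟨hs, hb, hbb⟩
    refine ⟨hs.imp (fun hs => ⟨hs.1, ?_⟩) id, subBox_subset hr hb, hbb⟩
    obtain ⟨I, hI, hh⟩ := hs.2
    exact ⟨I, hI, fun u hu => ⟨subBox_subset hr (hh u hu).1, (hh u hu).2⟩⟩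
  induction hp with
  | refl => exact hin o ho
  | @tail p q _ hs ih =>
    by_cases hq : q ∈ subBox N N₀ r₀
    · exact hin q hq
    have hqb : q ∉ blocked R r ω' 0 0 := fun hb => hs.2.2 ((hω.blocked_iff hβ hR hs.2.1 hq).1 hb)
    rcases hs.1 with hseg | hjump
    · by_cases hy : q.1.1 ∈ box d N₀
      · have ht : q.2 ∉ timeI r₀ := fun h => hq ⟨hy, h⟩
        rcases hR with ⟨rfl, rfl⟩ | ⟨rfl, hlt⟩
        · exact absurd hs.2.1.2 ht
        obtain ⟨hpq, I, hI, hfree⟩ := hseg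
        rw [show I = uIcc p.2 q.2 from hI] at hfree
        have hfree' : ∀ u ∈ uIcc p.2 q.2, (q.1, u) ∈ subBox N N r ∧
            (u ∉ timeI r₀ → (q.1, u) ∉ blocked .ground r ω' 0 0) := by
          intro u hu
          have := hfree u hu
          rw [hpq] at this
          exact ⟨this.1, fun hu' hb => this.2
            ((hω.blocked_iff hβ (Or.inr ⟨rfl, hlt⟩) this.1 fun h => hu' h.2).1 hb)⟩
        -- A vertical move ending at `q` outside the box may have crossed the box. It is replaced by
        -- its last part: from the end of `I_{r₀}` closer to `q`, which is reachable because the box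
        -- is fully connected, or from `p` itself if `p` lies on the same side as `q`.
        have hgo : ∀ v, Reach .ground r ω' (subBox N N r) o (q.1, v) →
            (∀ u ∈ uIcc v q.2, u ∈ uIcc p.2 q.2) → 
            Reach .ground r ω' (subBox N N r) o q := by
          intro v hv hsub
          refine hv.tail ⟨Or.inl ⟨rfl, _, uIcc_mem_arcs _ _, fun u hu => ?_⟩, hs.2.1, hqb⟩
          refine ⟨(hfree' u (hsub u hu)).1, ?_⟩
          by_cases hu0 : u ∈ timeI r₀
          · exact hω.not_blocked ⟨hy, hu0⟩
          · exact (hfree' u (hsub u hu)).2 hu0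
        by_cases hgt : r₀ / 2 < q.2
        · by_cases hpl : p.2 ≤ r₀ / 2
          · refine hgo (r₀ / 2) (hin _ ⟨hy, ⟨by linarith, le_rfl⟩⟩) fun u hu => ?_
            rw [uIcc_of_le hgt.le] at hu
            rw [uIcc_of_le (hpl.trans hgt.le)]
            exact ⟨hpl.trans hu.1, hu.2⟩
          · refine hgo p.2 (by rw [← hpq]; exact ih) fun u hu => hu
        · have hlt' : q.2 < -r₀ / 2 := by
            by_contra hc
            exact ht ⟨not_lt.1 hc, not_lt.1 hgt⟩
          by_cases hpl : -r₀ / 2 ≤ p.2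
          · refine hgo (-r₀ / 2) (hin _ ⟨hy, ⟨le_rfl, by linarith⟩⟩) fun u hu => ?_
            rw [uIcc_of_ge hlt'.le] at hu
            rw [uIcc_of_ge (hlt'.le.trans hpl)]
            exact ⟨hu.1, hu.2.trans hpl⟩
          · refine hgo p.2 (by rw [← hpq]; exact ih) fun u hu => hu
      · refine ih.tail ⟨Or.inl ⟨hseg.1, ?_⟩, hs.2.1, hqb⟩
        obtain ⟨I, hI, hfree⟩ := hseg.2
        refine ⟨I, hI, fun u hu => ⟨(hfree u hu).1, fun hb => (hfree u hu).2 ?_⟩⟩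
        refine (hω.blocked_iff hβ hR (hfree u hu).1 fun h => hy ?_).1 hb
        rw [← hseg.1]; exact h.1
    · refine ih.tail ⟨Or.inr ?_, hs.2.1, hqb⟩
      rcases hjump with ⟨ht, e, he, hmem⟩ | ⟨hg1, hg2⟩
      · refine Or.inl ⟨ht, e, he, ?_⟩
        -- Only bridges of the small box at times in `I_{r₀}` were changed, and both endpoints of
        -- such a bridge lie in the box, contrary to the choice of `q`.
        have hcase : (∀ f, liftEdge h f ≠ e) ∨ p.2 ∉ timeI r₀ := by
          by_contra hcon
          push Not at hcon
          obtain ⟨⟨f, hf⟩, hpt⟩ := hcon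
          refine hq ⟨?_, ht ▸ hpt⟩
          have hf1 := (mem_edges.1 f.2).1
          have hfe : f.1 = e.1 := by rw [← hf, liftEdge]
          rw [hfe] at hf1
          rcases he with he | he
          · rw [he] at hf1; exact hf1.2
          · rw [he] at hf1; exact hf1.1
        have e1 : (ω'.B e).count {p.2} = (ω.B e).count {p.2} := by
          rcases hcase with hc | hc
          · exact hω.B_out e hc _
          · exact hω.B_far e _ (Set.disjoint_singleton_left.2 hc)
        have e2 : (ω'.B' e).count {p.2} = (ω.B' e).count {p.2} := by
          rcases hcase with hc | hc
          · exact hω.B'_out e hc _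
          · exact hω.B'_far e _ (Set.disjoint_singleton_left.2 hc)
        rcases hmem with hm | hm
        · exact Or.inl ((Config.mem_points_iff _ _).2 (e1 ▸ (Config.mem_points_iff _ _).1 hm))
        · exact Or.inr ((Config.mem_points_iff _ _).2 (e2 ▸ (Config.mem_points_iff _ _).1 hm))
      · have hg : ∀ y, ghost R r ω' y = ghost R r ω y := fun y => by
          cases R <;> simp [ghost, points_eq_of_count (hω.G y)]
        exact Or.inr ⟨by rw [hg]; exact hg1, by rw [hg]; exact hg2⟩

lemma mem_connGhost (hω : Resample h r₀ J ω ω') (hβ : Compensates N r₀ J β) (h0 : 0 ≤ r₀)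
    (hR : (R = .thermal ∧ r₀ = r) ∨ (R = .ground ∧ r₀ ≤ r))
    (hz : ∃ z ∈ cluster R r ω 0 β (⟨0, zero_mem_box d N⟩, 0), z.2 ∈ ghost R r ω z.1) :
    ω' ∈ connGhost d R N r := by
  have hr : r₀ ≤ r := by rcases hR with ⟨_, h⟩ | ⟨_, h⟩ <;> linarith
  obtain ⟨z, hz, hzg⟩ := hz
  have ho : ((⟨0, zero_mem_box d N⟩, 0) : Site d N × ℝ) ∈ subBox N N₀ r₀ :=
    ⟨zero_mem_box d N₀, ⟨by change -r₀ / 2 ≤ 0; linarith, by change 0 ≤ r₀ / 2; linarith⟩⟩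
  refine ⟨z, ?_, openPath_of_reach (fun p hp => hp.2) (subBox_subset hr ho) (hω.not_blocked ho)
    (hω.reach_of_cluster hβ h0 hR ho hz)⟩
  have hg : ghost R r ω' z.1 = ghost R r ω z.1 := by
    cases R <;> simp [ghost, points_eq_of_count (hω.G z.1)]
  rwa [hg]

end Resample

/-- The even sets can differ only inside the box, whose lines have total length `(box d N₀).card *
r₀`. -/
lemma weight_le_of_agree {δ : ℝ} (hδ : 0 ≤ δ) (h0 : 0 ≤ r₀) (b : TemporalBC) (k : Site d N → Bool)
    {S S' : Site d N → Set ℝ → ℕ} (hc : Consistent b r S → Consistent b r S')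
    (hodd : ∀ y t, t ∈ timeI r → ¬ (y.1 ∈ box d N₀ ∧ t ∈ timeI r₀) →
      (IsOdd b r (k y) (S' y) t ↔ IsOdd b r (k y) (S y) t)) :
    weight δ b r k S ≤ Real.exp (2 * δ * ((box d N₀).card * r₀)) * weight δ b r k S' := by
  classical
  have hfin : ∀ (P : ℝ → Prop), volume {t ∈ timeI r | P t} ≠ ∞ := fun P =>
    ((measure_mono (fun t ht => ht.1)).trans_lt (by
      rw [volume_timeI]; exact ENNReal.ofReal_lt_top : volume (timeI r) < ∞)).ne
  unfold weight
  by_cases hcS : Consistent b r S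
  · rw [if_pos hcS, if_pos (hc hcS), ← Real.exp_add]
    refine Real.exp_le_exp.2 ?_
    rw [← mul_add]
    refine mul_le_mul_of_nonneg_left ?_ (by positivity)
    have h1 : ∀ y : Site d N, (volume {t ∈ timeI r | ¬ IsOdd b r (k y) (S y) t}).toReal ≤
        (if y.1 ∈ box d N₀ then r₀ else 0) +
          (volume {t ∈ timeI r | ¬ IsOdd b r (k y) (S' y) t}).toReal := by
      intro y
      split_ifs with hy
      · have hle : volume {t ∈ timeI r | ¬ IsOdd b r (k y) (S y) t} ≤
            volume (timeI r₀) + volume {t ∈ timeI r | ¬ IsOdd b r (k y) (S' y) t} := by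
          refine (measure_mono ?_).trans (measure_union_le _ _)
          rintro t ⟨ht, hto⟩
          by_cases ht0 : t ∈ timeI r₀
          · exact Or.inl ht0
          · exact Or.inr ⟨ht, fun h => hto ((hodd y t ht fun h => ht0 h.2).1 h)⟩
        rw [volume_timeI] at hle
        have h2 := ENNReal.toReal_mono (ENNReal.add_ne_top.2 ⟨ENNReal.ofReal_ne_top, hfin _⟩) hle
        rwa [ENNReal.toReal_add ENNReal.ofReal_ne_top (hfin _), ENNReal.toReal_ofReal h0] at h2
      · rw [zero_add]
        refine le_of_eq ?_
        congr 2
        ext t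
        exact and_congr_right fun ht => not_congr (hodd y t ht fun h => hy h.1).symm
    refine (Finset.sum_le_sum fun y _ => h1 y).trans ?_
    rw [Finset.sum_add_distrib]
    refine add_le_add ?_ le_rfl
    rw [← Finset.sum_filter, Finset.sum_const, nsmul_eq_mul]
    refine mul_le_mul_of_nonneg_right ?_ h0
    rw [Nat.cast_le]
    refine Finset.card_le_card_of_injOn (fun y => y.1) (fun y hy => ?_) (fun a _ b _ hab => Subtype.ext hab)
    exact (Finset.mem_filter.1 hy).2
  · rw [if_neg hcS]
    split_ifs <;> positivity

/-- Each labelling loses at most the factor of `weight_le_of_agree`, hence the square. Consistency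
survives because the parities on whole lines agree. -/
lemma Resample.srcWeight_le {h : N₀ ≤ N} {J : Edge d N₀ → ℕ} (hω : Resample h r₀ J ω ω')
    (hβ : Compensates N r₀ J β) {δ : ℝ} (hδ : 0 ≤ δ) (h0 : 0 ≤ r₀)
    (hR : (R = .thermal ∧ r₀ = r) ∨ (R = .ground ∧ r₀ ≤ r)) :
    srcWeight δ R r 0 β ω ≤
      Real.exp (2 * δ * ((box d N₀).card * r₀)) ^ 2 * srcWeight δ R r 0 0 ω' := by
  have hr : r₀ ≤ r := by rcases hR with ⟨_, h⟩ | ⟨_, h⟩ <;> linarith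
  have hl := fun (y : Site d N) (t : ℝ) (ht : t ∈ timeI r) (hn : ¬ (y.1 ∈ box d N₀ ∧ t ∈ timeI r₀)) =>
    hω.labels hβ hR (p := (y, t)) (mem_subBox_iff.2 ht) hn
  have e1 : ∀ y, Even (ω.T₁ 0 y (timeI r)) ↔ Even (ω'.T₁ 0 y (timeI r)) := fun y =>
    (hω.lineAgree₁ y).even_iff hr
  have e2 : ∀ y, Even (ω.T₂ β y (timeI r)) ↔ Even (ω'.T₂ 0 y (timeI r)) := by
    intro y
    by_cases hy : y.1 ∈ box d N₀
    · exact (hω.lineAgree₂ hβ hy).even_iff hr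
    · rw [hω.T₂_out hβ hy]
  have w1 : weight δ R.bc₁ r ω.coin (ω.T₁ 0) ≤
      Real.exp (2 * δ * ((box d N₀).card * r₀)) * weight δ R.bc₁ r ω'.coin (ω'.T₁ 0) := by
    rw [hω.coin]
    refine weight_le_of_agree hδ h0 _ _ ?_ ?_
    · cases R
      · exact fun hc y => (e1 y).1 (hc y)
      · exact fun hc y => (e1 y).1 (hc y)
    · intro y t ht hn
      have := (hl y t ht hn).1
      rwa [hω.coin] at this
  have w2 : weight δ R.bc₂ r ω.coin' (ω.T₂ β) ≤
      Real.exp (2 * δ * ((box d N₀).card * r₀)) * weight δ R.bc₂ r ω'.coin' (ω'.T₂ 0) := by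
    rw [hω.coin']
    refine weight_le_of_agree hδ h0 _ _ ?_ ?_
    · cases R
      · exact fun hc y => (e2 y).1 (hc y)
      · exact fun _ => trivial
    · intro y t ht hn
      have := (hl y t ht hn).2
      rwa [hω.coin'] at this
  calc srcWeight δ R r 0 β ω ≤ _ * _ := mul_le_mul w1 w2 (weight_nonneg _ _ _ _ _)
        (mul_nonneg (Real.exp_pos _).le (weight_nonneg _ _ _ _ _))
    _ = _ := by rw [srcWeight]; ring

end
end TFIM

namespace TFIM
noncomputable section
open scoped ENNReal
variable {d N N₀ : ℕ} {r r₀ : ℝ}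

/-! ### Resampling inside a box -/

namespace PConf
variable {X : Type*}

lemma cnt_mono (c : PConf X) {U V : Set X} (h : U ⊆ V) : c.cnt U ≤ c.cnt V :=
  Set.ncard_le_ncard (fun _ hi => h hi) (Set.toFinite _)

lemma cnt_empty (c : PConf X) : c.cnt ∅ = 0 := by simp [cnt]

lemma cnt_univ (c : PConf X) : c.cnt univ = c.1 := by
  simp [cnt, Set.ncard_univ]

lemma filt_fst (c : PConf X) (V : Set X) : (filt V c).1 = c.cnt V := by
  rw [← cnt_univ, cnt_filt, inter_univ]

end PConf

/-- The marks of bridges inside the smaller box. -/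
abbrev InnerBridge (d N₀ : ℕ) : Type := Edge d N₀ ⊕ Edge d N₀

/-- The marks of bridges and cuts inside the smaller box. -/
abbrev Inner (d N₀ : ℕ) : Type := InnerBridge d N₀ ⊕ Site d N₀

/-- Inner marks as marks of the larger box. -/
def innerMark (h : N₀ ≤ N) : Inner d N₀ → Mark d N
  | Sum.inl (Sum.inl f) => Mark.b (liftEdge h f)
  | Sum.inl (Sum.inr f) => Mark.b' (liftEdge h f)
  | Sum.inr x => Mark.cut (liftSite h x)

lemma innerMark_injective (h : N₀ ≤ N) : Function.Injective (innerMark (d := d) h) := by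
  have hcut : ∀ x y : Site d N, Mark.cut x = Mark.cut y → x = y := fun x y hxy =>
    Sum.inr.inj (Sum.inr.inj (Sum.inr.inj hxy))
  rintro ((f | f) | x) ((g | g) | y) hxy
  · rw [liftEdge_injective h (Mark.b_inj.1 hxy)]
  · exact absurd hxy Mark.b_ne_b'
  · exact absurd hxy.symm Mark.cut_ne_b
  · exact absurd hxy Mark.b'_ne_b
  · rw [liftEdge_injective h (Mark.b'_inj.1 hxy)]
  · exact absurd hxy.symm Mark.cut_ne_b'
  · exact absurd hxy Mark.cut_ne_b
  · exact absurd hxy Mark.cut_ne_b'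
  · rw [liftSite_injective h (hcut _ _ hxy)]

/-- The region which is resampled. -/
def innerRegion (d : ℕ) (h : N₀ ≤ N) (r₀ : ℝ) : Set (Mark d N × ℝ) :=
  {p | p.1 ∈ range (innerMark (d := d) h) ∧ p.2 ∈ timeI r₀}

lemma measurableSet_innerRegion (h : N₀ ≤ N) (r₀ : ℝ) : MeasurableSet (innerRegion d h r₀) :=
  (measurable_fst (MeasurableSet.of_discrete (s := range (innerMark (d := d) h)))).inter
    (measurable_snd (measurableSet_timeI r₀))

/-- The cell of an inner mark. -/
def cell (h : N₀ ≤ N) (r₀ : ℝ) (i : Inner d N₀) : Set (Mark d N × ℝ) := {innerMark h i} ×ˢ timeI r₀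

lemma measurableSet_cell (h : N₀ ≤ N) (r₀ : ℝ) (i : Inner d N₀) : MeasurableSet (cell h r₀ i) :=
  (MeasurableSet.of_discrete).prod (measurableSet_timeI r₀)

lemma cell_subset (h : N₀ ≤ N) (r₀ : ℝ) (i : Inner d N₀) : cell h r₀ i ⊆ innerRegion d h r₀ :=
  fun _ hp => ⟨⟨i, hp.1.symm⟩, hp.2⟩

/-- The parities of the numbers of bridges in the cells. -/
def cellParity (h : N₀ ≤ N) (r₀ : ℝ) (a : PConf (Mark d N × ℝ)) : InnerBridge d N₀ → Bool :=
  fun i => (a.cnt (cell h r₀ (Sum.inl i))).bodd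

/-- Change of the parities according to `J`. -/
def shiftParity (J : Edge d N₀ → ℕ) (p : InnerBridge d N₀ → Bool) : InnerBridge d N₀ → Bool
  | Sum.inl f => p (Sum.inl f)
  | Sum.inr f => p (Sum.inr f) ^^ (J f).bodd

/-- Configurations in the inner region without cuts and with one or two bridges in each cell. -/
def goodInner (d : ℕ) (h : N₀ ≤ N) (r₀ : ℝ) : Set (PConf (Mark d N × ℝ)) :=
  {a | a.cnt (innerRegion d h r₀)ᶜ = 0 ∧
    (∀ i, a.cnt (cell h r₀ (Sum.inl i)) = 1 ∨ a.cnt (cell h r₀ (Sum.inl i)) = 2) ∧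
    ∀ x, a.cnt (cell h r₀ (Sum.inr x)) = 0}

lemma measurable_cellParity (h : N₀ ≤ N) (r₀ : ℝ) : Measurable (cellParity (d := d) h r₀) :=
  measurable_pi_iff.2 fun _ => (measurable_of_countable Nat.bodd).comp
    (PConf.measurable_cnt (measurableSet_cell h r₀ _))

lemma measurableSet_goodInner (h : N₀ ≤ N) (r₀ : ℝ) : MeasurableSet (goodInner d h r₀) := by
  have e : goodInner d h r₀ = {a | a.cnt (innerRegion d h r₀)ᶜ = 0} ∩
      ((⋂ i, {a | a.cnt (cell h r₀ (Sum.inl i)) = 1 ∨ a.cnt (cell h r₀ (Sum.inl i)) = 2}) ∩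
      ⋂ x, {a | a.cnt (cell h r₀ (Sum.inr x)) = 0}) := by
    ext a; simp [goodInner]
  rw [e]
  refine ((PConf.measurable_cnt (measurableSet_innerRegion h r₀).compl)
    (MeasurableSet.of_discrete (s := {0}))).inter ((MeasurableSet.iInter fun i => ?_).inter
      (MeasurableSet.iInter fun x => ?_))
  · exact (PConf.measurable_cnt (measurableSet_cell h r₀ _))
      (MeasurableSet.of_discrete (s := {n | n = 1 ∨ n = 2}))
  · exact (PConf.measurable_cnt (measurableSet_cell h r₀ _)) (MeasurableSet.of_discrete (s := {0}))

lemma even_of_bodd {a b : ℕ} (h : a.bodd = b.bodd) : Even (a + b) := by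
  have h1 := Nat.mod_two_of_bodd a
  have h2 := Nat.mod_two_of_bodd b
  rw [h] at h1
  rw [Nat.even_iff]
  omega

/-- Replacing the points in the inner region. -/
lemma resample_join {h : N₀ ≤ N} {J : Edge d N₀ → ℕ} {c a : PConf (Mark d N × ℝ)} (k : Coins d N)
    (ha : a ∈ goodInner d h r₀)
    (hst : cellParity h r₀ a = shiftParity J (cellParity h r₀ (PConf.filt (innerRegion d h r₀) c))) :
    Resample h r₀ J (toPair (c, k))
      (toPair (PConf.join a (PConf.filt (innerRegion d h r₀)ᶜ c), k)) := by
  set c' := PConf.join a (PConf.filt (innerRegion d h r₀)ᶜ c) with hc'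
  have hcnt : ∀ m V, (component c' m).count V =
      a.cnt ({m} ×ˢ V) + c.cnt ((innerRegion d h r₀)ᶜ ∩ {m} ×ˢ V) := fun m V => by
    rw [component_count, hc', PConf.cnt_join, PConf.cnt_filt]
  have hsame : ∀ m V, ({m} ×ˢ V : Set (Mark d N × ℝ)) ⊆ (innerRegion d h r₀)ᶜ →
      (component c' m).count V = (component c m).count V := by
    intro m V hsub
    have h0 : a.cnt ({m} ×ˢ V) = 0 :=
      Nat.le_zero.1 ((PConf.cnt_mono a hsub).trans_eq ha.1)
    rw [hcnt, component_count, inter_eq_right.2 hsub, h0, zero_add]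
  have hfar : ∀ m V, Disjoint V (timeI r₀) → (component c' m).count V = (component c m).count V :=
    fun m V hV => hsame m V fun p hp hp' => Set.disjoint_left.1 hV hp.2 hp'.2
  have hout : ∀ m V, m ∉ range (innerMark (d := d) h) →
      (component c' m).count V = (component c m).count V :=
    fun m V hm => hsame m V fun p hp hp' => hm (by rw [← show p.1 = m from hp.1]; exact hp'.1)
  have hin : ∀ i, (component c' (innerMark h i)).count (timeI r₀) = a.cnt (cell h r₀ i) := by
    intro i
    have : (innerRegion d h r₀)ᶜ ∩ cell h r₀ i = ∅ := by
      rw [← disjoint_iff_inter_eq_empty, disjoint_compl_left_iff_subset]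
      exact cell_subset h r₀ i
    rw [hcnt]
    change a.cnt (cell h r₀ i) + c.cnt ((innerRegion d h r₀)ᶜ ∩ cell h r₀ i) = _
    rw [this, PConf.cnt_empty, add_zero]
  have hin' : ∀ i, (component c (innerMark h i)).count (timeI r₀) =
      (PConf.filt (innerRegion d h r₀) c).cnt (cell h r₀ i) := by
    intro i
    rw [component_count, PConf.cnt_filt, inter_eq_right.2 (cell_subset h r₀ i)]
    rfl
  have hb : ∀ e : Edge d N, (∀ f, liftEdge h f ≠ e) → Mark.b e ∉ range (innerMark (d := d) h) ∧
      Mark.b' e ∉ range (innerMark (d := d) h) := by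
    intro e he
    constructor
    · rintro ⟨(f | f) | x, hf⟩
      · exact he f (Mark.b_inj.1 hf)
      · exact Mark.b'_ne_b hf
      · exact Mark.cut_ne_b hf
    · rintro ⟨(f | f) | x, hf⟩
      · exact Mark.b_ne_b' hf
      · exact he f (Mark.b'_inj.1 hf)
      · exact Mark.cut_ne_b' hf
  refine ⟨rfl, rfl, fun y U => hout _ U ?_, fun e he U => hout _ U (hb e he).1,
    fun e he U => hout _ U (hb e he).2, fun e U hU => hfar _ U hU, fun e U hU => hfar _ U hU,
    fun y hy U => hout _ U ?_, fun y U hU => hfar _ U hU, fun y hy => ?_, fun f => ?_, fun f => ?_,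
    fun f => ?_⟩
  · rintro ⟨(f | f) | x, hf⟩
    · exact Mark.g_ne_b hf.symm
    · exact Mark.g_ne_b' hf.symm
    · exact Sum.inr_ne_inl (Sum.inr.inj (Sum.inr.inj hf))
  · rintro ⟨(f | f) | x, hf⟩
    · exact Mark.cut_ne_b hf.symm
    · exact Mark.cut_ne_b' hf.symm
    · have : liftSite h x = y := Sum.inr.inj (Sum.inr.inj (Sum.inr.inj hf))
      exact hy (this ▸ x.2)
  · exact (hin (Sum.inr ⟨y.1, hy⟩)).trans (ha.2.2 ⟨y.1, hy⟩)
  · have h1 := congrFun hst (Sum.inl f)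
    rw [add_comm]
    refine even_of_bodd ?_
    rw [show ((toPair (c', k)).B (liftEdge h f)).count (timeI r₀) = a.cnt _ from
      hin (Sum.inl (Sum.inl f)), show ((toPair (c, k)).B (liftEdge h f)).count (timeI r₀) = _ from
      hin' (Sum.inl (Sum.inl f))]
    exact h1
  · have h1 := congrFun hst (Sum.inr f)
    rw [show ∀ x y z : ℕ, x + y + z = y + (x + z) from fun x y z => by ring]
    refine even_of_bodd ?_
    rw [show ((toPair (c', k)).B' (liftEdge h f)).count (timeI r₀) = a.cnt _ from
      hin (Sum.inl (Sum.inr f)), show ((toPair (c, k)).B' (liftEdge h f)).count (timeI r₀) = _ from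
      hin' (Sum.inl (Sum.inr f)), Nat.bodd_add]
    exact h1
  · rw [show ((toPair (c', k)).B (liftEdge h f)).count (timeI r₀) = a.cnt _ from
      hin (Sum.inl (Sum.inl f))]
    rcases ha.2.1 (Sum.inl f) with h1 | h1 <;> rw [h1] <;> norm_num

/-- The probability that a Poisson variable of mean `a` equals `k`. -/
def poisProb (a : ℝ) (k : ℕ) : ℝ := Real.exp (-a) * a ^ k / k.factorial

/-- The lower bound for the probability of a good inner configuration with given parities. -/
def innerBound (d N₀ : ℕ) (lam δ r₀ : ℝ) : ℝ≥0∞ :=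
  ENNReal.ofReal (min (poisProb (lam * r₀) 1) (poisProb (lam * r₀) 2)) ^
      Fintype.card (InnerBridge d N₀) *
    ENNReal.ofReal (poisProb (4 * δ * r₀) 0) ^ Fintype.card (Site d N₀)

/-- For `N₀ = 0` the interval `I_{r₀}` may be a single point, but then the box has no edges and no
bridge has to be placed. -/
lemma innerBound_ne_zero {lam δ : ℝ} (hlam : 0 < lam) (h : 0 < r₀ ∨ N₀ = 0) :
    innerBound d N₀ lam δ r₀ ≠ 0 := by
  refine mul_ne_zero ?_ (pow_ne_zero _ ?_)
  · rcases h with h | rfl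
    · refine pow_ne_zero _ ?_
      rw [Ne, ENNReal.ofReal_eq_zero, not_le]
      have : 0 < lam * r₀ := mul_pos hlam h
      refine lt_min ?_ ?_ <;> unfold poisProb <;> positivity
    · have : IsEmpty (Edge d 0) := by
        refine ⟨fun e => ?_⟩
        obtain ⟨⟨h1, h2⟩, h3, -⟩ := mem_edges.1 e.2
        refine h3.ne ?_
        simp only [box, Fintype.mem_piFinset, Nat.cast_zero, neg_zero, Finset.Icc_self,
          Finset.mem_singleton] at h1 h2
        funext i
        rw [h1 i, h2 i]
      simp
  · rw [Ne, ENNReal.ofReal_eq_zero, not_le]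
    unfold poisProb
    positivity

lemma innerBound_ne_top (d N₀ : ℕ) (lam δ r₀ : ℝ) : innerBound d N₀ lam δ r₀ ≠ ∞ :=
  ENNReal.mul_ne_top (ENNReal.pow_ne_top ENNReal.ofReal_ne_top)
    (ENNReal.pow_ne_top ENNReal.ofReal_ne_top)

lemma meas_cell {lam δ : ℝ} (hlam : 0 ≤ lam) (hδ : 0 ≤ δ) (h : N₀ ≤ N) (h0 : 0 ≤ r₀) (hr : r₀ ≤ r)
    (i : Inner d N₀) : (((Mark.meas d N lam δ r).restrict (innerRegion d h r₀)).restrict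
      (cell h r₀ i) univ).toReal = (match i with
        | Sum.inl _ => lam * r₀
        | Sum.inr _ => 4 * δ * r₀) := by
  have hsub : timeI r₀ ⊆ timeI r := Icc_subset_Icc (by linarith) (by linarith)
  rw [Measure.restrict_apply_univ, Measure.restrict_apply (measurableSet_cell h r₀ i),
    inter_eq_left.2 (cell_subset h r₀ i), Mark.meas_apply _ _ _ (measurableSet_cell h r₀ i),
    Finset.sum_eq_single (innerMark h i)]
  · have e1 : {t | (innerMark h i, t) ∈ cell h r₀ i} = timeI r₀ := by ext t; simp [cell]
    rw [e1, rateMeas, Measure.smul_apply, Measure.restrict_apply (measurableSet_timeI r₀),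
      inter_eq_left.2 hsub, volume_timeI, smul_eq_mul, ENNReal.toReal_mul, ENNReal.toReal_ofReal h0]
    rcases i with (f | f) | x
    · rw [ENNReal.toReal_ofReal]
      · rfl
      · exact hlam
    · rw [ENNReal.toReal_ofReal]
      · rfl
      · exact hlam
    · rw [ENNReal.toReal_ofReal]
      · rfl
      · change 0 ≤ 4 * δ; positivity
  · intro m _ hm
    have e1 : {t | (m, t) ∈ cell h r₀ i} = ∅ := by ext t; simp [cell, hm]
    rw [e1, measure_empty]
  · simp

/-- The lower bound for the resampling probabilities. -/
lemma innerBound_le {lam δ : ℝ} (hlam : 0 ≤ lam) (hδ : 0 ≤ δ) (h : N₀ ≤ N) (h0 : 0 ≤ r₀)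
    (hr : r₀ ≤ r) (p : InnerBridge d N₀ → Bool) :
    innerBound d N₀ lam δ r₀ ≤ PConf.pois ((Mark.meas d N lam δ r).restrict (innerRegion d h r₀))
      (goodInner d h r₀ ∩ cellParity h r₀ ⁻¹' {p}) := by
  classical
  set μ' := (Mark.meas d N lam δ r).restrict (innerRegion d h r₀) with hμ'
  -- One cell for each inner process, plus everything outside the region. An odd parity is realised
  -- by one bridge and an even one by two, so that no edge is left without a bridge.
  let Vs : Option (Inner d N₀) → Set (Mark d N × ℝ) := fun i => i.elim (innerRegion d h r₀)ᶜ (cell h r₀)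
  let kk : Option (Inner d N₀) → ℕ := fun i => i.elim 0
    (Sum.elim (fun j => if p j then 1 else 2) fun _ => 0)
  have hVs : ∀ i, MeasurableSet (Vs i) := by
    rintro (_ | i)
    · exact (measurableSet_innerRegion h r₀).compl
    · exact measurableSet_cell h r₀ i
  have hd : Pairwise fun i j => Disjoint (Vs i) (Vs j) := by
    rintro (_ | i) (_ | j) hij
    · exact absurd rfl hij
    · exact disjoint_compl_left_iff_subset.2 (cell_subset h r₀ j)
    · exact disjoint_compl_right_iff_subset.2 (cell_subset h r₀ i)
    · refine Set.disjoint_left.2 fun x hx hx' => hij ?_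
      rw [innerMark_injective h (hx.1.symm.trans hx'.1)]
  have hA : ∀ k, MeasurableSet {c : PConf (Mark d N × ℝ) | c.1 = k} := by
    intro k
    have := (PConf.measurable_cnt (X := Mark d N × ℝ) MeasurableSet.univ)
      (MeasurableSet.of_discrete (s := {k}))
    simpa [PConf.cnt_univ, preimage] using this
  have key := PConf.pois_forall_filt Finset.univ Vs hVs hd (fun i => {c | c.1 = kk i})
    (fun i => hA _) μ'
  have hsub : {c : PConf (Mark d N × ℝ) | ∀ i ∈ Finset.univ, PConf.filt (Vs i) c ∈ {c | c.1 = kk i}} ⊆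
      goodInner d h r₀ ∩ cellParity h r₀ ⁻¹' {p} := by
    intro c hc
    have hc' : ∀ i, c.cnt (Vs i) = kk i := fun i => by
      have := hc i (Finset.mem_univ i)
      rwa [mem_ofPred_eq, PConf.filt_fst] at this
    have hj : ∀ j, c.cnt (cell h r₀ (Sum.inl j)) = if p j then 1 else 2 :=
      fun j => hc' (some (Sum.inl j))
    refine ⟨⟨hc' none, fun j => ?_, fun x => hc' (some (Sum.inr x))⟩, ?_⟩
    · rw [hj]; split_ifs <;> simp
    · funext j
      rw [cellParity, hj]
      cases p j <;> rfl
  refine le_trans ?_ (measure_mono hsub)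
  rw [key, Fintype.prod_option]
  -- The restricted intensity does not charge the outside, so almost surely there are no points
  -- there.
  have hnone : PConf.pois (μ'.restrict (Vs none)) {c | c.1 = kk none} = 1 := by
    rw [PConf.pois_zero_card]
    have : (μ'.restrict (Vs none)) univ = 0 := by
      rw [Measure.restrict_apply_univ, hμ', Measure.restrict_apply (hVs none)]
      simp [Vs]
    rw [this]
    simp [kk]
  rw [hnone, one_mul, Fintype.prod_sum_type, innerBound]
  refine mul_le_mul' ?_ ?_
  · rw [← Finset.card_univ, ← Finset.prod_const]
    refine Finset.prod_le_prod' fun j _ => ?_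
    rw [PConf.pois_zero_card]
    change _ ≤ ENNReal.ofReal (poisProb ((μ'.restrict (cell h r₀ (Sum.inl j))) univ).toReal
      (if p j then 1 else 2))
    rw [hμ', meas_cell hlam hδ h h0 hr]
    refine ENNReal.ofReal_le_ofReal ?_
    split_ifs
    · exact min_le_left _ _
    · exact min_le_right _ _
  · rw [← Finset.card_univ, ← Finset.prod_const]
    refine Finset.prod_le_prod' fun x _ => ?_
    rw [PConf.pois_zero_card]
    change _ ≤ ENNReal.ofReal (poisProb ((μ'.restrict (cell h r₀ (Sum.inr x))) univ).toReal 0)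
    rw [hμ', meas_cell hlam hδ h h0 hr]

end
end TFIM

namespace TFIM
noncomputable section
open scoped ENNReal
variable {d N N₀ : ℕ} {R : Regime} {r r₀ : ℝ} {ω ω' : Pair d N} {β : Site d N → Set ℝ → ℕ}

/-! ### The weighted measure -/

/-- The measure `𝔼_{N,r}` weighted by the product of the weights, before normalisation. -/
def weightedLaw (d : ℕ) (lam δ : ℝ) (R : Regime) (N : ℕ) (r : ℝ) : Measure (Pair d N) :=
  (pairLaw d lam δ N r).withDensity fun ω => ENNReal.ofReal (pairWeight δ R r ω)

lemma Pbar_real (lam δ : ℝ) (E : Set (Pair d N)) :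
    (Pbar d lam δ R N r).real E =
      ((weightedLaw d lam δ R N r univ).toReal)⁻¹ * (weightedLaw d lam δ R N r E).toReal := by
  rw [weightedLaw, withDensity_apply _ MeasurableSet.univ, setLIntegral_univ, Pbar, Measure.real,
    Measure.smul_apply, smul_eq_mul, ENNReal.toReal_mul, ENNReal.toReal_inv]

lemma measurable_pairWeight (δ : ℝ) (R : Regime) (r : ℝ) :
    Measurable (srcWeight (d := d) (N := N) δ R r 0 0) :=
  measurable_srcWeight_pair (goodSource_zero _) (goodSource_zero _) δ R r

lemma weightedLaw_apply {lam δ : ℝ} (hlam : 0 ≤ lam) (hδ : 0 ≤ δ) (hr : 0 ≤ r) {E : Set (Pair d N)}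
    (hE : MeasurableSet E) : weightedLaw d lam δ R N r E =
      ∫⁻ p in toPair ⁻¹' E, ENNReal.ofReal (srcWeight δ R r 0 0 (toPair p)) ∂baseLaw d N lam δ r := by
  rw [weightedLaw, withDensity_apply _ hE]
  exact ((map_toPair hlam hδ hr).setLIntegral_comp_preimage hE
    (measurable_pairWeight δ R r).ennreal_ofReal).symm

lemma integrable_srcWeight {lam δ : ℝ} (hδ : 0 ≤ δ) (hr : 0 ≤ r) (R : Regime)
    {α β : Site d N → Set ℝ → ℕ} (hα : GoodSource α) (hβ : GoodSource β) :
    Integrable (fun p : Base d N => srcWeight δ R r α β (toPair p)) (baseLaw d N lam δ r) := by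
  refine Integrable.of_bound (measurable_srcWeight (hα _) (hβ _) δ R r).aestronglyMeasurable
    (Real.exp (2 * δ * (Fintype.card (Site d N) * r)) *
      Real.exp (2 * δ * (Fintype.card (Site d N) * r))) (ae_of_all _ fun p => ?_)
  rw [Real.norm_of_nonneg (srcWeight_nonneg _ _ _ _ _ _)]
  exact mul_le_mul (weight_le hδ hr _ _ _) (weight_le hδ hr _ _ _) (weight_nonneg _ _ _ _ _)
    (Real.exp_pos _).le

lemma lintegral_srcWeight {lam δ : ℝ} (hδ : 0 ≤ δ) (hr : 0 ≤ r) (R : Regime)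
    {α β : Site d N → Set ℝ → ℕ} (hα : GoodSource α) (hβ : GoodSource β) :
    ∫⁻ p, ENNReal.ofReal (srcWeight δ R r α β (toPair p)) ∂baseLaw d N lam δ r =
      ENNReal.ofReal (∫ p, srcWeight δ R r α β (toPair p) ∂baseLaw d N lam δ r) :=
  (ofReal_integral_eq_lintegral_ofReal (integrable_srcWeight hδ hr R hα hβ)
    (ae_of_all _ fun _ => srcWeight_nonneg _ _ _ _ _ _)).symm

lemma weightedLaw_univ {lam δ : ℝ} (hlam : 0 ≤ lam) (hδ : 0 ≤ δ) (hr : 0 ≤ r) :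
    weightedLaw d lam δ R N r univ =
      ENNReal.ofReal (∫ p, srcWeight δ R r 0 0 (toPair p) ∂baseLaw d N lam δ r) := by
  rw [weightedLaw_apply hlam hδ hr MeasurableSet.univ, preimage_univ, setLIntegral_univ,
    lintegral_srcWeight hδ hr R goodSource_zero goodSource_zero]

lemma weightedLaw_ne_top {lam δ : ℝ} (hlam : 0 ≤ lam) (hδ : 0 ≤ δ) (hr : 0 ≤ r)
    (E : Set (Pair d N)) : weightedLaw d lam δ R N r E ≠ ∞ :=
  ((measure_mono (subset_univ E)).trans_lt (by
    rw [weightedLaw_univ hlam hδ hr]; exact ENNReal.ofReal_lt_top)).ne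

/-- The configuration without points has positive probability, and it is consistent for every
boundary condition. -/
lemma integral_srcWeight_pos {lam δ : ℝ} (hδ : 0 ≤ δ) (hr : 0 ≤ r) (R : Regime) :
    0 < ∫ p : Base d N, srcWeight δ R r 0 0 (toPair p) ∂baseLaw d N lam δ r := by
  rw [integral_pos_iff_support_of_nonneg (fun p => srcWeight_nonneg _ _ _ _ _ _)
    (integrable_srcWeight hδ hr R goodSource_zero goodSource_zero)]
  have hsub : {c : PConf (Mark d N × ℝ) | c.1 = 0} ×ˢ (univ : Set (Coins d N)) ⊆
      Function.support fun p : Base d N => srcWeight δ R r 0 0 (toPair p) := by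
    rintro ⟨⟨n, c⟩, k⟩ ⟨hn, -⟩
    change n = 0 at hn
    subst hn
    have hz : ∀ m U, (component (⟨0, c⟩ : PConf (Mark d N × ℝ)) m).count U = 0 := fun m U => by
      rw [component_count]
      refine Nat.le_zero.1 ((PConf.cnt_mono _ (subset_univ _)).trans_eq ?_)
      rw [PConf.cnt_univ]
    set ω := toPair ((⟨0, c⟩ : PConf (Mark d N × ℝ)), k) with hω
    have hB : ∀ e U, (ω.B e).count U = 0 := fun e U => hz _ U
    have hB' : ∀ e U, (ω.B' e).count U = 0 := fun e U => hz _ U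
    have hG : ∀ e U, (ω.G e).count U = 0 := fun e U => hz _ U
    have h1 : ∀ y U, ω.T₁ 0 y U = 0 := fun y U => by
      simp [Pair.T₁, Pair.S, switchCount, hB, config_empty_count]
    have h2 : ∀ y U, ω.T₂ 0 y U = 0 := fun y U => by
      simp [Pair.T₂, Pair.S', switchCount, hB', hG]
    have hw : ∀ (b : TemporalBC) (k : Site d N → Bool) (S : Site d N → Set ℝ → ℕ),
        (∀ y U, S y U = 0) → weight δ b r k S ≠ 0 := by
      intro b k S hS
      have hc : Consistent b r S := by
        cases b <;> simp [Consistent, hS]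
      rw [weight, if_pos hc]
      exact (Real.exp_pos _).ne'
    exact mul_ne_zero (hw _ _ _ h1) (hw _ _ _ h2)
  refine lt_of_lt_of_le ?_ (measure_mono hsub)
  rw [baseLaw, Measure.prod_prod, measure_univ, mul_one, PConf.pois_zero_card]
  rw [ENNReal.ofReal_pos]
  simp only [pow_zero, Nat.factorial_zero, Nat.cast_one, mul_one, div_one]
  exact Real.exp_pos _

/-! ### Resampling the configuration in a box -/

/-- The resampling constant. -/
def resampleConst (d N₀ : ℕ) (lam δ r₀ : ℝ) : ℝ≥0∞ :=
  ENNReal.ofReal (Real.exp (2 * δ * ((box d N₀).card * r₀)) ^ 2) * (innerBound d N₀ lam δ r₀)⁻¹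

lemma resampleConst_ne_top {lam δ : ℝ} (hlam : 0 < lam) (h : 0 < r₀ ∨ N₀ = 0) :
    resampleConst d N₀ lam δ r₀ ≠ ∞ :=
  ENNReal.mul_ne_top ENNReal.ofReal_ne_top (ENNReal.inv_ne_top.2 (innerBound_ne_zero hlam h))

/-- If the weight `F` increases by at most a constant factor when the configuration in the box is
replaced, and the new configuration belongs to `E`, then the integral of `F` is bounded by the
weight of `E`. -/
lemma exists_majorant {lam δ : ℝ} (hlam : 0 < lam) (hδ : 0 ≤ δ) (h : N₀ ≤ N)
    (hpos : 0 < r₀ ∨ N₀ = 0) (h0 : 0 ≤ r₀) (hr : r₀ ≤ r) (J : Edge d N₀ → ℕ) {E : Set (Pair d N)}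
    (hE : ∀ ω ω', SameCounts ω ω' → ω ∈ E → ω' ∈ E) {F : Pair d N → ℝ}
    (hF : ∀ ω ω', Resample h r₀ J ω ω' → 0 < F ω → ω' ∈ E ∧
      F ω ≤ Real.exp (2 * δ * ((box d N₀).card * r₀)) ^ 2 * srcWeight δ R r 0 0 ω') :
    ∃ V : Base d N → ℝ≥0∞, Measurable V ∧ (∀ p, ENNReal.ofReal (F (toPair p)) ≤ V p) ∧
      ∫⁻ p, V p ∂baseLaw d N lam δ r ≤
        resampleConst d N₀ lam δ r₀ * weightedLaw d lam δ R N r E := by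
  set ρ := weightedLaw d lam δ R N r
  have hr0 : 0 ≤ r := h0.trans hr
  have hm : Measurable fun p : Base d N => ENNReal.ofReal (srcWeight δ R r 0 0 (toPair p)) :=
    (measurable_srcWeight (goodSource_zero _) (goodSource_zero _) δ R r).ennreal_ofReal
  obtain ⟨V, hVm, hFV, hV⟩ := PConf.exists_resample_bound (μ := Mark.meas d N lam δ r)
    (κ := coinsLaw d N) (measurableSet_innerRegion (d := d) h r₀) (measurable_cellParity h r₀)
    (shiftParity J) (measurableSet_goodInner h r₀) (innerBound_ne_zero hlam hpos)
    (innerBound_ne_top d N₀ lam δ r₀) (innerBound_le hlam.le hδ h h0 hr)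
    (C := ENNReal.ofReal (Real.exp (2 * δ * ((box d N₀).card * r₀)) ^ 2))
    (F := fun p => ENNReal.ofReal (F (toPair p)))
    (w := fun p => ENNReal.ofReal (srcWeight δ R r 0 0 (toPair p))) hm
    (fun c k σ => by rw [(sameCounts_reorder c k σ).srcWeight_eq])
    -- The event `E` need not be measurable; its measurable hull has the same weight.
    (E' := toPair ⁻¹' E) (M := toPair ⁻¹' toMeasurable ρ E)
    ((map_toPair hlam.le hδ hr0).measurable (measurableSet_toMeasurable ρ E))
    (preimage_mono (subset_toMeasurable ρ E)) (fun c k σ hc => hE _ _ (sameCounts_reorder c k σ) hc)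
    (fun c k a ha hst => by
      by_cases hpF : 0 < F (toPair (c, k))
      · obtain ⟨h1, h2⟩ := hF _ _ (resample_join k ha hst) hpF
        rw [indicator_of_mem (show (PConf.join a _, k) ∈ toPair ⁻¹' E from h1),
          ← ENNReal.ofReal_mul (by positivity)]
        exact ENNReal.ofReal_le_ofReal h2
      · rw [ENNReal.ofReal_of_nonpos (not_lt.1 hpF)]
        exact zero_le)
  refine ⟨V, hVm, hFV, hV.trans_eq ?_⟩
  rw [resampleConst, ← measure_toMeasurable E,
    weightedLaw_apply hlam.le hδ hr0 (measurableSet_toMeasurable ρ E)]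
  rfl

/-! ### The difference of the two-point functions -/

/-- The shifts come from an edge set of the small box whose odd vertices are the sites of the two
sources. -/
lemma compensates_src {x : Site d N} (hx : x.1 ∈ box d N₀) {t : ℝ}
    (ht : t ∈ timeI r₀) (h0 : 0 ≤ r₀) : ∃ J : Edge d N₀ → ℕ,
    Compensates N r₀ J (src (⟨0, zero_mem_box d N⟩, 0) + src (x, t)) := by
  obtain ⟨J, hJ⟩ := exists_edge_set (⟨x.1, hx⟩ : Site d N₀)
  have hz : (0 : ℝ) ∈ timeI r₀ := ⟨by linarith, by linarith⟩
  refine ⟨J, fun y => (src_additive _ y).add (src_additive _ y), fun y U hy => ?_, fun y U hU => ?_,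
    fun y hy => ?_⟩
  · have h1 : y ≠ ⟨0, zero_mem_box d N⟩ := fun h => hy (h ▸ zero_mem_box d N₀)
    have h2 : y ≠ x := fun h => hy (h ▸ hx)
    simp [src, h1, h2]
  · have h1 : (0 : ℝ) ∉ U := fun h => Set.disjoint_left.1 hU h hz
    have h2 : t ∉ U := fun h => Set.disjoint_left.1 hU h ht
    simp [src, h1, h2]
  · have e : (src (⟨0, zero_mem_box d N⟩, 0) + src (x, t)) y (timeI r₀) =
        (if y.1 = 0 then 1 else 0) + if (⟨y.1, hy⟩ : Site d N₀) = ⟨x.1, hx⟩ then 1 else 0 := by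
      rw [Pi.add_apply, Pi.add_apply, src, src]
      congr 1
      · by_cases hy0 : y.1 = 0
        · rw [if_pos hy0, if_pos ⟨Subtype.ext hy0, hz⟩]
        · rw [if_neg hy0, if_neg fun h' => hy0 (congrArg Subtype.val h'.1)]
      · by_cases hyx : y.1 = x.1
        · rw [if_pos ⟨Subtype.ext hyx, ht⟩]; exact (if_pos (Subtype.mk_eq_mk.2 hyx)).symm
        · rw [if_neg fun h' => hyx (congrArg Subtype.val h'.1),
            if_neg fun h' => hyx (Subtype.mk.inj h')]
    rw [e]
    exact hJ ⟨y.1, hy⟩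

/-- Switching leaves only the configurations whose cluster meets the ghost; resampling the box
around the two sources turns them into configurations without sources in which the origin is
connected to the ghost. -/
theorem twoPoint_sub_le {lam δ : ℝ} (hlam : 0 < lam) (hδ : 0 ≤ δ) (h : N₀ ≤ N)
    (hR : (R = .thermal ∧ r₀ = r) ∨ (R = .ground ∧ r₀ ≤ r)) (h0 : 0 < r₀) {x : Lattice d}
    (hx : x ∈ box d N₀) {t : ℝ} (ht : t ∈ timeI r₀) :
    twoPoint d lam δ .wired R.bc₂ N r x t - twoPoint d lam δ .free R.bc₁ N r x t ≤
      (resampleConst d N₀ lam δ r₀).toReal * (Pbar d lam δ R N r).real (connGhost d R N r) := by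
  classical
  have hr : r₀ ≤ r := by rcases hR with ⟨_, h⟩ | ⟨_, h⟩ <;> linarith
  have hr0 : 0 ≤ r := h0.le.trans hr
  set x' : Site d N := ⟨x, box_mono h hx⟩ with hx'
  set o : Site d N × ℝ := (⟨0, zero_mem_box d N⟩, 0) with ho
  obtain ⟨J, hJ⟩ := compensates_src (x := x') hx ht h0.le
  have hZ := integral_srcWeight_pos (d := d) (N := N) (lam := lam) hδ hr0 R
  have hgs := goodSource_src_add o (x', t)
  obtain ⟨V, hVm, hFV, hV⟩ := exists_majorant (R := R) hlam hδ h (Or.inl h0) h0.le hr J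
    (E := connGhost d R N r) (fun ω ω' hs => hs.mem_connGhost)
    -- Only the ghost-connected part of the weight has to be majorised, since the switching argument
    -- takes care of the rest.
    (F := fun ω => if ∃ z ∈ cluster R r ω 0 (src o + src (x', t)) o, z.2 ∈ ghost R r ω z.1 then
      srcWeight δ R r 0 (src o + src (x', t)) ω else 0) (fun ω ω' hω hpos => by
        by_cases hz : ∃ z ∈ cluster R r ω 0 (src o + src (x', t)) o, z.2 ∈ ghost R r ω z.1
        · rw [if_pos hz]
          exact ⟨hω.mem_connGhost hJ h0.le hR hz, hω.srcWeight_le hJ hδ h0.le hR⟩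
        · rw [if_neg hz] at hpos
          exact absurd hpos (lt_irrefl 0))
  have key := lintegral_srcWeight_le (R := R) (o := o) (q := (x', t)) hr0 rfl lam δ hVm
    (measurable_srcWeight (goodSource_zero _) (hgs _) δ R r)
    (measurable_srcWeight (hgs _) (goodSource_zero _) δ R r) (fun p hz => by
      have := hFV p
      rwa [if_pos hz] at this)
  rw [lintegral_srcWeight hδ hr0 R goodSource_zero hgs,
    lintegral_srcWeight hδ hr0 R hgs goodSource_zero] at key
  have hK := resampleConst_ne_top (d := d) (N₀ := N₀) (δ := δ) hlam (Or.inl h0)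
  have hE := weightedLaw_ne_top (R := R) hlam.le hδ hr0 (connGhost d R N r)
  have key2 := ENNReal.toReal_mono (ENNReal.add_ne_top.2 ⟨ENNReal.ofReal_ne_top,
    ENNReal.mul_ne_top hK hE⟩) (key.trans (add_le_add le_rfl hV))
  have hnn : ∀ α β, 0 ≤ ∫ p : Base d N, srcWeight δ R r α β (toPair p) ∂baseLaw d N lam δ r :=
    fun α β => integral_nonneg fun p => srcWeight_nonneg _ _ _ _ _ _
  rw [ENNReal.toReal_add ENNReal.ofReal_ne_top (ENNReal.mul_ne_top hK hE), ENNReal.toReal_mul,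
    ENNReal.toReal_ofReal (hnn _ _), ENNReal.toReal_ofReal (hnn _ _)] at key2
  have hsub : timeI r₀ ⊆ timeI r := Icc_subset_Icc (by linarith) (by linarith)
  rw [twoPoint_sub_eq hlam.le hδ hr0 R x' (hsub ht) hZ.ne', Pbar_real,
    weightedLaw_univ hlam.le hδ hr0, ENNReal.toReal_ofReal hZ.le, div_le_iff₀ hZ]
  calc _ ≤ _ := sub_le_iff_le_add'.2 key2
    _ = _ := by field_simp

/-! ### Events defined outside a box -/

/-- Two configurations which no generator of the σ-algebra separates are not separated by any of its
sets. -/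
lemma mem_iff_of_definedIn {K : Set (Site d N × ℝ)} {A : Set (Pair d N)}
    (hA : MeasurableSet[definedIn R r K] A)
    (hB : ∀ e U, (ω'.B e).count (bridgeWindow K e U) = (ω.B e).count (bridgeWindow K e U))
    (hB' : ∀ e U, (ω'.B' e).count (bridgeWindow K e U) = (ω.B' e).count (bridgeWindow K e U))
    (hG : ∀ x U, (ω'.G x).count (siteWindow K x U) = (ω.G x).count (siteWindow K x U))
    (hcut : ∀ x U, (ω'.cuts x).count (siteWindow K x U) = (ω.cuts x).count (siteWindow K x U))
    (hodd : ∀ p ∈ K, (ω'.Odd₁ R r p ↔ ω.Odd₁ R r p) ∧ (ω'.Odd₂ R r p ↔ ω.Odd₂ R r p)) :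
    ω' ∈ A ↔ ω ∈ A := by
  induction A, hA using MeasurableSpace.generateFrom_induction with
  | hC A hA _ =>
    rcases hA with (⟨e, U, k, -, rfl | rfl⟩ | ⟨x, U, k, -, rfl | rfl⟩) | ⟨p, hp, rfl | rfl⟩
    · simp only [mem_ofPred_eq, hB]
    · simp only [mem_ofPred_eq, hB']
    · simp only [mem_ofPred_eq, hG]
    · simp only [mem_ofPred_eq, hcut]
    · exact (hodd p hp).1
    · exact (hodd p hp).2
  | empty => simp
  | compl A _ ih => exact not_congr ih
  | iUnion s _ ih => simp only [mem_iUnion, ih]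

lemma measurable_cuts (x : Site d N) : Measurable fun ω : Pair d N => ω.cuts x :=
  (measurable_pi_apply x).comp (measurable_snd.comp (measurable_snd.comp measurable_toProd))

lemma definedIn_le {K : Set (Site d N × ℝ)} (hK : ∀ x, MeasurableSet {t | (x, t) ∈ K}) :
    definedIn R r K ≤ (inferInstance : MeasurableSpace (Pair d N)) := by
  obtain ⟨hB, hB', hG, hk, hk'⟩ := measurable_pair_components (d := d) (N := N)
  have hsite : ∀ x U, MeasurableSet U → MeasurableSet (siteWindow K x U) := fun x U hU =>
    hU.inter (hK x)
  have hbridge : ∀ e U, MeasurableSet U → MeasurableSet (bridgeWindow K e U) := fun e U hU => by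
    refine hU.inter ?_
    have : {t | ∃ x : Site d N, (e.1.1 = x.1 ∨ e.1.2 = x.1) ∧ (x, t) ∈ K} =
        ⋃ x : Site d N, {t | (e.1.1 = x.1 ∨ e.1.2 = x.1) ∧ (x, t) ∈ K} := by
      ext t; simp
    change MeasurableSet {t | ∃ x : Site d N, (e.1.1 = x.1 ∨ e.1.2 = x.1) ∧ (x, t) ∈ K}
    rw [this]
    exact MeasurableSet.iUnion fun x => (MeasurableSet.const _).inter (hK x)
  refine MeasurableSpace.generateFrom_le ?_
  rintro A ((⟨e, U, k, hU, rfl | rfl⟩ | ⟨x, U, k, hU, rfl | rfl⟩) | ⟨p, hp, rfl | rfl⟩)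
  · exact (measCount_count (hB e)).apply (hbridge e U hU) (MeasurableSet.singleton k)
  · exact (measCount_count (hB' e)).apply (hbridge e U hU) (MeasurableSet.singleton k)
  · exact (measCount_count (hG x)).apply (hsite x U hU) (MeasurableSet.singleton k)
  · exact (measCount_count (measurable_cuts x)).apply (hsite x U hU) (MeasurableSet.singleton k)
  · exact (measurable_id.prodMk (measurable_const (a := p.2))) (measurableSet_isOdd_prod
      (measCount_switchCount hB (fun _ => measurable_const) p.1)
      ((measurable_pi_apply p.1).comp hk) R.bc₁ r)
  · exact (measurable_id.prodMk (measurable_const (a := p.2))) (measurableSet_isOdd_prod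
      (measCount_switchCount hB' hG p.1) ((measurable_pi_apply p.1).comp hk') R.bc₂ r)

lemma compensates_zero (N : ℕ) (r₀ : ℝ) :
    Compensates (d := d) N r₀ (fun _ : Edge d N₀ => 0) (0 : Site d N → Set ℝ → ℕ) :=
  ⟨fun _ _ _ => rfl, fun _ _ _ => rfl, fun _ _ _ => rfl, fun y _ => by simp⟩

/-- Events defined outside the box are not affected by changes inside the box. -/
lemma Resample.mem_iff {h : N₀ ≤ N} (hω : Resample h r₀ (fun _ => 0) ω ω')
    (hR : (R = .thermal ∧ r₀ = r) ∨ (R = .ground ∧ r₀ ≤ r)) {A : Set (Pair d N)}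
    (hA : MeasurableSet[definedIn R r (subBox N N r \ subBox N N₀ r₀)] A) : ω' ∈ A ↔ ω ∈ A := by
  -- An edge of the small box has both endpoints in it, so a bridge on it meets the outside region
  -- only at times outside `I_{r₀}`.
  have hbr : ∀ (e : Edge d N) U, (∀ f, liftEdge h f ≠ e) ∨
      Disjoint (bridgeWindow (subBox N N r \ subBox N N₀ r₀) e U) (timeI r₀) := by
    intro e U
    by_cases he : ∃ f, liftEdge h f = e
    · right
      obtain ⟨f, rfl⟩ := he
      refine Set.disjoint_left.2 ?_
      rintro t ⟨-, x, hx, -, hxt⟩ ht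
      have hf := (mem_edges.1 f.2).1
      refine hxt ⟨?_, ht⟩
      rcases hx with hx | hx
      · rw [← show f.1.1 = x.1 from hx]; exact hf.1
      · rw [← show f.1.2 = x.1 from hx]; exact hf.2
    · left; push Not at he; exact he
  refine mem_iff_of_definedIn hA (fun e U => ?_) (fun e U => ?_) (fun x U => hω.G x _)
    (fun x U => ?_) fun p hp => hω.labels (compensates_zero N r₀) hR hp.1 hp.2
  · exact (hbr e U).elim (fun he => hω.B_out e he _) (fun hd => hω.B_far e _ hd)
  · exact (hbr e U).elim (fun he => hω.B'_out e he _) (fun hd => hω.B'_far e _ hd)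
  · by_cases hx : x.1 ∈ box d N₀
    · refine hω.cuts_far x _ (Set.disjoint_left.2 ?_)
      rintro t ⟨-, -, hxt⟩ ht
      exact hxt ⟨hx, ht⟩
    · exact hω.cuts_out x hx _

/-- Resampling without parity shift keeps the configuration in `A`, since `A` ignores the box, and
makes the box fully connected. -/
theorem Pbar_le_fullyConnected {lam δ : ℝ} (hlam : 0 < lam) (hδ : 0 ≤ δ) (h : N₀ ≤ N)
    (hR : (R = .thermal ∧ r₀ = r) ∨ (R = .ground ∧ r₀ ≤ r)) (h0 : 0 ≤ r₀)
    (hpos : 0 < r₀ ∨ N₀ = 0) {A : Set (Pair d N)}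
    (hA : MeasurableSet[definedIn R r (subBox N N r \ subBox N N₀ r₀)] A) :
    (Pbar d lam δ R N r).real A ≤ (resampleConst d N₀ lam δ r₀).toReal *
      (Pbar d lam δ R N r).real (A ∩ fullyConnected d R N r N₀ r₀) := by
  classical
  have hr : r₀ ≤ r := by rcases hR with ⟨_, h⟩ | ⟨_, h⟩ <;> linarith
  have hr0 : 0 ≤ r := h0.trans hr
  have hm : ∀ (M : ℕ) (s : ℝ) (x : Site d N), MeasurableSet {t | (x, t) ∈ subBox N M s} :=
    fun M s x => (MeasurableSet.const (x.1 ∈ box d M)).inter (measurableSet_timeI s)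
  have hAm : MeasurableSet A := definedIn_le (K := subBox N N r \ subBox N N₀ r₀)
    (fun x => (hm N r x).diff (hm N₀ r₀ x)) A hA
  obtain ⟨V, hVm, hFV, hV⟩ := exists_majorant (R := R) hlam hδ h hpos h0 hr (fun _ => 0)
    (E := A ∩ fullyConnected d R N r N₀ r₀) (fun ω ω' hs hω =>
      ⟨(mem_iff_of_definedIn hA (fun e U => hs.B e _) (fun e U => hs.B' e _) (fun e U => hs.G e _)
        (fun e U => hs.cuts e _) (fun p _ => by
          simp only [Pair.Odd₁, Pair.Odd₂, hs.S, hs.S', hs.coin, hs.coin', and_self])).2 hω.1,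
        hs.mem_fullyConnected hω.2⟩)
    (F := A.indicator (srcWeight δ R r 0 0)) (fun ω ω' hω hp => by
      by_cases hωA : ω ∈ A
      · rw [indicator_of_mem hωA]
        exact ⟨⟨(hω.mem_iff hR hA).2 hωA, hω.mem_fullyConnected hr⟩,
          hω.srcWeight_le (compensates_zero N r₀) hδ h0 hR⟩
      · rw [indicator_of_notMem hωA] at hp
        exact absurd hp (lt_irrefl 0))
  have key : weightedLaw d lam δ R N r A ≤ resampleConst d N₀ lam δ r₀ *
      weightedLaw d lam δ R N r (A ∩ fullyConnected d R N r N₀ r₀) := by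
    refine le_trans ?_ hV
    rw [weightedLaw_apply hlam.le hδ hr0 hAm]
    refine (setLIntegral_mono hVm fun p hp => ?_).trans (setLIntegral_le_lintegral _ _)
    have := hFV p
    rwa [indicator_of_mem (show toPair p ∈ A from hp)] at this
  have key2 := ENNReal.toReal_mono (ENNReal.mul_ne_top (resampleConst_ne_top hlam hpos)
    (weightedLaw_ne_top hlam.le hδ hr0 _)) key
  rw [ENNReal.toReal_mul] at key2
  rw [Pbar_real, Pbar_real]
  calc _ ≤ _ := mul_le_mul_of_nonneg_left key2 (by positivity)
    _ = _ := by ring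

/-- A box containing `x`, and contained in every box that contains `x`. -/
lemma exists_box (x : Lattice d) : ∃ M : ℕ, ∀ N, x ∈ box d N ↔ M ≤ N := by
  refine ⟨Finset.univ.sup fun i => (x i).natAbs, fun N => ?_⟩
  simp only [box, Fintype.mem_piFinset, Finset.mem_Icc, Finset.sup_le_iff, Finset.mem_univ,
    true_implies]
  exact forall_congr' fun i => by omega

end
end TFIM

/-! ### The proposition in both regimes. -/

open MeasureTheory TFIM in
theorem mainTheorem7 (d : ℕ) (hd : 1 ≤ d) (lam δ : ℝ) (hlam : 0 < lam) (hδ : 0 < δ) :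
    -- positive temperature: `r = r₀ = β`
    (∀ β : ℝ, 0 < β →
      (∀ (x : Lattice d) (t : ℝ), t ∈ timeI β → ∃ C : ℝ, ∀ N : ℕ, x ∈ box d N →
        twoPoint d lam δ .wired .periodic N β x t - twoPoint d lam δ .free .periodic N β x t
          ≤ C * (Pbar d lam δ .thermal N β).real (connGhost d .thermal N β)) ∧
      (∀ N₀ : ℕ, ∃ c : ℝ, ∀ N : ℕ, N₀ < N → ∀ A : Set (Pair d N),
        MeasurableSet[definedIn .thermal β (subBox N N β \ subBox N N₀ β)] A →
        (Pbar d lam δ .thermal N β).real A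
          ≤ c * (Pbar d lam δ .thermal N β).real (A ∩ fullyConnected d .thermal N β N₀ β))) ∧
    -- ground state: `r = 2N`, `r₀ = 2N₀`
    (∀ (x : Lattice d) (t : ℝ), ∃ C : ℝ, ∀ N : ℕ, 1 ≤ N → x ∈ box d N → t ∈ timeI (2 * N) →
      twoPoint d lam δ .wired .wired N (2 * N) x t - twoPoint d lam δ .free .free N (2 * N) x t
        ≤ C * (Pbar d lam δ .ground N (2 * N)).real (connGhost d .ground N (2 * N))) ∧
    (∀ N₀ : ℕ, ∃ c : ℝ, ∀ N : ℕ, N₀ < N → ∀ A : Set (Pair d N),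
      MeasurableSet[definedIn .ground (2 * N) (subBox N N (2 * N) \ subBox N N₀ (2 * N₀))] A →
      (Pbar d lam δ .ground N (2 * N)).real A
        ≤ c * (Pbar d lam δ .ground N (2 * N)).real
            (A ∩ fullyConnected d .ground N (2 * N) N₀ (2 * N₀))) := by
  refine ⟨fun β hβ => ⟨fun x t ht => ?_, fun N₀ => ?_⟩, fun x t => ?_, fun N₀ => ?_⟩
  -- The resampled box is the smallest one containing `x`, so the constant does not depend on `N`.
  · obtain ⟨M, hM⟩ := exists_box x
    exact ⟨_, fun N hN => twoPoint_sub_le (R := .thermal) hlam hδ.le ((hM N).1 hN)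
      (Or.inl ⟨rfl, rfl⟩) hβ ((hM M).2 le_rfl) ht⟩
  · exact ⟨_, fun N hN A hA => Pbar_le_fullyConnected hlam hδ.le hN.le (Or.inl ⟨rfl, rfl⟩) hβ.le
      (Or.inl hβ) hA⟩
  · obtain ⟨M, hM⟩ := exists_box x
    -- The height `max (2 * |t|) 1` is positive, its interval contains `t`, and it is at most `2 *
    -- N` since `|t| ≤ N` and `1 ≤ N`.
    have hle : 2 * |t| ≤ max (2 * |t|) 1 := le_max_left _ _
    refine ⟨_, fun N hN hx ht => twoPoint_sub_le (R := .ground) (r₀ := max (2 * |t|) 1) hlam hδ.le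
      ((hM N).1 hx) (Or.inr ⟨rfl, max_le ?_ ?_⟩) (by positivity) ((hM M).2 le_rfl)
      ⟨by linarith [neg_abs_le t], by linarith [le_abs_self t]⟩⟩
    · have h1 := ht.1
      have h2 := ht.2
      have : |t| ≤ N := abs_le.2 ⟨by linarith, by linarith⟩
      linarith
    · have : (1 : ℝ) ≤ N := by exact_mod_cast hN
      linarith
  · refine ⟨_, fun N hN A hA => Pbar_le_fullyConnected hlam hδ.le hN.le
      (Or.inr ⟨rfl, ?_⟩) (by positivity) ?_ hA⟩
    · have : (N₀ : ℝ) ≤ N := by exact_mod_cast hN.le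
      linarith
    -- For `N₀ = 0` also `r₀ = 0`, which is the degenerate case of `innerBound_ne_zero`.
    · rcases Nat.eq_zero_or_pos N₀ with h | h
      · exact Or.inr h
      · exact Or.inl (by positivity)
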